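/- **Setting.** Let $F$ be a nonarchimedean local field with finite residue field and normalized valuation $\mathrm{val}_F$, $\mathbf G$ a connected reductive $F$-group, $\mathbf S$ a maximal $F$-split torus of $\mathbf G$ with centralizer $\mathbf Z$ and normalizer $\boldsymbol{\mathcal N}$, and $\mathbf B=\mathbf Z\mathbf U$ a minimal parabolic $F$-subgroup containing $\mathbf S$, with opposite unipotent radical $\mathbf U_{\mathrm{op}}$. Write $G,Z,\mathcal N,U,U_{\mathrm{op}}$ for the groups of $F$-points. Let $\Phi$ be the set of roots of $\mathbf S$ in $\mathbf G$, $\Delta\subset\Phi^+\subset\Phi$ the simple and the positive roots with respect to $\mathbf B$, and $V_{\mathrm{ad}}=X_*(\mathbf S_{\mathrm{ad}})\otimes\mathbb R$, where $\mathbf S_{\mathrm{ad}}$ is the image of $\mathbf S$ in the adjoint group. Let $v:Z\to V_{\mathrm{ad}}$ be the homomorphism induced by $\langle\chi|_{\mathbf S},v(z)\rangle=\mathrm{val}_F(\chi(z))$ for the $F$-rational characters $\chi$ of $\mathbf Z$, and $\nu=-v$. Let $x_0$ be a special point of the apartment $x_0+V_{\mathrm{ad}}$ attached to $\mathbf S$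 in the adjoint Bruhat–Tits building. The group $\mathcal N$ acts on this apartment (identified with $V_{\mathrm{ad}}$ by $x_0\mapsto 0$), with $z\in Z$ acting as the translation by $\nu(z)$. Let $K$ be the special parahoric subgroup fixing $x_0$ (the elements of the kernel of the Kottwitz homomorphism of $G$ that fix $x_0$), $Z^0=Z\cap K$, $\Lambda=Z/Z^0$, and let $W=\mathcal N/Z^0$ be the Iwahori Weyl group; $\nu$ is also viewed as a map on $\Lambda$. Let $G'$ be the subgroup of $G$ generated by $U$ and $U_{\mathrm{op}}$, and $W^{\mathrm{aff}}\subset W$ the image of $\mathcal N\cap G'$. Let $e_\alpha$ ($\alpha\in\Phi$) be the positive integers such that $\Phi_a=\{\alpha_a=e_\alpha\alpha\mid\alpha\in\Phi\}$ is a reduced root system and $\mathcal N\cap G'$ acts on the apartment through the affine Weyl group of $\Phi_a$ (generated by the reflections $x\mapsto x-(\langle\alpha_a,x\rangle-k)\alpha_a^\vee$, $k\in\mathbb Z$). Let $S^{\mathrm{aff}}\subset W^{\mathrm{aff}}$ be the set of reflections in the walls of the antidominant alcove $\{x\mid -1<\langle\alpha_a,x\rangle<0\text{ for all }\alpha\in\Phi^+\}$,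 and $\Omega$ the normalizer of $S^{\mathrm{aff}}$ in $W$. The Bruhat order $\le$ on $W$ is defined by: $x\le y$ if and only if $x=w_1u$, $y=w_2u$ with $u\in\Omega$ and $w_1,w_2\in W^{\mathrm{aff}}$ such that $w_1\le w_2$ in the Bruhat order of the Coxeter system $(W^{\mathrm{aff}},S^{\mathrm{aff}})$. For $\alpha\in\Delta$ let $M'_\alpha$ be the group generated by the root subgroups $U_{\alpha},U_{-\alpha}$ and let $\lambda_\alpha\in\Lambda$ be the image of an element $a_\alpha\in Z\cap M'_\alpha$ with $\nu(a_\alpha)=\alpha_a^\vee$. For $x_1,x_2\in V_{\mathrm{ad}}$ write $x_1\preceq x_2$ if $x_1-x_2\in\sum_{\alpha\in\Delta}\mathbb N\alpha_a^\vee$. Let $Z^+=\{z\in Z\mid\langle\alpha,v(z)\rangle\ge0\text{ for all }\alpha\in\Delta\}$ and $\Lambda^+=Z^+/Z^0$. **Proposition.** For $\lambda_1,\lambda_2\in\Lambda^+$ the following are equivalent: 1. $\lambda_1\le\lambda_2$; 2. $\lambda_1\in\lambda_2\prod_{\alpha\in\Delta}\lambda_\alpha^{\mathbb N}$; 3. $\nu(\lambda_1)\preceq\nu(\lambda_2)$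 and $\lambda_1\in\lambda_2W^{\mathrm{aff}}$. -/

import Mathlib

open ValuativeRel

noncomputable section

namespace PadicGroup

/-! ## Linear algebraic groups over a field, as subgroups of `GL_n` over an algebraic closure -/

section AlgebraicGroups

variable (F : Type*) [Field F] {n : ℕ}

/-- The group `GL_n(R)`. -/
abbrev GLn (n : ℕ) (R : Type*) [CommRing R] := Matrix.GeneralLinearGroup (Fin n) R

/-- The inclusion `GL_n(F) → GL_n(F̄)`. -/
def incl : GLn n F →* GLn n (AlgebraicClosure F) :=
  Matrix.GeneralLinearGroup.map (algebraMap F (AlgebraicClosure F))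

variable {F}

/-- The value of a polynomial in the matrix entries at an invertible matrix. -/
def evalAt (g : GLn n (AlgebraicClosure F))
    (f : MvPolynomial (Fin n × Fin n) (AlgebraicClosure F)) : AlgebraicClosure F :=
  MvPolynomial.eval (fun ij => g ij.1 ij.2) f

/-- The ideal of polynomials in the matrix entries which vanish on a subset of `GL_n(F̄)`. -/
def vanishingIdeal (H : Set (GLn n (AlgebraicClosure F))) :
    Ideal (MvPolynomial (Fin n × Fin n) (AlgebraicClosure F)) where
  carrier := {f | ∀ g ∈ H, evalAt g f = 0}
  add_mem' := by
    intro a b ha hb g hg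
    have h1 := ha g hg
    have h2 := hb g hg
    simp only [evalAt] at h1 h2 ⊢
    rw [map_add, h1, h2, add_zero]
  zero_mem' := by
    intro g _
    simp [evalAt]
  smul_mem' := by
    intro c a ha g hg
    have h1 := ha g hg
    simp only [evalAt, smul_eq_mul, map_mul] at h1 ⊢
    rw [h1, mul_zero]

/-- Zariski closed subgroups of `GL_n(F̄)`. -/
def IsZariskiClosed (H : Subgroup (GLn n (AlgebraicClosure F))) : Prop :=
  ∀ g, (∀ f ∈ vanishingIdeal (H : Set (GLn n (AlgebraicClosure F))), evalAt g f = 0) → g ∈ H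

/-- A linear algebraic `F`-group (smooth over `F`): a Zariski closed subgroup of `GL_n(F̄)` which
is defined over `F`, i.e. whose ideal is generated by polynomials with coefficients in `F`. -/
def IsFGroup (H : Subgroup (GLn n (AlgebraicClosure F))) : Prop :=
  IsZariskiClosed H ∧
    vanishingIdeal (H : Set (GLn n (AlgebraicClosure F))) =
      Ideal.map (MvPolynomial.map (algebraMap F (AlgebraicClosure F)))
        (Ideal.comap (MvPolynomial.map (algebraMap F (AlgebraicClosure F)))
          (vanishingIdeal (H : Set (GLn n (AlgebraicClosure F)))))

/-- Zariski connected: no proper closed subgroup of finite index. -/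
def IsZariskiConnected (H : Subgroup (GLn n (AlgebraicClosure F))) : Prop :=
  ∀ H' : Subgroup (GLn n (AlgebraicClosure F)), H' ≤ H → IsZariskiClosed H' →
    H'.relIndex H ≠ 0 → H' = H

/-- Connected reductive: connected, and every closed connected unipotent normal subgroup (over the
algebraic closure) is trivial. -/
def IsConnectedReductive (H : Subgroup (GLn n (AlgebraicClosure F))) : Prop :=
  IsZariskiConnected H ∧
    ∀ R : Subgroup (GLn n (AlgebraicClosure F)), R ≤ H → IsZariskiClosed R →
      IsZariskiConnected R → (∀ h ∈ H, ∀ u ∈ R, h * u * h⁻¹ ∈ R) →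
      (∀ u ∈ R, IsNilpotent
        ((u : Matrix (Fin n) (Fin n) (AlgebraicClosure F)) - 1)) → R = ⊥

/-- An `F`-split torus: a subgroup `T` with an isomorphism `(F̄ˣ)^r ≃ T` which is given by Laurent
polynomials over `F`, and whose inverse is given by regular functions over `F`
(polynomials in the entries over `F`, divided by a power of the determinant). -/
def IsSplitTorus (T : Subgroup (GLn n (AlgebraicClosure F))) : Prop :=
  ∃ (r : ℕ) (f : (Fin r → (AlgebraicClosure F)ˣ) ≃* T),
    (∃ c : (Fin r → ℤ) →₀ Matrix (Fin n) (Fin n) F, ∀ t,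
      ((f t : GLn n (AlgebraicClosure F)) : Matrix (Fin n) (Fin n) (AlgebraicClosure F)) =
        c.sum fun m A => ((∏ i, (t i) ^ (m i) : (AlgebraicClosure F)ˣ) : AlgebraicClosure F) •
          A.map (algebraMap F (AlgebraicClosure F))) ∧
    ∀ i, ∃ (p : MvPolynomial (Fin n × Fin n) F) (d : ℕ), ∀ s : T,
      ((f.symm s i : (AlgebraicClosure F)ˣ) : AlgebraicClosure F) *
          (Matrix.det ((s : GLn n (AlgebraicClosure F)) :
            Matrix (Fin n) (Fin n) (AlgebraicClosure F))) ^ d =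
        evalAt (s : GLn n (AlgebraicClosure F))
          (MvPolynomial.map (algebraMap F (AlgebraicClosure F)) p)

/-- `T` is a maximal `F`-split torus of `G`. -/
def IsMaximalSplitTorus (G T : Subgroup (GLn n (AlgebraicClosure F))) : Prop :=
  IsSplitTorus T ∧ T ≤ G ∧ ∀ T', IsSplitTorus T' → T' ≤ G → T ≤ T' → T' = T

/-- The homomorphism `lam` from the multiplicative group to `GL_n` is the Laurent polynomial
`∑ t ^ k • c k`, with matrix coefficients in an extension `E` of `F` inside `F̄`. -/
def HasCoeffs {E : Type*} [Field E] [Algebra E (AlgebraicClosure F)]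
    (lam : (AlgebraicClosure F)ˣ →* GLn n (AlgebraicClosure F))
    (c : ℤ →₀ Matrix (Fin n) (Fin n) E) : Prop :=
  ∀ t, (lam t : Matrix (Fin n) (Fin n) (AlgebraicClosure F)) =
    c.sum fun k A => ((t ^ k : (AlgebraicClosure F)ˣ) : AlgebraicClosure F) •
      A.map (algebraMap E (AlgebraicClosure F))

/-- `lam` is an algebraic cocharacter of `GL_n` defined over `E`. -/
def IsCochar (E : Type*) [Field E] [Algebra E (AlgebraicClosure F)]
    (lam : (AlgebraicClosure F)ˣ →* GLn n (AlgebraicClosure F)) : Prop :=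
  ∃ c : ℤ →₀ Matrix (Fin n) (Fin n) E, HasCoeffs lam c

/-- `lam(t) g lam(t)⁻¹` is a polynomial in `t` congruent to `1` modulo `t ^ m`. For `m = 1` this
says `lim_{t → 0} lam(t) g lam(t)⁻¹ = 1`. -/
def Contracts (lam : (AlgebraicClosure F)ˣ →* GLn n (AlgebraicClosure F)) (m : ℕ)
    (g : GLn n (AlgebraicClosure F)) : Prop :=
  ∃ P : Matrix (Fin n) (Fin n) (Polynomial (AlgebraicClosure F)), ∀ t : (AlgebraicClosure F)ˣ,
    ((lam t * g * (lam t)⁻¹ : GLn n (AlgebraicClosure F)) :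
        Matrix (Fin n) (Fin n) (AlgebraicClosure F)) =
      1 + (t : AlgebraicClosure F) ^ m • P.map (Polynomial.eval (t : AlgebraicClosure F))

/-- The `F`-points of the Lie algebra of `G`: the tangent space at `1`. -/
def lieAlg (G : Subgroup (GLn n (AlgebraicClosure F))) :
    Submodule F (Matrix (Fin n) (Fin n) F) where
  carrier := {X | ∀ f ∈ vanishingIdeal (G : Set (GLn n (AlgebraicClosure F))),
    ∑ ij : Fin n × Fin n, evalAt 1 (MvPolynomial.pderiv ij f) *
      algebraMap F (AlgebraicClosure F) (X ij.1 ij.2) = 0}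
  add_mem' := by
    intro X Y hX hY f hf
    simp only [Matrix.add_apply, map_add, mul_add, Finset.sum_add_distrib]
    rw [hX f hf, hY f hf, add_zero]
  zero_mem' := by
    intro f _
    simp
  smul_mem' := by
    intro a X hX f hf
    have := hX f hf
    simp only [Matrix.smul_apply, smul_eq_mul, map_mul]
    calc _ = algebraMap F (AlgebraicClosure F) a *
          ∑ ij : Fin n × Fin n, evalAt 1 (MvPolynomial.pderiv ij f) *
            algebraMap F (AlgebraicClosure F) (X ij.1 ij.2) := by
            rw [Finset.mul_sum]; exact Finset.sum_congr rfl fun _ _ => by ring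
      _ = 0 := by rw [this, mul_zero]

/-- The `F`-points of the weight space of the character `α` of `S` in the Lie algebra of `G`. -/
def weightSpace (G S : Subgroup (GLn n (AlgebraicClosure F))) (α : S →* (AlgebraicClosure F)ˣ) :
    Submodule F (Matrix (Fin n) (Fin n) F) where
  carrier := {X | X ∈ lieAlg G ∧ ∀ s : S,
    (s : GLn n (AlgebraicClosure F)).1 * X.map (algebraMap F (AlgebraicClosure F)) *
        ((s : GLn n (AlgebraicClosure F))⁻¹).1 =
      (α s : AlgebraicClosure F) • X.map (algebraMap F (AlgebraicClosure F))}
  add_mem' := by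
    rintro X Y ⟨hX, hX'⟩ ⟨hY, hY'⟩
    refine ⟨add_mem hX hY, fun s => ?_⟩
    rw [Matrix.map_add _ (map_add _), mul_add, add_mul, hX' s, hY' s, smul_add]
  zero_mem' := by
    refine ⟨zero_mem _, fun s => ?_⟩
    rw [Matrix.map_zero _ (map_zero _)]
    simp
  smul_mem' := by
    rintro a X ⟨hX, hX'⟩
    refine ⟨Submodule.smul_mem _ a hX, fun s => ?_⟩
    have h : (a • X).map (algebraMap F (AlgebraicClosure F)) =
        algebraMap F (AlgebraicClosure F) a • X.map (algebraMap F (AlgebraicClosure F)) := by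
      ext i j
      simp
    rw [h, Matrix.mul_smul, Matrix.smul_mul, hX' s, smul_comm]

/-- The roots of `S` in `G`: the nontrivial weights of `S` in the Lie algebra of `G`. -/
def IsRoot (G S : Subgroup (GLn n (AlgebraicClosure F))) (α : S →* (AlgebraicClosure F)ˣ) : Prop :=
  α ≠ 1 ∧ weightSpace G S α ≠ ⊥

end AlgebraicGroups

/-! ## The local field -/

section LocalField

variable (F : Type*) [Field F] [ValuativeRel F] [TopologicalSpace F]
  [IsNonarchimedeanLocalField F] {n : ℕ}

variable {F} in
/-- The normalized additive valuation of `F` (with junk value `0` at `0`). -/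
def valF (x : F) : ℤ :=
  -(WithZero.log (IsNonarchimedeanLocalField.valueGroupWithZeroIsoInt F (valuation F x)))

/-- The maximal unramified extension of `F` in `F̄`, generated by the roots of unity of order prime
to the residue characteristic. -/
def maxUnramified : IntermediateField F (AlgebraicClosure F) :=
  IntermediateField.adjoin F {x | ∃ m : ℕ, 0 < m ∧ (m : 𝓀[F]) ≠ 0 ∧ x ^ m = 1}

/-- `x` is a unit of the ring of integers of `F̄`. -/
def IsUnitInteger (x : AlgebraicClosure F) : Prop :=
  x ≠ 0 ∧ IsIntegral 𝒪[F] x ∧ IsIntegral 𝒪[F] x⁻¹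

/-- The matrix has its entries in `E`. -/
def HasEntriesIn (E : IntermediateField F (AlgebraicClosure F))
    (g : GLn n (AlgebraicClosure F)) : Prop :=
  ∀ i j, g i j ∈ E

variable {F}

/-- The points over the maximal unramified extension of the unipotent groups
`{g | lim_{t → 0} lam(t) g lam(t)⁻¹ = 1}` attached to the cocharacters `lam` of `G` defined over the
maximal unramified extension. They generate the image of the simply connected cover of the derived
group. -/
def unipotentGens (G : Subgroup (GLn n (AlgebraicClosure F))) :
    Set (GLn n (AlgebraicClosure F)) :=
  {g | g ∈ G ∧ HasEntriesIn F (maxUnramified F) g ∧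
    ∃ lam : (AlgebraicClosure F)ˣ →* GLn n (AlgebraicClosure F),
      IsCochar (maxUnramified F) lam ∧ (∀ t, lam t ∈ G) ∧ Contracts lam 1 g}

/-- The images of the units of induced tori: `L` is a finite Galois extension of the maximal
unramified extension `E`, `mu` is a cocharacter of `G` over `L` whose Galois conjugates commute with
each other (equivalently, a homomorphism over `E` from the torus `Res_{L/E} 𝔾_m` to `G`), `x` is a
unit of the ring of integers of `L`, and the element is `∏_σ σ(mu(x))`. For a torus these are the
norms of the bounded elements over a splitting field, i.e. the kernel of the
Kottwitz homomorphism of the torus. -/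
def inducedTorusGens (G : Subgroup (GLn n (AlgebraicClosure F))) :
    Set (GLn n (AlgebraicClosure F)) :=
  {g | ∃ (L : IntermediateField (maxUnramified F) (AlgebraicClosure F))
      (_ : FiniteDimensional (maxUnramified F) L) (_ : IsGalois (maxUnramified F) L)
      (mu : (AlgebraicClosure F)ˣ →* GLn n (AlgebraicClosure F))
      (c : ℤ →₀ Matrix (Fin n) (Fin n) L) (x : L) (l : List (L ≃ₐ[maxUnramified F] L)),
      HasCoeffs mu c ∧ (∀ t, mu t ∈ G) ∧
      (∀ (σ : L ≃ₐ[maxUnramified F] L) (k m : ℤ), Commute (c k) ((c m).map σ)) ∧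
      IsUnitInteger F (x : AlgebraicClosure F) ∧
      l.Nodup ∧ (∀ σ, σ ∈ l) ∧
      (g : Matrix (Fin n) (Fin n) (AlgebraicClosure F)) =
        ((l.map fun σ : L ≃ₐ[maxUnramified F] L =>
            (c.sum fun k A => x ^ k • A).map σ).prod).map
          (algebraMap L (AlgebraicClosure F))}

/-- The kernel of the Kottwitz homomorphism of `G` over the maximal unramified extension `E` of
`F`: the normal subgroup of `G(E)` generated by the image of the simply connected cover of
the derived group and by the kernels of the Kottwitz homomorphisms of the tori in `G`. -/
def kottwitzKernel (G : Subgroup (GLn n (AlgebraicClosure F))) :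
    Subgroup (GLn n (AlgebraicClosure F)) :=
  Subgroup.closure {y | ∃ g ∈ G, HasEntriesIn F (maxUnramified F) g ∧
    ∃ x ∈ unipotentGens G ∪ inducedTorusGens G, y = g * x * g⁻¹}

end LocalField

/-! ## The triple `(G, S, B)` -/

/-- A connected reductive `F`-group `G`, a maximal `F`-split torus `S` of `G`, and a minimal
parabolic `F`-subgroup `B` containing `S`. The minimal parabolic `F`-subgroups containing `S` are
the groups `{g ∈ G | lim_{t → 0} lam(t) g lam(t)⁻¹ exists}` for the cocharacters `lam` of `S` which
lie on no root hyperplane; `B` is given by such a `lam`. -/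
structure ReductiveTriple (F : Type*) [Field F] (n : ℕ) where
  G : Subgroup (GLn n (AlgebraicClosure F))
  isFGroup : IsFGroup G
  isConnectedReductive : IsConnectedReductive G
  S : Subgroup (GLn n (AlgebraicClosure F))
  isMaximalSplitTorus : IsMaximalSplitTorus G S
  lam : (AlgebraicClosure F)ˣ →* S
  isCochar : IsCochar F (S.subtype.comp lam)
  regular : ∀ α, IsRoot G S α → α.comp lam ≠ 1

namespace ReductiveTriple

section Algebraic

variable {F : Type*} [Field F] {n : ℕ} (D : ReductiveTriple F n)

/-- Homomorphisms `S → 𝔾_m`; the roots of `S` are among them. -/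
abbrev Char := D.S →* (AlgebraicClosure F)ˣ

/-- The set `Φ` of roots of `S` in `G`, as a type. -/
abbrev Root := {α : D.Char // IsRoot D.G D.S α}

/-- The normalizer of `S`, on `F`-points. -/
def N : Subgroup (GLn n F) :=
  (D.G ⊓ Subgroup.normalizer (D.S : Set (GLn n (AlgebraicClosure F)))).comap (incl F)

/-- The centralizer of `S`, on `F`-points. -/
def Z : Subgroup (GLn n F) :=
  (D.G ⊓ Subgroup.centralizer (D.S : Set (GLn n (AlgebraicClosure F)))).comap (incl F)

/-- `U = 𝐔(F)`, where `𝐔` is the unipotent radical of `B`. -/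
def U : Set (GLn n F) :=
  {g | incl F g ∈ D.G ∧ Contracts (D.S.subtype.comp D.lam) 1 (incl F g)}

/-- `U_op = 𝐔_op(F)`, for the unipotent radical `𝐔_op` of the parabolic subgroup opposite to
`B` with respect to the centralizer of `S`. -/
def Uop : Set (GLn n F) :=
  {g | incl F g ∈ D.G ∧
    Contracts ((D.S.subtype.comp D.lam).comp (invMonoidHom : (AlgebraicClosure F)ˣ →* _)) 1
      (incl F g)}

/-- The group `G'` generated by `U` and `U_op`. -/
def G' : Subgroup (GLn n F) := Subgroup.closure (D.U ∪ D.Uop)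

/-- The root subgroup `U_α` of `G = 𝐆(F)`, with Lie algebra `𝔤_α + 𝔤_{2α}`: the elements `g` such
that `mu(t) g mu(t)⁻¹` is a polynomial in `t`, congruent to `1` modulo `t ^ ⟨α, mu⟩`, for all the
cocharacters `mu` of `S` with `⟨α, mu⟩ > 0`. -/
def rootSubgroup (α : D.Char) : Set (GLn n F) :=
  {g | incl F g ∈ D.G ∧ ∀ mu : (AlgebraicClosure F)ˣ →* D.S,
    IsCochar F (D.S.subtype.comp mu) → ∀ m : ℕ, 0 < m → (∀ t, α (mu t) = t ^ m) →
      Contracts (D.S.subtype.comp mu) m (incl F g)}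

/-- The group `M'_α` generated by `U_α` and `U_{-α}`. -/
def M' (α : D.Char) : Subgroup (GLn n F) :=
  Subgroup.closure (D.rootSubgroup α ∪ D.rootSubgroup α⁻¹)

/-- The elements of `N` which lie in the group generated by `Z`, `U_α`, `U_{-α}`, but not in `Z`.
This is the coset of `Z` in `N` which maps to the reflection `s_α` in the Weyl group `N / Z`. -/
def reflectionCoset (α : D.Char) : Set (GLn n F) :=
  {g | g ∈ D.N ∧ g ∉ D.Z ∧
    g ∈ Subgroup.closure ((D.Z : Set (GLn n F)) ∪ D.rootSubgroup α ∪ D.rootSubgroup α⁻¹)}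

/-- The roots which are positive with respect to `B`. -/
def IsPositive (α : D.Root) : Prop :=
  ∃ m : ℕ, 0 < m ∧ ∀ t, α.1 (D.lam t) = t ^ m

/-- `Δ` is the set of simple roots in the set of positive roots: it consists of positive roots,
it is linearly independent over `ℤ`, and every positive root is a sum of elements of `Δ`
(characters are written multiplicatively). -/
def IsSimpleRoots (Δ : Set D.Root) : Prop :=
  (∀ α ∈ Δ, D.IsPositive α) ∧
    (∀ c : Δ →₀ ℤ, c.prod (fun α k => (α.1.1 : D.Char) ^ k) = 1 → c = 0) ∧
    ∀ β, D.IsPositive β → β.1 ∈ Submonoid.closure {χ : D.Char | ∃ α ∈ Δ, χ = α.1}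

/-- The root lattice, as a (multiplicative) group of characters of `S`. -/
def rootLattice : Subgroup D.Char := Subgroup.closure {χ | IsRoot D.G D.S χ}

/-- `V_ad = X_*(S_ad) ⊗ ℝ`, where `S_ad` is the image of `S` in the adjoint group, realized as
the dual `Hom(ℤΦ, ℝ)` of the root lattice. -/
abbrev Vad := Additive D.rootLattice →+ ℝ

/-- A root, as a linear form on `V_ad`. -/
def form (α : D.Root) : Module.Dual ℝ D.Vad where
  toFun x := x (Additive.ofMul ⟨α.1, Subgroup.subset_closure α.2⟩)
  map_add' _ _ := rfl
  map_smul' _ _ := rfl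

/-- The inner automorphism `X ↦ g X g⁻¹` of the algebra of matrices. -/
def conj (g : GLn n F) : Matrix (Fin n) (Fin n) F ≃ₗ[F] Matrix (Fin n) (Fin n) F where
  toFun X := g.1 * X * (g⁻¹).1
  invFun X := (g⁻¹).1 * X * g.1
  map_add' X Y := by rw [mul_add, add_mul]
  map_smul' a X := by simp
  left_inv X := by
    have h : (g⁻¹).1 * g.1 = 1 := g.inv_mul
    simp only [mul_assoc, h, mul_one]
    rw [← mul_assoc, h, one_mul]
  right_inv X := by
    have h : g.1 * (g⁻¹).1 = 1 := g.mul_inv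
    simp only [mul_assoc, h, mul_one]
    rw [← mul_assoc, h, one_mul]

lemma conj_mul (g h : GLn n F) (X : Matrix (Fin n) (Fin n) F) :
    conj (g * h) X = conj g (conj h X) := by
  simp [conj, mul_assoc]

lemma conj_inv_conj (g : GLn n F) (X : Matrix (Fin n) (Fin n) F) :
    conj g⁻¹ (conj g X) = X := by
  rw [← conj_mul]
  simp [conj]

lemma conj_conj_inv (g : GLn n F) (X : Matrix (Fin n) (Fin n) F) :
    conj g (conj g⁻¹ X) = X := by
  rw [← conj_mul]
  simp [conj]

/-- The polynomial map `x ↦ g x g⁻¹` in coordinates. -/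
def conjPoly (g : GLn n (AlgebraicClosure F)) (kl : Fin n × Fin n) :
    MvPolynomial (Fin n × Fin n) (AlgebraicClosure F) :=
  ∑ ij : Fin n × Fin n, MvPolynomial.C (g kl.1 ij.1 * g⁻¹ ij.2 kl.2) * MvPolynomial.X ij

lemma evalAt_conjPoly (g h : GLn n (AlgebraicClosure F)) (kl : Fin n × Fin n) :
    evalAt h (conjPoly g kl) = (g * h * g⁻¹) kl.1 kl.2 := by
  simp only [evalAt, conjPoly, map_sum, map_mul, MvPolynomial.eval_C, MvPolynomial.eval_X,
    Matrix.GeneralLinearGroup.coe_mul, Matrix.mul_apply, Fintype.sum_prod_type, Finset.sum_mul]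
  rw [Finset.sum_comm]
  exact Finset.sum_congr rfl fun _ _ => Finset.sum_congr rfl fun _ _ => by ring

lemma evalAt_aeval_conjPoly (g h : GLn n (AlgebraicClosure F))
    (f : MvPolynomial (Fin n × Fin n) (AlgebraicClosure F)) :
    evalAt h (MvPolynomial.aeval (conjPoly g) f) = evalAt (g * h * g⁻¹) f := by
  induction f using MvPolynomial.induction_on with
  | C a => simp [evalAt, MvPolynomial.algebraMap_eq]
  | add p q hp hq =>
    simp only [evalAt, map_add] at hp hq ⊢
    rw [hp, hq]
  | mul_X p i hp =>
    have h1 := evalAt_conjPoly g h i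
    simp only [evalAt, map_mul, MvPolynomial.aeval_X, MvPolynomial.eval_X] at hp h1 ⊢
    rw [hp, h1]

lemma tangent_conj (g : GLn n F) (X : Matrix (Fin n) (Fin n) F)
    (f : MvPolynomial (Fin n × Fin n) (AlgebraicClosure F)) :
    ∑ ij : Fin n × Fin n,
        evalAt 1 (MvPolynomial.pderiv ij (MvPolynomial.aeval (conjPoly (incl F g)) f)) *
        algebraMap F (AlgebraicClosure F) (X ij.1 ij.2) =
      ∑ ij : Fin n × Fin n, evalAt 1 (MvPolynomial.pderiv ij f) *
        algebraMap F (AlgebraicClosure F) (conj g X ij.1 ij.2) := by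
  induction f using MvPolynomial.induction_on with
  | C a => simp [evalAt, MvPolynomial.algebraMap_eq]
  | add p q hp hq =>
    simp only [evalAt, map_add, add_mul, Finset.sum_add_distrib] at hp hq ⊢
    rw [hp, hq]
  | mul_X p i hp =>
    have h0 := evalAt_aeval_conjPoly (incl F g) 1 p
    have h1 := evalAt_conjPoly (incl F g) 1 i
    have h2 : ∑ ij : Fin n × Fin n, evalAt 1 (MvPolynomial.pderiv ij (conjPoly (incl F g) i)) *
        algebraMap F (AlgebraicClosure F) (X ij.1 ij.2) =
        algebraMap F (AlgebraicClosure F) (conj g X i.1 i.2) := by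
      have : ∀ ij, evalAt 1 (MvPolynomial.pderiv ij (conjPoly (incl F g) i)) =
          incl F g i.1 ij.1 * (incl F g)⁻¹ ij.2 i.2 := by
        intro ij
        simp [evalAt, conjPoly, MvPolynomial.pderiv_X, Pi.single_apply]
      simp only [this]
      have e1 : ∀ a b, incl F g a b = algebraMap F (AlgebraicClosure F) (g a b) := fun _ _ => rfl
      have e2 : ∀ a b, (incl F g)⁻¹ a b = algebraMap F (AlgebraicClosure F) (g⁻¹ a b) := by
        intro a b
        rw [← map_inv]
        rfl
      simp only [e1, e2, conj, LinearEquiv.coe_mk, LinearMap.coe_mk, AddHom.coe_mk,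
        Matrix.mul_apply, map_sum, map_mul, Fintype.sum_prod_type, Finset.sum_mul]
      rw [Finset.sum_comm]
      exact Finset.sum_congr rfl fun _ _ => Finset.sum_congr rfl fun _ _ => by ring
    simp only [mul_one, mul_inv_cancel] at h0 h1
    simp only [evalAt, map_mul, MvPolynomial.aeval_X, Derivation.leibniz, smul_eq_mul, map_add,
      MvPolynomial.eval_X, add_mul, Finset.sum_add_distrib] at hp h0 h1 h2 ⊢
    rw [h0, h1]
    have hl : ∀ (c : AlgebraicClosure F) (u v : Fin n × Fin n → AlgebraicClosure F),
        ∑ ij, c * u ij * v ij = c * ∑ ij, u ij * v ij := by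
      intro c u v
      rw [Finset.mul_sum]
      exact Finset.sum_congr rfl fun _ _ => by ring
    rw [hl, hl, hl, hl, hp, h2]
    congr 2
    simp [MvPolynomial.pderiv_X, Pi.single_apply]

variable {D}

lemma conj_mem_lieAlg {G : Subgroup (GLn n (AlgebraicClosure F))} {g : GLn n F}
    (hg : incl F g ∈ G) {X : Matrix (Fin n) (Fin n) F} (hX : X ∈ lieAlg G) :
    conj g X ∈ lieAlg G := by
  intro f hf
  rw [← tangent_conj]
  refine hX _ fun h hh => ?_
  rw [evalAt_aeval_conjPoly]
  exact hf _ (mul_mem (mul_mem hg hh) (inv_mem hg))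

lemma inv_mul_mul_mem (g : D.N) {s : GLn n (AlgebraicClosure F)} (hs : s ∈ D.S) :
    (incl F g.1)⁻¹ * s * incl F g.1 ∈ D.S := by
  have h1 := (Subgroup.mem_normalizer_iff.1 (inv_mem g.2.2) s).1 hs
  simpa using h1

/-- The character `s ↦ α(g⁻¹ s g)` of `S`, for `g` in the normalizer of `S`. -/
def conjChar (g : D.N) (α : D.Char) : D.Char where
  toFun s := α ⟨(incl F g.1)⁻¹ * s * incl F g.1, inv_mul_mul_mem g s.2⟩
  map_one' := by
    rw [← map_one α]
    congr 1
    apply Subtype.ext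
    simp
  map_mul' s t := by
    rw [← map_mul]
    congr 1
    apply Subtype.ext
    simp only [Subgroup.coe_mul]
    group

lemma conjChar_apply (g : D.N) (α : D.Char) (s t : D.S)
    (h : (t : GLn n (AlgebraicClosure F)) = (incl F g.1)⁻¹ * s * incl F g.1) :
    conjChar g α s = α t := by
  change α _ = α _
  congr 1
  exact Subtype.ext h.symm

lemma conj_mem_weightSpace (g : D.N) (α : D.Char) {X : Matrix (Fin n) (Fin n) F}
    (hX : X ∈ weightSpace D.G D.S α) :
    conj g.1 X ∈ weightSpace D.G D.S (conjChar g α) := by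
  refine ⟨conj_mem_lieAlg g.2.1 hX.1, fun s => ?_⟩
  have ht := inv_mul_mul_mem g s.2
  rw [conjChar_apply g α s ⟨_, ht⟩ rfl]
  have h2 := hX.2 ⟨_, ht⟩
  set Y := X.map (algebraMap F (AlgebraicClosure F))
  have h3 : (conj g.1 X).map (algebraMap F (AlgebraicClosure F)) =
      (incl F g.1).1 * Y * ((incl F g.1)⁻¹).1 := by
    rw [← map_inv]
    simp only [conj, LinearEquiv.coe_mk, LinearMap.coe_mk, AddHom.coe_mk, Matrix.map_mul]
    rfl
  rw [h3]
  have h4 : (s : GLn n (AlgebraicClosure F)).1 * (incl F g.1).1 =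
      (incl F g.1).1 * ((incl F g.1)⁻¹ * s * incl F g.1).1 := by
    rw [← Units.val_mul, ← Units.val_mul]
    congr 1
    group
  have h5 : ((incl F g.1)⁻¹).1 * ((s : GLn n (AlgebraicClosure F))⁻¹).1 =
      (((incl F g.1)⁻¹ * s * incl F g.1)⁻¹).1 * ((incl F g.1)⁻¹).1 := by
    rw [← Units.val_mul, ← Units.val_mul]
    congr 1
    group
  calc _ = ((s : GLn n (AlgebraicClosure F)).1 * (incl F g.1).1) * Y *
        (((incl F g.1)⁻¹).1 * ((s : GLn n (AlgebraicClosure F))⁻¹).1) := by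
          simp only [mul_assoc]
    _ = (incl F g.1).1 * (((incl F g.1)⁻¹ * s * incl F g.1).1 * Y *
        (((incl F g.1)⁻¹ * s * incl F g.1)⁻¹).1) * ((incl F g.1)⁻¹).1 := by
          rw [h4, h5]
          simp only [mul_assoc]
    _ = _ := by
          rw [h2, Matrix.mul_smul, Matrix.smul_mul]

lemma conjChar_mul (g h : D.N) (α : D.Char) :
    conjChar (g * h) α = conjChar g (conjChar h α) := by
  ext s
  have ht := inv_mul_mul_mem g s.2
  have ht' := inv_mul_mul_mem h ht
  rw [conjChar_apply g _ s ⟨_, ht⟩ rfl, conjChar_apply h _ ⟨_, ht⟩ ⟨_, ht'⟩ rfl,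
    conjChar_apply (g * h) α s ⟨_, ht'⟩ (by simp [mul_assoc])]

lemma conjChar_of_mem_Z (g : D.N) (hg : g.1 ∈ D.Z) (α : D.Char) : conjChar g α = α := by
  ext s
  rw [conjChar_apply g α s s]
  have h1 := Subgroup.mem_centralizer_iff.1 hg.2 s s.2
  rw [mul_assoc, h1]
  group

lemma conjChar_isRoot (g : D.N) (α : D.Root) : IsRoot D.G D.S (conjChar g α.1) := by
  constructor
  · intro h
    apply α.2.1
    have h1 : conjChar g⁻¹ (conjChar g α.1) = α.1 := by
      rw [← conjChar_mul, inv_mul_cancel]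
      exact conjChar_of_mem_Z 1 (one_mem _) _
    rw [h] at h1
    rw [← h1]
    ext s
    simp [conjChar]
  · intro h
    obtain ⟨X, hX, hX0⟩ := (Submodule.ne_bot_iff _).1 α.2.2
    have h1 := conj_mem_weightSpace g _ hX
    rw [h, Submodule.mem_bot] at h1
    exact hX0 ((conj g.1).map_eq_zero_iff.1 h1)

/-- The action of `N` on the set of roots. -/
def conjRoot (g : D.N) (α : D.Root) : D.Root := ⟨conjChar g α.1, conjChar_isRoot g α⟩

lemma Z_le_N : D.Z ≤ D.N := by
  intro g hg
  exact ⟨hg.1, Subgroup.centralizer_le_normalizer _ hg.2⟩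

variable (D) in
/-- The determinant of `Ad(z)` on the `F`-points of the weight space of `α`, for `z` which stabilizes
it. On `Z` this is an `F`-rational character which restricts on `S` to the character
`α ^ dim 𝔤_α`. -/
def adDet (α : D.Char) (z : GLn n F) : F := by
  classical
  exact if h : ∀ X ∈ weightSpace D.G D.S α, (conj z).toLinearMap X ∈ weightSpace D.G D.S α then
    LinearMap.det ((conj z).toLinearMap.restrict h) else 1

lemma adDet_of_forall {α : D.Char} {z : GLn n F}
    (h : ∀ X ∈ weightSpace D.G D.S α, (conj z).toLinearMap X ∈ weightSpace D.G D.S α) :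
    D.adDet α z = LinearMap.det ((conj z).toLinearMap.restrict h) := dif_pos h

lemma conj_mem_of_mem_Z {z : GLn n F} (hz : z ∈ D.Z) (α : D.Char) :
    ∀ X ∈ weightSpace D.G D.S α, (conj z).toLinearMap X ∈ weightSpace D.G D.S α := by
  intro X hX
  have := conj_mem_weightSpace ⟨z, Z_le_N hz⟩ α hX
  rwa [conjChar_of_mem_Z _ hz] at this

lemma adDet_mul {z w : GLn n F} (hz : z ∈ D.Z) (hw : w ∈ D.Z) (α : D.Char) :
    D.adDet α (z * w) = D.adDet α z * D.adDet α w := by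
  rw [adDet_of_forall (conj_mem_of_mem_Z (mul_mem hz hw) α),
    adDet_of_forall (conj_mem_of_mem_Z hz α), adDet_of_forall (conj_mem_of_mem_Z hw α),
    ← LinearMap.det_comp]
  congr 1
  refine LinearMap.ext fun X => Subtype.ext ?_
  exact conj_mul z w X

lemma adDet_one (α : D.Char) : D.adDet α 1 = 1 := by
  rw [adDet_of_forall (conj_mem_of_mem_Z (one_mem _) α)]
  convert LinearMap.det_id using 2
  refine LinearMap.ext fun X => Subtype.ext ?_
  change (1 : GLn n F).1 * X.1 * ((1 : GLn n F)⁻¹).1 = X.1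
  simp

lemma adDet_ne_zero {z : GLn n F} (hz : z ∈ D.Z) (α : D.Char) : D.adDet α z ≠ 0 := by
  have h := adDet_mul hz (inv_mem hz) α
  rw [mul_inv_cancel, adDet_one] at h
  exact left_ne_zero_of_mul_eq_one h.symm

lemma Z_conj_mem (g : D.N) {z : GLn n F} (hz : z ∈ D.Z) : g.1 * z * (g.1)⁻¹ ∈ D.Z := by
  refine ⟨?_, ?_⟩
  · exact (mul_mem (mul_mem g.2 (Z_le_N hz)) (inv_mem g.2)).1
  · refine Subgroup.mem_centralizer_iff.2 fun s hs => ?_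
    have h1 := Subgroup.mem_centralizer_iff.1 hz.2 _ (inv_mul_mul_mem g hs)
    simp only [map_mul, map_inv]
    have h2 : incl F g.1 * (((incl F g.1)⁻¹ * s * incl F g.1) * incl F z) * (incl F g.1)⁻¹ =
        incl F g.1 * (incl F z * ((incl F g.1)⁻¹ * s * incl F g.1)) * (incl F g.1)⁻¹ := by
      congr 2
    simpa [mul_assoc] using h2

lemma adDet_conj (g : D.N) {z : GLn n F} (hz : z ∈ D.Z) (α : D.Char) :
    D.adDet (conjChar g α) (g.1 * z * (g.1)⁻¹) = D.adDet α z := by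
  rw [adDet_of_forall (conj_mem_of_mem_Z (Z_conj_mem g hz) _),
    adDet_of_forall (conj_mem_of_mem_Z hz α)]
  let e : weightSpace D.G D.S α ≃ₗ[F] weightSpace D.G D.S (conjChar g α) :=
    { toFun := fun X => ⟨conj g.1 X, conj_mem_weightSpace g α X.2⟩
      map_add' := fun X Y => Subtype.ext (map_add _ _ _)
      map_smul' := fun a X => Subtype.ext (map_smul _ _ _)
      invFun := fun X => ⟨conj (g⁻¹).1 X, by
        have := conj_mem_weightSpace g⁻¹ _ X.2
        rwa [← conjChar_mul, inv_mul_cancel, conjChar_of_mem_Z 1 (one_mem _)] at this⟩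
      left_inv := fun X => Subtype.ext (conj_inv_conj g.1 X)
      right_inv := fun X => Subtype.ext (conj_conj_inv g.1 X) }
  rw [← LinearMap.det_conj _ e]
  congr 1
  refine LinearMap.ext fun X => Subtype.ext ?_
  change conj (g.1 * z * (g.1)⁻¹) X.1 = conj g.1 (conj z (conj (g⁻¹).1 X.1))
  rw [← conj_mul, ← conj_mul]
  rfl

lemma conjChar_conjChar_inv (g : D.N) (α : D.Char) : conjChar g (conjChar g⁻¹ α) = α := by
  rw [← conjChar_mul, mul_inv_cancel]
  exact conjChar_of_mem_Z 1 (one_mem _) _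

lemma conjRoot_conjRoot_inv (g : D.N) (α : D.Root) : conjRoot g (conjRoot g⁻¹ α) = α :=
  Subtype.ext (conjChar_conjChar_inv g α.1)

end Algebraic

/-! ## Points of the apartment, and the Iwahori Weyl group -/

section Local

variable {F : Type*} [Field F] [ValuativeRel F] [TopologicalSpace F]
  [IsNonarchimedeanLocalField F] {n : ℕ}

lemma valF_mul {x y : F} (hx : x ≠ 0) (hy : y ≠ 0) : valF (x * y) = valF x + valF y := by
  simp only [valF, map_mul]
  rw [WithZero.log_mul (by simpa using hx) (by simpa using hy)]
  ring

lemma valF_one : valF (1 : F) = 0 := by simp [valF]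

variable (D : ReductiveTriple F n)

/-- The real number `⟨α, v(z)⟩`, for a root `α` and `z ∈ Z`. By definition
`⟨χ|_S, v(z)⟩ = val_F (χ(z))` for the `F`-rational characters `χ` of the centralizer of `S`; for
`χ = det (Ad | 𝔤_α)` one has `χ|_S = α ^ dim 𝔤_α`. -/
def rootVal (α : D.Root) (z : GLn n F) : ℝ :=
  (valF (D.adDet α.1 z) : ℝ) / (Module.finrank F (weightSpace D.G D.S α.1) : ℝ)

variable {D}

lemma rootVal_mul {z w : GLn n F} (hz : z ∈ D.Z) (hw : w ∈ D.Z) (α : D.Root) :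
    D.rootVal α (z * w) = D.rootVal α z + D.rootVal α w := by
  rw [rootVal, adDet_mul hz hw, valF_mul (adDet_ne_zero hz _) (adDet_ne_zero hw _)]
  simp only [rootVal]
  push_cast
  ring

lemma rootVal_one (α : D.Root) : D.rootVal α 1 = 0 := by
  rw [rootVal, adDet_one, valF_one]
  simp

lemma rootVal_conj (g : D.N) {z : GLn n F} (hz : z ∈ D.Z) (α : D.Root) :
    D.rootVal (conjRoot g α) (g.1 * z * (g.1)⁻¹) = D.rootVal α z := by
  have hd : Module.finrank F (weightSpace D.G D.S (conjRoot g α).1) =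
      Module.finrank F (weightSpace D.G D.S α.1) := by
    refine LinearEquiv.finrank_eq
      { toFun := fun X => ⟨conj (g⁻¹).1 X, ?_⟩
        map_add' := fun X Y => Subtype.ext (map_add _ _ _)
        map_smul' := fun a X => Subtype.ext (map_smul _ _ _)
        invFun := fun X => ⟨conj g.1 X, conj_mem_weightSpace g α.1 X.2⟩
        left_inv := fun X => Subtype.ext (conj_conj_inv g.1 X)
        right_inv := fun X => Subtype.ext (conj_inv_conj g.1 X) }
    have := conj_mem_weightSpace g⁻¹ _ X.2
    change _ ∈ weightSpace D.G D.S (conjChar g⁻¹ (conjChar g α.1)) at this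
    rwa [← conjChar_mul, inv_mul_cancel, conjChar_of_mem_Z 1 (one_mem _)] at this
  rw [rootVal, rootVal, hd]
  have : D.adDet (conjRoot g α).1 (g.1 * z * (g.1)⁻¹) = D.adDet α.1 z := adDet_conj g hz α.1
  rw [this]

lemma conj_mem_kottwitzKernel {G : Subgroup (GLn n (AlgebraicClosure F))} {g : GLn n F}
    (hg : incl F g ∈ G) {x : GLn n (AlgebraicClosure F)} (hx : x ∈ kottwitzKernel G) :
    incl F g * x * (incl F g)⁻¹ ∈ kottwitzKernel G := by
  have hE : HasEntriesIn F (maxUnramified F) (incl F g) := fun i j =>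
    (maxUnramified F).algebraMap_mem (g i j)
  induction hx using Subgroup.closure_induction with
  | mem y hy =>
    obtain ⟨h, hh, hhE, x, hx, rfl⟩ := hy
    refine Subgroup.subset_closure ⟨incl F g * h, mul_mem hg hh, ?_, x, hx, by group⟩
    intro i j
    rw [Matrix.GeneralLinearGroup.coe_mul, Matrix.mul_apply]
    exact sum_mem fun k _ => mul_mem (hE i k) (hhE k j)
  | one => simp
  | mul a b _ _ ha hb =>
    have : incl F g * (a * b) * (incl F g)⁻¹ =
        (incl F g * a * (incl F g)⁻¹) * (incl F g * b * (incl F g)⁻¹) := by group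
    rw [this]
    exact mul_mem ha hb
  | inv a _ ha =>
    have : incl F g * a⁻¹ * (incl F g)⁻¹ = (incl F g * a * (incl F g)⁻¹)⁻¹ := by group
    rw [this]
    exact inv_mem ha

variable (D) in
/-- The group `Z⁰ = Z ∩ K`, where the special parahoric subgroup `K` is the group of the elements of
the kernel of the Kottwitz homomorphism which fix the special point. As `z ∈ Z` acts on the
apartment by the translation by `-v(z)`, it fixes the special point if and only if
`⟨α, v(z)⟩ = 0` for all roots `α`. -/
def Z0 : Subgroup (GLn n F) where
  carrier := {z | z ∈ D.Z ∧ (∀ α : D.Root, D.rootVal α z = 0) ∧ incl F z ∈ kottwitzKernel D.G}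
  mul_mem' := by
    rintro z w ⟨hz, hz', hz''⟩ ⟨hw, hw', hw''⟩
    refine ⟨mul_mem hz hw, fun α => ?_, ?_⟩
    · rw [rootVal_mul hz hw, hz', hw', add_zero]
    · rw [map_mul]
      exact mul_mem hz'' hw''
  one_mem' := ⟨one_mem _, fun α => rootVal_one α, by rw [map_one]; exact one_mem _⟩
  inv_mem' := by
    rintro z ⟨hz, hz', hz''⟩
    refine ⟨inv_mem hz, fun α => ?_, ?_⟩
    · have h := rootVal_mul hz (inv_mem hz) α
      rw [mul_inv_cancel, rootVal_one, hz', zero_add] at h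
      exact h.symm
    · rw [map_inv]
      exact inv_mem hz''

instance : (D.Z0.subgroupOf D.N).Normal where
  conj_mem := by
    intro z hz g
    rw [Subgroup.mem_subgroupOf] at hz ⊢
    obtain ⟨h1, h2, h3⟩ := hz
    refine ⟨Z_conj_mem g h1, fun α => ?_, ?_⟩
    · have := rootVal_conj g h1 (conjRoot g⁻¹ α)
      rw [conjRoot_conjRoot_inv, h2] at this
      exact this
    · have := conj_mem_kottwitzKernel g.2.1 h3
      simpa using this

variable (D)

/-- The Iwahori Weyl group `W = N / Z⁰`. -/
abbrev W := D.N ⧸ (D.Z0.subgroupOf D.N)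

/-- The class in `W` of an element of `Z`. These classes form the group `Λ = Z / Z⁰`. -/
def toW (z : D.Z) : D.W := QuotientGroup.mk ⟨z.1, Z_le_N z.2⟩

/-- The subgroup `W^aff` of `W`, the image of `N ∩ G'`. -/
def Waff : Subgroup D.W := (D.G'.subgroupOf D.N).map (QuotientGroup.mk' _)

/-- A valuation of the root datum `(Z, (U_α)_{α ∈ Φ})` (Bruhat and Tits). The values of `φ α`
outside `U_α` play no role. -/
structure IsValuation (φ : D.Root → GLn n F → WithTop ℝ) : Prop where
  three_values : ∀ α, 3 ≤ (φ α '' D.rootSubgroup α.1).encard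
  eq_top_iff : ∀ α, ∀ u ∈ D.rootSubgroup α.1, φ α u = ⊤ ↔ u = 1
  min_le : ∀ α, ∀ u ∈ D.rootSubgroup α.1, ∀ v ∈ D.rootSubgroup α.1,
    min (φ α u) (φ α v) ≤ φ α (u * v⁻¹)
  reflection : ∀ α β : D.Root, β.1 = (α.1)⁻¹ → ∀ m ∈ D.reflectionCoset α.1,
    ∃ c : ℝ, ∀ u ∈ D.rootSubgroup β.1, u ≠ 1 → φ β u = φ α (m * u * m⁻¹) + (c : WithTop ℝ)
  commutator : ∀ α β : D.Root, (∀ p q : ℕ, 0 < q → β.1 ^ q * α.1 ^ p ≠ 1) → ∀ k l : ℝ,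
    ∀ u ∈ D.rootSubgroup α.1, ∀ v ∈ D.rootSubgroup β.1,
      (k : WithTop ℝ) ≤ φ α u → (l : WithTop ℝ) ≤ φ β v →
        u * v * u⁻¹ * v⁻¹ ∈ Subgroup.closure {w | ∃ (p q : ℕ) (γ : D.Root), 0 < p ∧ 0 < q ∧
          γ.1 = α.1 ^ p * β.1 ^ q ∧ w ∈ D.rootSubgroup γ.1 ∧
          ((p * k + q * l : ℝ) : WithTop ℝ) ≤ φ γ w}
  double : ∀ α γ : D.Root, γ.1 = α.1 ^ 2 → ∀ u ∈ D.rootSubgroup γ.1, φ γ u = φ α u + φ α u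
  opposite : ∀ α β : D.Root, β.1 = (α.1)⁻¹ → ∀ u ∈ D.rootSubgroup α.1,
    ∀ u' ∈ D.rootSubgroup β.1, ∀ u'' ∈ D.rootSubgroup β.1,
      u' * u * u'' ∈ D.reflectionCoset α.1 → φ α u + φ β u' = 0

/-- Two families of functions agree on the root subgroups. -/
def SameFamily (φ ψ : D.Root → GLn n F → WithTop ℝ) : Prop :=
  ∀ α, ∀ u ∈ D.rootSubgroup α.1, φ α u = ψ α u

/-- The family `φ + x`, for `x ∈ V_ad`: `(φ + x)_α(u) = φ_α(u) + ⟨α, x⟩`. -/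
def translate (φ : D.Root → GLn n F → WithTop ℝ) (x : D.Vad) :
    D.Root → GLn n F → WithTop ℝ :=
  fun α u => φ α u + ((D.form α x : ℝ) : WithTop ℝ)

/-- The family `g · φ`, for `g ∈ N`: `(g · φ)_α(u) = φ_{g⁻¹ α}(g⁻¹ u g)`. -/
def act (g : D.N) (φ : D.Root → GLn n F → WithTop ℝ) : D.Root → GLn n F → WithTop ℝ :=
  fun α u => φ (conjRoot g⁻¹ α) ((g.1)⁻¹ * u * g.1)

/-- A special point `x₀` of the apartment attached to `S` in the adjoint building, together with
the homomorphism `ν = -v : Z → V_ad` (which is determined by `nu_spec`). The points of the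
apartment are the valuations `φ` of the root datum which are compatible with the valuation of `F`,
that is, such that `z · φ = φ + ν(z)` for `z ∈ Z`. The point is special if every element of the Weyl
group `N / Z` is the image of an element of `N ∩ G'` which fixes the point. -/
structure SpecialPoint where
  nu : D.Z → D.Vad
  nu_spec : ∀ (z : D.Z) (α : D.Root), D.form α (nu z) = -D.rootVal α z
  phi : D.Root → GLn n F → WithTop ℝ
  isValuation : D.IsValuation phi
  compatible : ∀ z : D.Z,
    D.SameFamily (D.act ⟨z.1, Z_le_N z.2⟩ phi) (D.translate phi (nu z))
  special : ∀ g : D.N, ∃ h : D.N, h.1 ∈ D.G' ∧ D.SameFamily (D.act h phi) phi ∧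
    g.1 * (h.1)⁻¹ ∈ D.Z

/-- The element `g ∈ N` acts on the apartment `x₀ + V_ad` (identified with `V_ad`) by the
transformation `f`. -/
def ActsBy (x₀ : D.SpecialPoint) (g : D.N) (f : Equiv.Perm D.Vad) : Prop :=
  ∀ x, D.SameFamily (D.act g (D.translate x₀.phi x)) (D.translate x₀.phi (f x))

/-- `f` is the affine reflection `s_{a - k} : x ↦ x - (⟨a, x⟩ - k) a^∨`, where `a` is the root of
index `i`. -/
def IsAffineReflection {ι : Type*} (P : RootPairing ι ℝ (Module.Dual ℝ D.Vad) D.Vad) (i : ι) (k : ℤ)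
    (f : Equiv.Perm D.Vad) : Prop :=
  ∀ x, f x = x - (P.root i x - (k : ℝ)) • P.coroot i

/-- The affine Weyl group of a root system in the dual of `V_ad`, generated by the affine
reflections. -/
def affineWeylGroup {ι : Type*} (P : RootPairing ι ℝ (Module.Dual ℝ D.Vad) D.Vad) :
    Subgroup (Equiv.Perm D.Vad) :=
  Subgroup.closure {f | ∃ (i : ι) (k : ℤ), D.IsAffineReflection P i k f}

/-- The reduced root system `Φ_a = {α_a = e_α α | α ∈ Φ}` attached to the special point `x₀`: the
`e_α` are the positive integers such that `Φ_a` is a reduced (crystallographic) root system and the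
group of transformations of the apartment induced by `N ∩ G'` is the affine Weyl group of `Φ_a`.
The root system is indexed by `ι`, and `α_a` is the root of index `idx α`. -/
structure AffineRootSystem (x₀ : D.SpecialPoint) (ι : Type*) where
  e : D.Root → ℕ
  e_pos : ∀ α, 0 < e α
  P : RootPairing ι ℝ (Module.Dual ℝ D.Vad) D.Vad
  pairing_eq : ∀ (f : Module.Dual ℝ D.Vad) (x : D.Vad), P.toLinearMap f x = f x
  isRootSystem : P.IsRootSystem
  isCrystallographic : P.IsCrystallographic
  isReduced : P.IsReduced
  idx : D.Root → ι
  idx_surjective : Function.Surjective idx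
  root_idx : ∀ α, P.root (idx α) = (e α : ℝ) • D.form α
  exists_actsBy : ∀ g : D.N, g.1 ∈ D.G' → ∃ f, D.ActsBy x₀ g f
  mem_affineWeylGroup_iff : ∀ f : Equiv.Perm D.Vad,
    f ∈ D.affineWeylGroup P ↔ ∃ g : D.N, g.1 ∈ D.G' ∧ D.ActsBy x₀ g f

namespace AffineRootSystem

variable {D} {x₀ : D.SpecialPoint} {ι : Type*} (A : D.AffineRootSystem x₀ ι)

/-- The coroot `α_a^∨` in `V_ad`. -/
def corootA (α : D.Root) : D.Vad := A.P.coroot (A.idx α)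

/-- The root `α_a`, as a linear form on `V_ad`. -/
def rootA (α : D.Root) : Module.Dual ℝ D.Vad := A.P.root (A.idx α)

/-- The closure of the antidominant alcove `{x | -1 < ⟨α_a, x⟩ < 0 for all α > 0}` of
vertex `0`. -/
def closedAlcove : Set D.Vad :=
  {x | ∀ α, D.IsPositive α → -1 ≤ A.rootA α x ∧ A.rootA α x ≤ 0}

/-- The hyperplane `⟨α_a, x⟩ = k` is a wall of the antidominant alcove: some point of the
hyperplane which lies in the closed alcove lies on no other hyperplane `⟨β_a, x⟩ = m`. -/
def IsWallOfAlcove (α : D.Root) (k : ℤ) : Prop :=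
  ∃ x ∈ A.closedAlcove, A.rootA α x = k ∧
    ∀ (β : D.Root) (m : ℤ), A.rootA β x = m → ∀ y, A.rootA β y = m ↔ A.rootA α y = k

/-- The subset `S^aff` of `W^aff`: the reflections with respect to the walls of the
antidominant alcove. -/
def Saff : Set D.W :=
  {w | ∃ (g : D.N) (f : Equiv.Perm D.Vad) (α : D.Root) (k : ℤ), g.1 ∈ D.G' ∧
    w = QuotientGroup.mk g ∧ D.ActsBy x₀ g f ∧ D.IsAffineReflection A.P (A.idx α) k f ∧
    A.IsWallOfAlcove α k}

/-- The normalizer `Ω` of `S^aff` in `W`. -/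
def Omega : Set D.W := {u | ∀ s, s ∈ A.Saff ↔ u * s * u⁻¹ ∈ A.Saff}

end AffineRootSystem

end Local

end ReductiveTriple

/-! ## The Bruhat order -/

section Bruhat

variable {Γ : Type*} [Group Γ]

/-- The length of an element with respect to a generating set of involutions. -/
def wordLength (S : Set Γ) (w : Γ) : ℕ :=
  sInf {l | ∃ L : List Γ, (∀ s ∈ L, s ∈ S) ∧ L.prod = w ∧ L.length = l}

/-- The Bruhat order of the Coxeter group `⟨S⟩`, on the elements of `⟨S⟩`: it is generated by the
relations `u < t u` for the reflections `t` (the conjugates in `⟨S⟩` of the elements of `S`) such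
that the length of `u` is less than the length of `t u`. -/
def BruhatLE (S : Set Γ) : Γ → Γ → Prop :=
  Relation.ReflTransGen fun u w =>
    ∃ g ∈ Subgroup.closure S, ∃ s ∈ S, u ∈ Subgroup.closure S ∧
      w = g * s * g⁻¹ * u ∧ wordLength S u < wordLength S w

end Bruhat

namespace ReductiveTriple

section Order

variable {F : Type*} [Field F] [ValuativeRel F] [TopologicalSpace F]
  [IsNonarchimedeanLocalField F] {n : ℕ} {D : ReductiveTriple F n} {x₀ : D.SpecialPoint}
  {ι : Type*} (A : D.AffineRootSystem x₀ ι)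

/-- The dominant elements of `Z`: `⟨α, v(z)⟩ ≥ 0` for all the simple roots `α`, with `v = -ν`. -/
def SpecialPoint.IsDominant (x₀ : D.SpecialPoint) (Δ : Set D.Root) (z : D.Z) : Prop :=
  ∀ α ∈ Δ, 0 ≤ D.form α (-x₀.nu z)

namespace AffineRootSystem

/-- The Bruhat order on `W`: `w₁ u ≤ w₂ u` for `w₁ ≤ w₂` in `W^aff` and `u ∈ Ω`. -/
def WLE (x y : D.W) : Prop :=
  ∃ w₁ ∈ D.Waff, ∃ w₂ ∈ D.Waff, ∃ u ∈ A.Omega,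
    x = w₁ * u ∧ y = w₂ * u ∧ BruhatLE A.Saff w₁ w₂

/-- The order on `V_ad`: `x ≼ y` if `x - y ∈ ∑_{α ∈ Δ} ℕ α_a^∨`. -/
def VadLE (Δ : Set D.Root) (x y : D.Vad) : Prop :=
  x - y ∈ AddSubmonoid.closure (A.corootA '' Δ)

end AffineRootSystem

end Order

end ReductiveTriple

end PadicGroup

end

/-! The statement about the Iwahori Weyl group `W` is decided on the apartment. `W` acts on `V_ad`
by affine transformations that normalize the set of reflections in the hyperplanes ⟨α_a, x⟩ = k
(`actionW`, `actionW_mem_autGroup`). There `Λ` acts by the translations ν, and `W^aff` acts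
faithfully, with image the affine Weyl group of Φ_a (`actionW_injOn`, `exists_actionW_eq`). Each λ_α
lies in `W^aff` and translates by α_a^∨, so faithfulness gives 2 ⇔ 3: an element of `W^aff` acting
by a translation is determined by it.

For the Bruhat order, fix a point a of the antidominant alcove. The length of w is the number of
hyperplanes between a and w a (`wordLength_eq`), so multiplying w on the left by a reflection t
increases the length exactly when the hyperplane of t does not separate a from w a.

1 ⇒ 3. Write λ_j = w_j u with u in Ω. The point q = u 0 lies in the closed alcove
(`apply_zero_mem_closedAlcove`), and w_j q = ν(λ_j). At a Bruhat step w < t w, the point w q lies on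
the segment from t w q to its image under the reflection through 0 parallel to t
(`inCone_of_affRefl`). Consider the property that every conjugate of a point under the finite Weyl
group differs from ν(λ₂) by a nonnegative real combination of simple coroots. It holds at w₂ q,
because ν(λ₂) is antidominant (`inCone_apply_sub`), and by convexity it descends along the chain to
w₁ q. Since λ₁ ∈ λ₂ `W^aff`, the difference ν(λ₁) - ν(λ₂) is in the coroot lattice, and its
coefficients are natural numbers (`mem_closure_of_inCone`).

3 ⇒ 1. By Stembridge's lemma (`exists_antidominant_sub_coroot`) one passes from ν(λ₁) to ν(λ₂)
through antidominant points, subtracting one positive coroot at a time. Each subtraction is the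
product of two parallel reflections, both of which increase the length
(`bruhatLE_addRight_sub_coroot`).

Faithfulness is the algebraic input. An element g of N ∩ G' that acts trivially on the apartment
fixes all roots. The elements g⁻¹ s g s⁻¹ with s ∈ S are then killed by all roots, so they commute
with U and U_op (`commute_of_contracts`), hence with g. As S has finitely many weights on the
standard representation, these elements are trivial and g ∈ Z (`mem_Z_of_conjChar_eq`). Moreover
ν(g) = 0, and G' lies in the Kottwitz kernel, so g ∈ Z⁰ (`mem_Z0_of_actsBy_one`). -/

noncomputable section

set_option linter.unusedSectionVars false

/-! ### Simple systems: from real nonnegative coefficients to natural ones. -/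

namespace RootPairing

open Module

/-- A linearly independent set of roots such that every root is, up to sign, a combination of its
elements with nonnegative real coefficients generates, up to sign, every root over `ℕ`. -/
lemma root_mem_or_neg_mem_closure_of_nonneg {ι V N : Type*} [Finite ι] [AddCommGroup V] [Module ℝ V]
    [AddCommGroup N] [Module ℝ N] (P : RootPairing ι ℝ V N) [P.IsCrystallographic] [P.IsReduced]
    (s : Finset ι) (hli : LinearIndepOn ℝ P.root (s : Set ι))
    (hsp : ∀ i, ∃ c : ι → ℝ, (∀ j ∈ s, 0 ≤ c j) ∧
      (P.root i = ∑ j ∈ s, c j • P.root j ∨ -P.root i = ∑ j ∈ s, c j • P.root j)) (i : ι) :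
    P.root i ∈ AddSubmonoid.closure (P.root '' s) ∨
      -P.root i ∈ AddSubmonoid.closure (P.root '' s) := by
  classical
  have _i : Fintype ι := Fintype.ofFinite ι
  have huniq : ∀ c d : ι → ℝ, ∑ j ∈ s, c j • P.root j = ∑ j ∈ s, d j • P.root j →
      ∀ j ∈ s, c j = d j := by
    intro c d h j hj
    have h' : ∑ j ∈ s, (c j - d j) • P.root j = 0 := by
      simp only [sub_smul, Finset.sum_sub_distrib, h, sub_self]
    exact sub_eq_zero.1 (linearIndepOn_finset_iff.1 hli _ h' j hj)
  -- The coefficient sum is only real, so the induction is on the number of roots whose coefficient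
  -- sum is strictly smaller.
  have key : ∀ (N : ℕ) (i : ι) (c : ι → ℝ), (∀ j ∈ s, 0 ≤ c j) →
      P.root i = ∑ j ∈ s, c j • P.root j →
      (Finset.univ.filter fun k : ι => ∃ d : ι → ℝ, P.root k = ∑ j ∈ s, d j • P.root j ∧
        ∑ j ∈ s, d j < ∑ j ∈ s, c j).card = N →
      P.root i ∈ AddSubmonoid.closure (P.root '' s) := by
    intro N
    induction N using Nat.strong_induction_on with
    | _ N ih =>
    intro i c hc hi hN
    -- The pairing of the root with its own coroot is 2 > 0, so some term of the expansion
    -- contributes positively; the root of that term can be subtracted.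
    obtain ⟨j, hj, hpos⟩ : ∃ j ∈ s, 0 < c j * P.pairing j i := by
      by_contra! h
      have h2 : P.toLinearMap (P.root i) (P.coroot i) = ∑ j ∈ s, c j * P.pairing j i := by
        conv_lhs => rw [hi]
        simp [map_sum, LinearMap.sum_apply]
      have h3 := Finset.sum_nonpos h
      rw [← h2, P.root_coroot_two] at h3
      norm_num at h3
    have hcj : 0 < c j := lt_of_le_of_ne (hc j hj) (by rintro h; rw [← h] at hpos; simp at hpos)
    have hpj : 0 < P.pairing j i := (pos_iff_pos_of_mul_pos hpos).1 hcj
    have hpj' : 0 < P.pairingIn ℤ j i := by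
      rw [← P.algebraMap_pairingIn ℤ] at hpj
      simpa using hpj
    rcases eq_or_ne i j with rfl | hij
    · exact AddSubmonoid.subset_closure ⟨i, hj, rfl⟩
    obtain ⟨k, hk⟩ := P.root_sub_root_mem_of_pairingIn_pos ((P.zero_lt_pairingIn_iff' ℤ).1 hpj') hij
    have hk' : P.root k = ∑ l ∈ s, (c l - if l = j then 1 else 0) • P.root l := by
      simp only [sub_smul, Finset.sum_sub_distrib, ← hi, hk, ite_smul, one_smul, zero_smul,
        Finset.sum_ite_eq', hj, if_true]
    have hsum : ∑ l ∈ s, (c l - if l = j then 1 else 0) = ∑ l ∈ s, c l - 1 := by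
      simp [Finset.sum_sub_distrib, hj]
    obtain ⟨d, hd, h | h⟩ := hsp k
    · have hd' := huniq _ _ (hk'.symm.trans h)
      have hkc : P.root k ∈ AddSubmonoid.closure (P.root '' s) := by
        refine ih _ ?_ k d hd h rfl
        rw [← hN]
        have hdc : ∑ l ∈ s, d l = ∑ l ∈ s, c l - 1 := by
          rw [← hsum]
          exact Finset.sum_congr rfl fun l hl => (hd' l hl).symm
        refine Finset.card_lt_card ⟨?_, ?_⟩
        · intro l hl
          simp only [Finset.mem_filter, Finset.mem_univ, true_and] at hl ⊢
          obtain ⟨e, he, he'⟩ := hl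
          exact ⟨e, he, by linarith⟩
        · intro hsub
          have : k ∈ Finset.univ.filter fun k : ι => ∃ e : ι → ℝ,
              P.root k = ∑ j ∈ s, e j • P.root j ∧ ∑ j ∈ s, e j < ∑ j ∈ s, c j := by
            simp only [Finset.mem_filter, Finset.mem_univ, true_and]
            exact ⟨d, h, by linarith⟩
          have := hsub this
          simp only [Finset.mem_filter, Finset.mem_univ, true_and] at this
          obtain ⟨e, he, he'⟩ := this
          have hde : ∑ l ∈ s, d l = ∑ l ∈ s, e l :=
            Finset.sum_congr rfl fun l hl => huniq _ _ (h.symm.trans he) l hl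
          linarith
      have : P.root i = P.root k + P.root j := by rw [hk]; abel
      rw [this]
      exact add_mem hkc (AddSubmonoid.subset_closure ⟨j, hj, rfl⟩)
    -- If the difference were a negative root, every coefficient other than that of `j` would vanish
    -- and root `i` would be a multiple of root `j`; reducedness excludes this for `i ≠ j`.
    · exfalso
      have hneg : ∑ l ∈ s, (-(c l - if l = j then 1 else 0)) • P.root l =
          ∑ l ∈ s, d l • P.root l := by
        rw [← h, hk']
        simp only [neg_smul, Finset.sum_neg_distrib]
      have hd' := huniq _ _ hneg
      have hz : ∀ l ∈ s, l ≠ j → c l = 0 := by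
        intro l hl hlj
        have h1 := hd' l hl
        rw [if_neg hlj] at h1
        have := hd l hl
        have := hc l hl
        linarith
      have hi' : P.root i = c j • P.root j := by
        rw [hi]
        exact Finset.sum_eq_single_of_mem j hj fun l hl hlj => by rw [hz l hl hlj, zero_smul]
      have hdep : ¬ LinearIndependent ℝ ![P.root i, P.root j] := by
        intro hl
        have := (LinearIndependent.pair_iff.1 hl 1 (-c j) (by rw [hi']; module)).1
        norm_num at this
      rcases IsReduced.eq_or_eq_neg i j hdep with h1 | h1
      · exact hij (P.root.injective h1)
      · rw [hi'] at h1
        have h2 : (c j + 1) • P.root j = 0 := by rw [add_smul, h1]; simp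
        rcases smul_eq_zero.1 h2 with h3 | h3
        · linarith
        · exact P.ne_zero j h3
  obtain ⟨c, hc, h | h⟩ := hsp i
  · exact Or.inl (key _ i c hc h rfl)
  · right
    have h' : P.root (P.reflectionPerm i i) = ∑ j ∈ s, c j • P.root j := by
      rw [← h, P.root_reflectionPerm, P.reflection_apply_self]
    have := key _ _ c hc h' rfl
    rwa [P.root_reflectionPerm, P.reflection_apply_self] at this

end RootPairing

/-- A root pairing between the dual of `V` and `V` whose pairing is the evaluation. -/
class RootPairing.IsEval {ι V : Type*} [AddCommGroup V] [Module ℝ V]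
    (P : RootPairing ι ℝ (Module.Dual ℝ V) V) : Prop where
  toLinearMap_apply (f : Module.Dual ℝ V) (x : V) : P.toLinearMap f x = f x

/-! ### Affine reflections, their hyperplanes, and separation of points. -/

namespace AffineWeyl

open Module Equiv

variable {ι V : Type*} [AddCommGroup V] [Module ℝ V] (P : RootPairing ι ℝ (Dual ℝ V) V) [P.IsEval]

lemma root_coroot (i j : ι) : P.root i (P.coroot j) = P.pairing i j := by
  rw [← RootPairing.IsEval.toLinearMap_apply (P := P), P.root_coroot_eq_pairing]

lemma root_coroot_self (i : ι) : P.root i (P.coroot i) = 2 := by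
  rw [root_coroot, P.pairing_same]

/-- The affine reflection `x ↦ x - (⟨α, x⟩ - k) α^∨`. -/
def affRefl (i : ι) (k : ℤ) : Perm V :=
  Function.Involutive.toPerm (fun x => x - (P.root i x - k) • P.coroot i) fun x => by
    simp only [map_sub, map_smul, root_coroot_self, smul_eq_mul]
    module

lemma affRefl_apply (i : ι) (k : ℤ) (x : V) :
    affRefl P i k x = x - (P.root i x - k) • P.coroot i := rfl

lemma affRefl_affRefl (i : ι) (k : ℤ) (x : V) : affRefl P i k (affRefl P i k x) = x :=
  Function.Involutive.toPerm_involutive _ x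

@[simp] lemma affRefl_mul_self (i : ι) (k : ℤ) : affRefl P i k * affRefl P i k = 1 :=
  Equiv.ext (affRefl_affRefl P i k)

@[simp] lemma affRefl_inv (i : ι) (k : ℤ) : (affRefl P i k)⁻¹ = affRefl P i k :=
  inv_eq_of_mul_eq_one_left (affRefl_mul_self P i k)

lemma root_affRefl (i j : ι) (k : ℤ) (x : V) :
    P.root j (affRefl P i k x) = P.root j x - (P.root i x - k) * P.pairing j i := by
  rw [affRefl_apply, map_sub, map_smul, root_coroot, smul_eq_mul]

lemma root_affRefl_self (i : ι) (k : ℤ) (x : V) :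
    P.root i (affRefl P i k x) = 2 * k - P.root i x := by
  rw [root_affRefl, P.pairing_same]
  ring

/-- The set of affine reflections. -/
def reflections : Set (Perm V) := {t | ∃ i k, t = affRefl P i k}

lemma affRefl_mem (i : ι) (k : ℤ) : affRefl P i k ∈ reflections P := ⟨i, k, rfl⟩

variable {P} in
lemma mul_self_of_mem {t : Perm V} (ht : t ∈ reflections P) : t * t = 1 := by
  obtain ⟨i, k, rfl⟩ := ht
  exact affRefl_mul_self P i k

variable {P} in
lemma inv_of_mem {t : Perm V} (ht : t ∈ reflections P) : t⁻¹ = t :=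
  inv_eq_of_mul_eq_one_left (mul_self_of_mem ht)

variable {P} in
lemma apply_apply_of_mem {t : Perm V} (ht : t ∈ reflections P) (x : V) : t (t x) = x := by
  rw [← Perm.mul_apply, mul_self_of_mem ht, Perm.one_apply]

/-- Affine transformations. -/
def IsAffine (g : Perm V) : Prop := ∃ L : V ≃ₗ[ℝ] V, ∀ x, g x = L x + g 0

/-- The group of the affine transformations which normalize the set of affine reflections. -/
def autGroup : Subgroup (Perm V) where
  carrier := {g | IsAffine g ∧ ∀ t, t ∈ reflections P ↔ g * t * g⁻¹ ∈ reflections P}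
  mul_mem' := by
    rintro g h ⟨⟨L, hL⟩, hg⟩ ⟨⟨M, hM⟩, hh⟩
    refine ⟨⟨M.trans L, fun x => ?_⟩, fun t => ?_⟩
    · rw [Perm.mul_apply, hM, Perm.mul_apply, hL, hL (h 0), map_add, add_assoc]
      rfl
    · rw [hh, hg]
      simp [mul_assoc]
  one_mem' := ⟨⟨LinearEquiv.refl ℝ V, fun x => by simp⟩, fun t => by simp⟩
  inv_mem' := by
    rintro g ⟨⟨L, hL⟩, hg⟩
    have h : ∀ y, g⁻¹ y = L.symm (y - g 0) := fun y => by
      rw [Perm.inv_eq_iff_eq, hL, L.apply_symm_apply, sub_add_cancel]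
    refine ⟨⟨L.symm, fun x => ?_⟩, fun t => ?_⟩
    · rw [h, h, ← map_add]
      congr 1
      abel
    · rw [hg (g⁻¹ * t * g⁻¹⁻¹)]
      simp [mul_assoc]

variable {P} in
/-- A transformation in `autGroup` transports the equation of a hyperplane into a multiple of the
equation of its image. -/
lemma exists_root_apply_sub {g : Perm V} (hg : g ∈ autGroup P) {i j : ι} {k m : ℤ}
    (h : g * affRefl P i k * g⁻¹ = affRefl P j m) :
    ∃ c : ℝ, c ≠ 0 ∧ ∀ x, P.root j (g x) - m = c * (P.root i x - k) := by
  obtain ⟨⟨L, hL⟩, -⟩ := hg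
  have h1 : ∀ x, (P.root i x - k) • L (P.coroot i) = (P.root j (g x) - m) • P.coroot j := by
    intro x
    have h2 : g (affRefl P i k x) = affRefl P j m (g x) := by
      rw [← h]
      simp
    rw [affRefl_apply, affRefl_apply, hL, map_sub, map_smul] at h2
    have h3 : g x = L x + g 0 := hL x
    have h4 : L x - (P.root i x - k) • L (P.coroot i) + g 0 =
        (L x + g 0) - (P.root j (g x) - m) • P.coroot j := by rw [h2, ← h3]
    have h5 : (P.root j (g x) - m) • P.coroot j - (P.root i x - k) • L (P.coroot i) = 0 := by
      have := sub_eq_zero.2 h4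
      rw [← this]
      abel
    exact (sub_eq_zero.1 h5).symm
  have h2 : ∀ x, P.root j (g x) - m = (P.root j (L (P.coroot i)) / 2) * (P.root i x - k) := by
    intro x
    have := congrArg (P.root j) (h1 x)
    rw [map_smul, map_smul, root_coroot_self, smul_eq_mul, smul_eq_mul] at this
    linarith
  refine ⟨_, ?_, h2⟩
  intro h0
  -- The root `j` takes the value `m + 1` at this multiple of its coroot, a point off the
  -- hyperplane; `c = 0` would give 1 = 0.
  have h3 := h2 (g⁻¹ ((((m : ℝ) + 1) / 2) • P.coroot j))
  rw [h0, zero_mul, ← Perm.mul_apply, mul_inv_cancel, Perm.one_apply, map_smul, root_coroot_self, smul_eq_mul] at h3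
  linarith

/-- The hyperplane of the reflection `t` strictly separates `x` and `y`. -/
def Separates (t : Perm V) (x y : V) : Prop :=
  ∃ i k, t = affRefl P i k ∧ (P.root i x - k) * (P.root i y - k) < 0

variable {P}

lemma Separates.mem {t : Perm V} {x y : V} (h : Separates P t x y) : t ∈ reflections P := by
  obtain ⟨i, k, h, -⟩ := h
  exact ⟨i, k, h⟩

/-- The equation of the image hyperplane is a nonzero multiple `c` of the transported one, so the
product of its two values changes by `c ^ 2 > 0`. This holds for every pair naming the conjugated
reflection. -/
lemma separates_conj_affRefl {g : Perm V} (hg : g ∈ autGroup P) {i : ι} {k : ℤ} {x y : V} :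
    Separates P (g * affRefl P i k * g⁻¹) (g x) (g y) ↔
      (P.root i x - k) * (P.root i y - k) < 0 := by
  have key : ∀ j m, g * affRefl P i k * g⁻¹ = affRefl P j m →
      ((P.root j (g x) - m) * (P.root j (g y) - m) < 0 ↔
        (P.root i x - k) * (P.root i y - k) < 0) := by
    intro j m h
    obtain ⟨c, hc, h⟩ := exists_root_apply_sub hg h
    rw [h, h]
    have hc2 : 0 < c ^ 2 := by positivity
    have : c * (P.root i x - k) * (c * (P.root i y - k)) =
        c ^ 2 * ((P.root i x - k) * (P.root i y - k)) := by ring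
    rw [this]
    constructor
    · intro h
      by_contra! h'
      have := mul_nonneg hc2.le h'
      linarith
    · exact fun h => mul_neg_of_pos_of_neg hc2 h
  constructor
  · rintro ⟨j, m, h, h'⟩
    exact (key j m h).1 h'
  · intro h
    obtain ⟨j, m, h'⟩ := (hg.2 _).1 (affRefl_mem P i k)
    exact ⟨j, m, h', (key j m h').2 h⟩

/-- Separation does not depend on the pair naming the reflection; at least (α, k) and (-α, -k) name
the same one. -/
lemma separates_affRefl {i : ι} {k : ℤ} {x y : V} :
    Separates P (affRefl P i k) x y ↔ (P.root i x - k) * (P.root i y - k) < 0 := by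
  simpa using separates_conj_affRefl (one_mem (autGroup P)) (i := i) (k := k) (x := x) (y := y)

lemma separates_conj {g : Perm V} (hg : g ∈ autGroup P) {t : Perm V} {x y : V} :
    Separates P (g * t * g⁻¹) (g x) (g y) ↔ Separates P t x y := by
  constructor
  · intro h
    obtain ⟨i, k, rfl⟩ := (hg.2 _).2 h.mem
    rw [separates_conj_affRefl hg] at h
    exact separates_affRefl.2 h
  · intro h
    obtain ⟨i, k, rfl⟩ := h.mem
    rw [separates_conj_affRefl hg]
    exact separates_affRefl.1 h

lemma Separates.symm {t : Perm V} {x y : V} (h : Separates P t x y) : Separates P t y x := by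
  obtain ⟨i, k, rfl, h⟩ := h
  exact ⟨i, k, rfl, by rwa [mul_comm]⟩

variable (P) in
/-- Points on no hyperplane. -/
def Regular (x : V) : Prop := ∀ i (k : ℤ), P.root i x ≠ k

lemma Regular.apply {g : Perm V} (hg : g ∈ autGroup P) {x : V} (hx : Regular P x) :
    Regular P (g x) := by
  intro j m h
  obtain ⟨i, k, h'⟩ := ((inv_mem hg).2 _).1 (affRefl_mem P j m)
  rw [inv_inv] at h'
  have h2 : g * affRefl P i k * g⁻¹ = affRefl P j m := by rw [← h']; group
  obtain ⟨c, hc, h3⟩ := exists_root_apply_sub hg h2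
  have h4 := h3 x
  rw [h, sub_self] at h4
  rcases mul_eq_zero.1 h4.symm with h5 | h5
  · exact hc h5
  · exact hx i k (sub_eq_zero.1 h5)

lemma Regular.sub_ne {x : V} (hx : Regular P x) (i : ι) (k : ℤ) : P.root i x - k ≠ 0 :=
  sub_ne_zero.2 (hx i k)

/-- A hyperplane has two sides and regular points lie on none, so separation is additive modulo 2.
-/
lemma separates_trans_iff {t : Perm V} (ht : t ∈ reflections P) {x y z : V} (hx : Regular P x)
    (hy : Regular P y) (hz : Regular P z) :
    Separates P t x z ↔ (Separates P t x y ↔ ¬ Separates P t y z) := by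
  obtain ⟨i, k, rfl⟩ := ht
  simp only [separates_affRefl]
  have h1 := hx.sub_ne i k
  have h2 := hy.sub_ne i k
  have h3 := hz.sub_ne i k
  generalize P.root i x - k = p at *
  generalize P.root i y - k = q at *
  generalize P.root i z - k = r at *
  rcases h1.lt_or_gt with h1 | h1 <;> rcases h2.lt_or_gt with h2 | h2 <;>
    rcases h3.lt_or_gt with h3 | h3 <;>
    simp [mul_neg_iff, h1, h2, h3, h1.not_gt, h2.not_gt, h3.not_gt]

lemma separates_self_apply {t : Perm V} (ht : t ∈ reflections P) {x : V} (hx : Regular P x) :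
    Separates P t x (t x) := by
  obtain ⟨i, k, rfl⟩ := ht
  rw [separates_affRefl, root_affRefl_self]
  have : 0 < (P.root i x - k) ^ 2 := by
    have := hx.sub_ne i k
    positivity
  nlinarith

variable (P) in
/-- The reflections whose hyperplane separates `x` and `y`. -/
def sepSet (x y : V) : Set (Perm V) := {t | Separates P t x y}

lemma finite_sepSet [Finite ι] (x y : V) : (sepSet P x y).Finite := by
  have h : sepSet P x y ⊆ ⋃ i : ι, (affRefl P i) ''
      {k : ℤ | (P.root i x - k) * (P.root i y - k) < 0} := by
    rintro t ⟨i, k, rfl, h⟩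
    exact Set.mem_iUnion.2 ⟨i, k, h, rfl⟩
  refine Set.Finite.subset (Set.finite_iUnion fun i => Set.Finite.image _ ?_) h
  refine Set.Finite.subset (Set.finite_Icc (⌊min (P.root i x) (P.root i y)⌋)
    ⌈max (P.root i x) (P.root i y)⌉) ?_
  intro k hk
  have hk' := mul_neg_iff.1 (show (P.root i x - k) * (P.root i y - k) < 0 from hk)
  refine ⟨?_, ?_⟩
  · have : min (P.root i x) (P.root i y) ≤ k := by
      rcases hk' with h | h
      · exact (min_le_right _ _).trans (by linarith)
      · exact (min_le_left _ _).trans (by linarith)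
    exact_mod_cast (Int.floor_le _).trans this
  · have : (k : ℝ) ≤ max (P.root i x) (P.root i y) := by
      rcases hk' with h | h
      · exact le_trans (by linarith) (le_max_left _ _)
      · exact le_trans (by linarith) (le_max_right _ _)
    exact_mod_cast this.trans (Int.le_ceil _)

section Crystallographic

variable [P.IsCrystallographic]

lemma intCast_pairingIn (i j : ι) : ((P.pairingIn ℤ i j : ℤ) : ℝ) = P.pairing i j := by
  simpa using P.algebraMap_pairingIn ℤ i j

-- Crystallographicity enters here: it makes the level of the conjugated reflection an integer, so
-- the reflections are stable under conjugation by one another.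
variable (P) in
lemma affRefl_conj (i j : ι) (k m : ℤ) :
    affRefl P i k * affRefl P j m * affRefl P i k =
      affRefl P (P.reflectionPerm i j) (m - k * P.pairingIn ℤ j i) := by
  ext x
  simp only [Perm.mul_apply]
  rw [affRefl_apply P (P.reflectionPerm i j)]
  have h1 : P.root (P.reflectionPerm i j) x = P.root j x - P.pairing j i * P.root i x := by
    rw [P.root_reflectionPerm, P.reflection_apply_root]
    simp
  have h2 : P.coroot (P.reflectionPerm i j) = P.coroot j - P.pairing i j • P.coroot i := by
    rw [P.coroot_reflectionPerm, P.coreflection_apply_coroot]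
  rw [h1, h2]
  push_cast
  rw [intCast_pairingIn, affRefl_apply P i k (affRefl P j m _), root_affRefl, affRefl_apply P j m,
    root_affRefl, root_affRefl_self, affRefl_apply]
  module

lemma affRefl_mem_autGroup (i : ι) (k : ℤ) : affRefl P i k ∈ autGroup P := by
  have key : ∀ t ∈ reflections P, affRefl P i k * t * affRefl P i k ∈ reflections P := by
    rintro t ⟨j, m, rfl⟩
    exact ⟨_, _, affRefl_conj P i j k m⟩
  refine ⟨⟨P.coreflection i, fun x => ?_⟩, fun t => ⟨fun h => ?_, fun h => ?_⟩⟩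
  · have : P.coreflection i x = x - P.root i x • P.coroot i := by
      rw [P.coreflection_apply]
      congr 2
      exact RootPairing.IsEval.toLinearMap_apply _ _
    rw [this, affRefl_apply, affRefl_apply, map_zero]
    module
  · rw [affRefl_inv]
    exact key t h
  · rw [affRefl_inv] at h
    have := key _ h
    have e : affRefl P i k * (affRefl P i k * t * affRefl P i k) * affRefl P i k = t := by
      rw [mul_assoc, mul_assoc, affRefl_mul_self, mul_one, ← mul_assoc, affRefl_mul_self, one_mul]
    rwa [e] at this

lemma reflections_subset_autGroup : reflections P ⊆ autGroup P := by
  rintro t ⟨i, k, rfl⟩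
  exact affRefl_mem_autGroup i k

variable (P) in
/-- The affine Weyl group. -/
def affGroup : Subgroup (Perm V) := Subgroup.closure (reflections P)

lemma affGroup_le_autGroup : affGroup P ≤ autGroup P :=
  (Subgroup.closure_le _).2 reflections_subset_autGroup

lemma mem_affGroup {t : Perm V} (ht : t ∈ reflections P) : t ∈ affGroup P :=
  Subgroup.subset_closure ht

/-- If the hyperplane of `t` does not separate `a` and `y`, then there are fewer hyperplanes between
`a` and `y` than between `a` and `t y`. -/
lemma ncard_sepSet_lt [Finite ι] {t : Perm V} (ht : t ∈ reflections P) {a y : V} (ha : Regular P a)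
    (hy : Regular P y) (h : ¬ Separates P t a y) :
    (sepSet P a y).ncard < (sepSet P a (t y)).ncard := by
  classical
  have htA := reflections_subset_autGroup ht
  have hty : Regular P (t y) := hy.apply htA
  have hta : Regular P (t a) := ha.apply htA
  have htt := apply_apply_of_mem ht
  -- A hyperplane between `a` and `y` that is lost on passing to `t y` is replaced by its mirror
  -- image under `t`, which is gained. The proof compares signs; that `t` does not separate `a` from
  -- `y` enters through `hc`.
  have key : ∀ r ∈ sepSet P a y, ¬ Separates P r a (t y) →
      Separates P (t * r * t⁻¹) a (t y) ∧ ¬ Separates P (t * r * t⁻¹) a y := by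
    intro r hr hr'
    have e1 : Separates P (t * r * t⁻¹) a (t y) ↔ Separates P r (t a) y := by
      rw [← separates_conj htA (t := r), htt]
    have e2 : Separates P (t * r * t⁻¹) a y ↔ Separates P r (t a) (t y) := by
      rw [← separates_conj htA (t := r), htt, htt]
    rw [e1, e2]
    obtain ⟨j, m, rfl⟩ := Separates.mem hr
    obtain ⟨i, k, rfl⟩ := ht
    change Separates P _ _ _ at hr
    have n1 := ha.sub_ne j m
    have n2 := hty.sub_ne j m
    simp only [separates_affRefl, root_affRefl] at *
    set c := P.pairing j i
    set fa := P.root j a - m with hfa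
    set fy := P.root j y - m with hfy
    set Fa := P.root i a - k
    set Fy := P.root i y - k
    have e3 : P.root j a - Fa * c - m = fa - Fa * c := by rw [hfa]; ring
    have e4 : P.root j y - Fy * c - m = fy - Fy * c := by rw [hfy]; ring
    rw [e3, e4]
    rw [e4] at n2 hr'
    have hc : 0 ≤ (Fa * c) * (Fy * c) := by
      have := mul_nonneg (not_lt.1 h) (sq_nonneg c)
      linarith
    have hr2 : 0 < fa * (fy - Fy * c) :=
      lt_of_le_of_ne (not_lt.1 hr') (mul_ne_zero n1 n2).symm
    rcases n1.lt_or_gt with h1 | h1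
    · have h2 : 0 < fy := by
        by_contra! h'
        have := mul_nonneg_of_nonpos_of_nonpos h1.le h'
        linarith
      have h3 : fy - Fy * c < 0 := by
        by_contra! h'
        have := mul_nonpos_of_nonpos_of_nonneg h1.le h'
        linarith
      have h4 : 0 ≤ Fa * c := by
        by_contra! h'
        have := mul_neg_of_neg_of_pos h' (show 0 < Fy * c by linarith)
        linarith
      have h5 : fa - Fa * c < 0 := by linarith
      exact ⟨mul_neg_of_neg_of_pos h5 h2, not_lt.2 (mul_nonneg_of_nonpos_of_nonpos h5.le h3.le)⟩
    · have h2 : fy < 0 := by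
        by_contra! h'
        have := mul_nonneg h1.le h'
        linarith
      have h3 : 0 < fy - Fy * c := by
        by_contra! h'
        have := mul_nonpos_of_nonneg_of_nonpos h1.le h'
        linarith
      have h4 : Fa * c ≤ 0 := by
        by_contra! h'
        have := mul_neg_of_pos_of_neg h' (show Fy * c < 0 by linarith)
        linarith
      have h5 : 0 < fa - Fa * c := by linarith
      exact ⟨mul_neg_of_pos_of_neg h5 h2, not_lt.2 (mul_nonneg h5.le h3.le)⟩
  have hsep : t ∈ sepSet P a (t y) := by
    by_contra h'
    have h1 := separates_trans_iff ht ha hy hty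
    have h2 := separates_self_apply ht hy
    change ¬ Separates P t a (t y) at h'
    tauto
  -- An injection of the hyperplanes between `a` and `y` into those between `a` and `t y`. It misses
  -- `t` itself, whence the strict inequality.
  let φ : Perm V → Perm V := fun r => if Separates P r a (t y) then r else t * r * t⁻¹
  have hφ : ∀ r ∈ sepSet P a y, φ r ∈ sepSet P a (t y) \ {t} := by
    intro r hr
    by_cases h' : Separates P r a (t y)
    · simp only [φ, if_pos h']
      refine ⟨h', ?_⟩
      rintro rfl
      exact h hr
    · simp only [φ, if_neg h']
      refine ⟨(key r hr h').1, ?_⟩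
      intro e
      have : r = t := by
        rw [Set.mem_singleton_iff, mul_inv_eq_iff_eq_mul] at e
        exact mul_left_cancel e
      subst this
      exact h hr
  have hinj : Set.InjOn φ (sepSet P a y) := by
    intro r hr r' hr' e
    by_cases h1 : Separates P r a (t y) <;> by_cases h2 : Separates P r' a (t y)
    · simpa [φ, h1, h2] using e
    · simp only [φ, if_pos h1, if_neg h2] at e
      have := (key r' hr' h2).2
      rw [← e] at this
      exact absurd hr this
    · simp only [φ, if_neg h1, if_pos h2] at e
      have := (key r hr h1).2
      rw [e] at this
      exact absurd hr' this
    · simp only [φ, if_neg h1, if_neg h2] at e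
      simpa using e
  calc (sepSet P a y).ncard ≤ (sepSet P a (t y) \ {t}).ncard :=
        Set.ncard_le_ncard_of_injOn φ hφ hinj ((finite_sepSet a (t y)).subset Set.sdiff_subset)
    _ < (sepSet P a (t y)).ncard :=
        Set.ncard_sdiff_singleton_lt_of_mem hsep (finite_sepSet a (t y))

lemma ncard_sepSet_gt [Finite ι] {t : Perm V} {a y : V} (ha : Regular P a)
    (hy : Regular P y) (h : Separates P t a y) :
    (sepSet P a (t y)).ncard < (sepSet P a y).ncard := by
  have ht := h.mem
  have hty : Regular P (t y) := hy.apply (reflections_subset_autGroup ht)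
  have h1 : ¬ Separates P t a (t y) := by
    have h1 := separates_trans_iff ht ha hy hty
    have h2 := separates_self_apply ht hy
    tauto
  have := ncard_sepSet_lt ht ha hty h1
  rwa [apply_apply_of_mem ht] at this

end Crystallographic

end AffineWeyl

/-! ### Wall reflections as Coxeter generators: exchange, length, alcove transitivity. -/

namespace AffineWeyl

open Module Equiv PadicGroup

variable {ι V : Type*} [Finite ι] [AddCommGroup V] [Module ℝ V]
  (P : RootPairing ι ℝ (Dual ℝ V) V) [P.IsEval] [P.IsCrystallographic]

/-- `S` is the set of the reflections in the walls of the alcove of `a`. -/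
structure IsWallSet (a : V) (S : Set (Perm V)) : Prop where
  regular : Regular P a
  subset : S ⊆ reflections P
  eq_of_separates : ∀ s ∈ S, ∀ t, Separates P t a (s a) → t = s
  not_separates : ∀ y, Regular P y → (∀ s ∈ S, ¬ Separates P s a y) → ∀ t, ¬ Separates P t a y

namespace IsWallSet

variable {P} {a : V} {S : Set (Perm V)} (h : IsWallSet P a S)

include h

lemma mem_autGroup {s : Perm V} (hs : s ∈ S) : s ∈ autGroup P :=
  reflections_subset_autGroup (h.subset hs)

/-- Induction on the number of hyperplanes between `a` and `t a`. A wall `s` separates these two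
points; if `t ≠ s`, then `s * t * s` has a smaller number, because both passages t a → s t a → s t s
a cross back over a separating hyperplane. -/
lemma exists_conj {t : Perm V} (ht : t ∈ reflections P) :
    ∃ g ∈ Subgroup.closure S, ∃ s ∈ S, t = g * s * g⁻¹ := by
  have key : ∀ (N : ℕ) (t : Perm V), t ∈ reflections P → (sepSet P a (t a)).ncard = N →
      ∃ g ∈ Subgroup.closure S, ∃ s ∈ S, t = g * s * g⁻¹ := by
    intro N
    induction N using Nat.strong_induction_on with
    | _ N ih =>
    intro t ht hN
    have htA := reflections_subset_autGroup ht
    obtain ⟨s, hs, hsep⟩ : ∃ s ∈ S, Separates P s a (t a) := by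
      by_contra! h'
      exact h.not_separates _ (h.regular.apply htA) h' t (separates_self_apply ht h.regular)
    by_cases hst : t = s
    · exact ⟨1, one_mem _, s, hs, by simp [hst]⟩
    have hsA := h.mem_autGroup hs
    have hts : ¬ Separates P t a (s a) := fun h' => hst (h.eq_of_separates s hs t h')
    -- The second drop. Transported by (s t)⁻¹, it says that `s` separates t s a from a; this
    -- follows since `s` separates a from t a while `t` does not separate a from s a.
    have hr : Separates P (s * t * s * (s * t)⁻¹) a ((s * t) a) := by
      have e1 : Separates P (s * t * s * (s * t)⁻¹) ((s * t) (t (s a))) ((s * t) a) ↔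
          Separates P s (t (s a)) a := separates_conj (mul_mem hsA htA)
      have e2 : (s * t) (t (s a)) = a := by
        rw [Perm.mul_apply, apply_apply_of_mem ht, apply_apply_of_mem (h.subset hs)]
      rw [e2] at e1
      rw [e1]
      obtain ⟨i, k, rfl⟩ := h.subset hs
      obtain ⟨j, m, rfl⟩ := ht
      have n1 := h.regular.sub_ne i k
      have n2 := h.regular.sub_ne j m
      rw [separates_affRefl] at hsep hts ⊢
      rw [root_affRefl P j i, root_affRefl_self]
      rw [root_affRefl P j i] at hsep
      generalize P.root j (affRefl P i k a) = v at *
      generalize P.root i a = u at *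
      generalize P.root j a = w at *
      generalize P.pairing i j = c at *
      have n1' : 0 < (u - k) ^ 2 := by positivity
      have h1 : 0 < (u - k) * ((w - m) * c) := by nlinarith
      have h2 : 0 ≤ (w - m) * (v - m) := not_lt.1 hts
      have h3 : 0 ≤ ((v - m) * c) * ((w - m) * c) := by
        have := mul_nonneg h2 (sq_nonneg c)
        linarith
      have h4 : 0 ≤ (u - k) * ((v - m) * c) := by
        by_contra! h'
        have h5 := mul_neg_of_pos_of_neg h1 h'
        have h6 := mul_nonneg h3 n1'.le
        nlinarith
      nlinarith
    have hst1 : (sepSet P a ((s * t) a)).ncard < N := by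
      rw [← hN]
      exact ncard_sepSet_gt h.regular (h.regular.apply htA) hsep
    have hst2 := ncard_sepSet_gt h.regular (h.regular.apply (mul_mem hsA htA)) hr
    have e : (s * t * s * (s * t)⁻¹) ((s * t) a) = (s * t * s) a := by
      rw [← Perm.mul_apply]
      simp
    rw [e] at hst2
    have hmem : s * t * s ∈ reflections P := by
      have := (hsA.2 t).1 ht
      rwa [inv_of_mem (h.subset hs)] at this
    obtain ⟨g, hg, s', hs', e2⟩ := ih _ (hst2.trans hst1) _ hmem rfl
    refine ⟨s * g, mul_mem (Subgroup.subset_closure hs) hg, s', hs', ?_⟩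
    have hss := mul_self_of_mem (h.subset hs)
    calc t = (s * s) * t * (s * s) := by rw [hss]; simp
      _ = s * (s * t * s) * s⁻¹ := by rw [inv_of_mem (h.subset hs)]; group
      _ = _ := by rw [e2]; group
  exact key _ t ht rfl

lemma reflections_subset_closure : reflections P ⊆ Subgroup.closure S := by
  intro t ht
  obtain ⟨g, hg, s, hs, rfl⟩ := h.exists_conj ht
  exact mul_mem (mul_mem hg (Subgroup.subset_closure hs)) (inv_mem hg)

lemma closure_eq : Subgroup.closure S = affGroup P :=
  le_antisymm (Subgroup.closure_mono h.subset)
    ((Subgroup.closure_le _).2 h.reflections_subset_closure)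

lemma list_prod_mem {L : List (Perm V)} (hL : ∀ s ∈ L, s ∈ S) : L.prod ∈ autGroup P :=
  Subgroup.list_prod_mem _ fun s hs => h.mem_autGroup (hL s hs)

lemma exists_list {w : Perm V} (hw : w ∈ affGroup P) :
    ∃ L : List (Perm V), (∀ s ∈ L, s ∈ S) ∧ L.prod = w := by
  rw [← h.closure_eq, ← Subgroup.mem_toSubmonoid, Subgroup.closure_toSubmonoid] at hw
  obtain ⟨L, hL, rfl⟩ := Submonoid.exists_list_of_mem_closure hw
  refine ⟨L, fun s hs => ?_, rfl⟩
  rcases hL s hs with h1 | h1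
  · exact h1
  · have := inv_of_mem (h.subset h1)
    rw [inv_inv] at this
    rw [this]
    exact h1

/-- Follow the gallery from `a` to `L.prod a`. The hyperplane of `t` is crossed at some letter, and
that letter can be deleted. A head `s ≠ t` does not cross it, as a wall is the only hyperplane
between `a` and `s a`, so one conjugates by `s` and continues in the tail. -/
lemma exchange {L : List (Perm V)} (hL : ∀ s ∈ L, s ∈ S) {t : Perm V}
    (ht : Separates P t a (L.prod a)) :
    ∃ L' : List (Perm V), (∀ s ∈ L', s ∈ S) ∧ L'.length + 1 = L.length ∧ L'.prod = t * L.prod := by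
  induction L generalizing t with
  | nil =>
    obtain ⟨i, k, rfl, h'⟩ := ht
    simp only [List.prod_nil, Perm.one_apply] at h'
    nlinarith [mul_self_nonneg (P.root i a - k)]
  | cons s L ih =>
    have hs := hL s (by simp)
    have hL' : ∀ s ∈ L, s ∈ S := fun r hr => hL r (by simp [hr])
    have hss := mul_self_of_mem (h.subset hs)
    by_cases hts : t = s
    · refine ⟨L, hL', by simp, ?_⟩
      rw [hts, List.prod_cons, ← mul_assoc, hss, one_mul]
    have hsA := h.mem_autGroup hs
    have hsa := h.regular.apply hsA
    have hwa := h.regular.apply (h.list_prod_mem hL)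
    have h1 : Separates P t (s a) ((s :: L).prod a) := by
      have h1 := separates_trans_iff ht.mem h.regular hsa hwa
      have h2 : ¬ Separates P t a (s a) := fun h' => hts (h.eq_of_separates s hs t h')
      tauto
    have h2 : Separates P (s * t * s⁻¹) a (L.prod a) := by
      rw [← separates_conj hsA] at h1
      rwa [apply_apply_of_mem (h.subset hs), List.prod_cons, Perm.mul_apply,
        apply_apply_of_mem (h.subset hs)] at h1
    obtain ⟨L', h3, h4, h5⟩ := ih hL' h2
    refine ⟨s :: L', ?_, by simp [h4], ?_⟩
    · simpa using ⟨hs, h3⟩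
    · rw [List.prod_cons, List.prod_cons, h5, inv_of_mem (h.subset hs), ← mul_assoc, ← mul_assoc,
        ← mul_assoc, hss, one_mul, mul_assoc]

lemma ncard_sepSet_prod_le {L : List (Perm V)} (hL : ∀ s ∈ L, s ∈ S) :
    (sepSet P a (L.prod a)).ncard ≤ L.length := by
  induction L with
  | nil =>
    have : sepSet P a ((List.prod [] : Perm V) a) = ∅ := by
      ext t
      simp only [Set.mem_empty_iff_false, iff_false]
      rintro ⟨i, k, rfl, h'⟩
      simp only [List.prod_nil, Perm.one_apply] at h'
      nlinarith [mul_self_nonneg (P.root i a - k)]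
    rw [this, Set.ncard_empty, List.length_nil]
  | cons s L ih =>
    have hs := hL s (by simp)
    have hL' : ∀ s ∈ L, s ∈ S := fun r hr => hL r (by simp [hr])
    have hsA := h.mem_autGroup hs
    have hsa := h.regular.apply hsA
    have hwa := h.regular.apply (h.list_prod_mem hL)
    have hsub : sepSet P a ((s :: L).prod a) ⊆
        insert s ((fun t => s * t * s⁻¹) '' sepSet P a (L.prod a)) := by
      intro t ht
      by_cases hts : t = s
      · exact Or.inl hts
      · right
        change Separates P _ _ _ at ht
        have h1 := separates_trans_iff ht.mem h.regular hsa hwa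
        have h2 : ¬ Separates P t a (s a) := fun h' => hts (h.eq_of_separates s hs t h')
        refine ⟨s⁻¹ * t * s, ?_, by group⟩
        change Separates P _ _ _
        rw [← separates_conj hsA, ← Perm.mul_apply, ← List.prod_cons]
        have e : s * (s⁻¹ * t * s) * s⁻¹ = t := by group
        rw [e]
        tauto
    have h1 := Set.ncard_le_ncard hsub (((finite_sepSet _ _).image _).insert _)
    have h2 := Set.ncard_insert_le s ((fun t => s * t * s⁻¹) '' sepSet P a (L.prod a))
    have h3 := Set.ncard_image_le (f := fun t => s * t * s⁻¹) (finite_sepSet (P := P) a (L.prod a))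
    have h4 := ih hL'
    rw [List.length_cons]
    omega

/-- In a shortest word each new letter must cross a new hyperplane, since otherwise the exchange
property produces a shorter word. -/
lemma length_le_of_minimal {L : List (Perm V)} (hL : ∀ s ∈ L, s ∈ S)
    (hmin : ∀ L' : List (Perm V), (∀ s ∈ L', s ∈ S) → L'.prod = L.prod → L.length ≤ L'.length) :
    L.length ≤ (sepSet P a (L.prod a)).ncard := by
  induction L with
  | nil => simp
  | cons s L ih =>
    have hs := hL s (by simp)
    have hL' : ∀ s ∈ L, s ∈ S := fun r hr => hL r (by simp [hr])
    have h1 := ih hL' fun L' h1 h2 => by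
      have := hmin (s :: L') (by simpa using ⟨hs, h1⟩) (by simp [h2])
      simpa using this
    have h2 : ¬ Separates P s a (L.prod a) := by
      intro h2
      obtain ⟨L', h3, h4, h5⟩ := h.exchange hL' h2
      have := hmin L' h3 (by rw [h5, List.prod_cons])
      simp only [List.length_cons] at this
      omega
    have h3 := ncard_sepSet_lt (h.subset hs) h.regular
      (h.regular.apply (h.list_prod_mem hL')) h2
    rw [List.prod_cons, Perm.mul_apply, List.length_cons]
    omega

/-- This turns the combinatorial length into a count of hyperplanes; later comparisons of lengths go
through it. -/
lemma wordLength_eq {w : Perm V} (hw : w ∈ affGroup P) :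
    wordLength S w = (sepSet P a (w a)).ncard := by
  have hne : {l | ∃ L : List (Perm V), (∀ s ∈ L, s ∈ S) ∧ L.prod = w ∧ L.length = l}.Nonempty := by
    obtain ⟨L, hL, rfl⟩ := h.exists_list hw
    exact ⟨_, L, hL, rfl, rfl⟩
  obtain ⟨L, hL, h1, h2⟩ := Nat.sInf_mem hne
  change L.length = wordLength S w at h2
  rw [← h2, ← h1]
  refine le_antisymm (h.length_le_of_minimal hL fun L' h3 h4 => ?_) (h.ncard_sepSet_prod_le hL)
  rw [h2]
  exact Nat.sInf_le ⟨L', h3, h4.trans h1, rfl⟩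

/-- No separating hyperplane means length zero, hence the empty word: the group acts freely on
alcoves. -/
lemma eq_one_of_forall_not_separates {w : Perm V} (hw : w ∈ affGroup P)
    (hw' : ∀ t, ¬ Separates P t a (w a)) : w = 1 := by
  have h0 : sepSet P a (w a) = ∅ := Set.eq_empty_of_forall_notMem hw'
  have h1 := h.wordLength_eq hw
  rw [h0, Set.ncard_empty] at h1
  have hne : {l | ∃ L : List (Perm V), (∀ s ∈ L, s ∈ S) ∧ L.prod = w ∧ L.length = l}.Nonempty := by
    obtain ⟨L, hL, rfl⟩ := h.exists_list hw
    exact ⟨_, L, hL, rfl, rfl⟩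
  obtain ⟨L, -, h2, h3⟩ := Nat.sInf_mem hne
  change L.length = wordLength S w at h3
  rw [h1, List.length_eq_zero_iff] at h3
  rw [← h2, h3, List.prod_nil]

/-- Transitivity on alcoves: reflect in a separating wall as long as there is one; each reflection
lowers the number of hyperplanes to cross. -/
lemma exists_forall_not_separates {y : V} (hy : Regular P y) :
    ∃ w ∈ affGroup P, ∀ t, ¬ Separates P t a (w y) := by
  generalize hN : (sepSet P a y).ncard = N
  induction N using Nat.strong_induction_on generalizing y with
  | _ N ih =>
  by_cases h' : ∃ s ∈ S, Separates P s a y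
  · obtain ⟨s, hs, hs'⟩ := h'
    obtain ⟨w, hw, hw'⟩ := ih _ (hN ▸ ncard_sepSet_gt h.regular hy hs')
      (hy.apply (h.mem_autGroup hs)) rfl
    exact ⟨w * s, mul_mem hw (mem_affGroup (h.subset hs)), hw'⟩
  · push Not at h'
    exact ⟨1, one_mem _, h.not_separates y hy h'⟩

lemma bruhat_step {t w : Perm V} (ht : t ∈ reflections P) (hw : w ∈ affGroup P)
    (hsep : ¬ Separates P t a (w a)) : BruhatLE S w (t * w) := by
  have hwA := affGroup_le_autGroup hw
  have hlen : wordLength S w < wordLength S (t * w) := by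
    rw [h.wordLength_eq hw, h.wordLength_eq (mul_mem (mem_affGroup ht) hw)]
    exact ncard_sepSet_lt ht h.regular (h.regular.apply hwA) hsep
  obtain ⟨g, hg, s, hs, rfl⟩ := h.exists_conj ht
  refine Relation.ReflTransGen.single ⟨g, hg, s, hs, ?_, rfl, hlen⟩
  rwa [h.closure_eq]

end IsWallSet

end AffineWeyl

/-! ### Walls of the antidominant alcove. -/

namespace AffineWeyl

open Module Equiv PadicGroup

variable {ι V : Type*} [Finite ι] [AddCommGroup V] [Module ℝ V]
  {P : RootPairing ι ℝ (Dual ℝ V) V} [P.IsEval] [P.IsCrystallographic]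

lemma root_reflectionPerm_self (i : ι) (x : V) : P.root (P.reflectionPerm i i) x = -P.root i x := by
  rw [P.root_reflectionPerm, P.reflection_apply_self, LinearMap.neg_apply]

lemma affRefl_neg (i : ι) (k : ℤ) : affRefl P (P.reflectionPerm i i) (-k) = affRefl P i k := by
  ext x
  rw [affRefl_apply, affRefl_apply, root_reflectionPerm_self, P.coroot_reflectionPerm,
    P.coreflection_apply_self]
  push_cast
  module

lemma exists_root_eq_smul_of_ker_le {i j : ι}
    (h : ∀ d, P.root i d = 0 → P.root j d = 0) : ∃ c : ℝ, P.root j = c • P.root i := by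
  refine ⟨P.pairing j i / 2, LinearMap.ext fun x => ?_⟩
  have h1 := h (x - (P.root i x / 2) • P.coroot i) (by
    rw [map_sub, map_smul, root_coroot_self, smul_eq_mul]
    ring)
  rw [map_sub, map_smul, root_coroot, smul_eq_mul] at h1
  rw [LinearMap.smul_apply, smul_eq_mul]
  linarith

/-- Equal hyperplanes have proportional roots, and in a reduced system proportional roots agree up
to sign; the level follows the sign. -/
lemma affRefl_eq_of_forall_iff [P.IsReduced] {i j : ι} {k m : ℤ}
    (h : ∀ y, P.root j y = m ↔ P.root i y = k) : affRefl P j m = affRefl P i k := by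
  set y₀ := ((k : ℝ) / 2) • P.coroot i with hy₀
  have h0 : P.root i y₀ = k := by
    rw [hy₀, map_smul, root_coroot_self, smul_eq_mul]
    ring
  obtain ⟨c, hc⟩ := exists_root_eq_smul_of_ker_le (P := P) (i := i) (j := j) fun d hd => by
    have h1 := (h y₀).2 h0
    have h2 := (h (y₀ + d)).2 (by rw [map_add, h0, hd, add_zero])
    rw [map_add, h1] at h2
    linarith
  have hm : (m : ℝ) = c * k := by
    rw [← (h y₀).2 h0, hc, LinearMap.smul_apply, h0, smul_eq_mul]
  have hdep : ¬ LinearIndependent ℝ ![P.root j, P.root i] := by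
    intro hl
    have := (LinearIndependent.pair_iff.1 hl 1 (-c) (by rw [hc]; module)).1
    norm_num at this
  have hne : ∃ x, P.root i x ≠ 0 := ⟨P.coroot i, by rw [root_coroot_self]; norm_num⟩
  obtain ⟨x, hx⟩ := hne
  have hcx : P.root j x = c * P.root i x := by rw [hc]; rfl
  rcases RootPairing.IsReduced.eq_or_eq_neg (P := P) j i hdep with h1 | h1
  · have hji := P.root.injective h1
    subst hji
    have hc1 : c = 1 := by
      have : (c - 1) * P.root j x = 0 := by linarith
      rcases mul_eq_zero.1 this with h | h
      · linarith
      · exact absurd h hx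
    rw [hc1, one_mul] at hm
    rw [show m = k by exact_mod_cast hm]
  · have h2 : P.root j = P.root (P.reflectionPerm i i) := by
      rw [h1, P.root_reflectionPerm, P.reflection_apply_self]
    have hji := P.root.injective h2
    have hc1 : c = -1 := by
      rw [h1, LinearMap.neg_apply] at hcx
      have : (c + 1) * P.root i x = 0 := by linarith
      rcases mul_eq_zero.1 this with h | h
      · linarith
      · exact absurd h hx
    rw [hc1] at hm
    have hmk : m = -k := by
      have : (m : ℝ) = -k := by linarith
      exact_mod_cast this
    rw [hji, hmk, affRefl_neg]

variable (b : P.Base)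

lemma isPos_reflectionPerm_self (i : ι) (h : ¬ b.IsPos i) : b.IsPos (P.reflectionPerm i i) :=
  (RootPairing.Base.IsPos.or_neg b i).resolve_left h

/-- The closure of the antidominant alcove with vertex `0`. -/
def closedAlcove : Set V := {x | ∀ i, b.IsPos i → -1 ≤ P.root i x ∧ P.root i x ≤ 0}

/-- The antidominant alcove with vertex `0`. -/
def alcove : Set V := {x | ∀ i, b.IsPos i → -1 < P.root i x ∧ P.root i x < 0}

/-- The walls of the antidominant alcove. -/
def IsWall (i : ι) (k : ℤ) : Prop :=
  ∃ x ∈ closedAlcove b, P.root i x = k ∧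
    ∀ (j : ι) (m : ℤ), P.root j x = m → ∀ y, P.root j y = m ↔ P.root i y = k

/-- The reflections in the walls of the antidominant alcove. -/
def walls : Set (Perm V) := {t | ∃ i k, t = affRefl P i k ∧ IsWall b i k}

variable {b}

/-- No integer lies strictly between -1 and 0, so no hyperplane passes between a point of the alcove
and a point of its closure. -/
lemma mul_nonneg_of_mem {a q : V} (ha : a ∈ alcove b) (hq : q ∈ closedAlcove b) (i : ι) (k : ℤ) :
    0 ≤ (P.root i a - k) * (P.root i q - k) := by
  have key : ∀ (i : ι) (k : ℤ), b.IsPos i → 0 ≤ (P.root i a - k) * (P.root i q - k) := by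
    intro i k hi
    obtain ⟨h1, h2⟩ := ha i hi
    obtain ⟨h3, h4⟩ := hq i hi
    rcases le_or_gt 0 k with hk | hk
    · have hk' : (0 : ℝ) ≤ k := by exact_mod_cast hk
      exact mul_nonneg_of_nonpos_of_nonpos (by linarith) (by linarith)
    · have hk' : (k : ℝ) ≤ -1 := by exact_mod_cast Int.le_sub_one_of_lt hk
      exact mul_nonneg (by linarith) (by linarith)
  by_cases hi : b.IsPos i
  · exact key i k hi
  · have h := key _ (-k) (isPos_reflectionPerm_self b i hi)
    rw [root_reflectionPerm_self, root_reflectionPerm_self] at h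
    push_cast at h
    nlinarith

lemma mem_closedAlcove_of_mul_nonneg {a q : V} (ha : a ∈ alcove b)
    (h : ∀ i (k : ℤ), 0 ≤ (P.root i a - k) * (P.root i q - k)) : q ∈ closedAlcove b := by
  intro i hi
  obtain ⟨h1, h2⟩ := ha i hi
  have h3 := h i 0
  have h4 := h i (-1)
  push_cast at h3 h4
  constructor
  · by_contra! h'
    nlinarith
  · by_contra! h'
    nlinarith

lemma alcove_subset_closedAlcove : alcove b ⊆ closedAlcove b := fun _ h i hi =>
  ⟨(h i hi).1.le, (h i hi).2.le⟩

lemma regular_of_mem_alcove {a : V} (ha : a ∈ alcove b) : Regular P a := by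
  have key : ∀ (i : ι) (k : ℤ), b.IsPos i → P.root i a ≠ k := by
    intro i k hi h
    obtain ⟨h1, h2⟩ := ha i hi
    rw [h] at h1 h2
    have h1' : -1 < k := by exact_mod_cast h1
    have h2' : k < 0 := by exact_mod_cast h2
    omega
  intro i k h
  by_cases hi : b.IsPos i
  · exact key i k hi h
  · refine key _ (-k) (isPos_reflectionPerm_self b i hi) ?_
    rw [root_reflectionPerm_self, h]
    push_cast
    rfl

lemma not_separates_of_mem {a q : V} (ha : a ∈ alcove b) (hq : q ∈ closedAlcove b) (t : Perm V) :
    ¬ Separates P t a q := by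
  rintro ⟨i, k, -, h⟩
  exact absurd (mul_nonneg_of_mem ha hq i k) (not_le.2 h)

lemma mem_alcove_of_not_separates {a q : V} (ha : a ∈ alcove b) (hq : Regular P q)
    (h : ∀ t, ¬ Separates P t a q) : q ∈ alcove b := by
  have h1 : q ∈ closedAlcove b := mem_closedAlcove_of_mul_nonneg ha fun i k => by
    by_contra! h'
    exact h _ ⟨i, k, rfl, h'⟩
  intro i hi
  refine ⟨lt_of_le_of_ne (h1 i hi).1 fun h2 => hq i (-1) ?_,
    lt_of_le_of_ne (h1 i hi).2 fun h2 => hq i 0 ?_⟩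
  · rw [← h2]; simp
  · rw [h2]; simp

/-- The wall has a point `x` of the closed alcove lying on no other hyperplane, and the reflection
fixes `x`. For any other hyperplane, `a` and its mirror image are both on the side of `x`. -/
lemma eq_of_separates_of_isWall [P.IsReduced] {a : V} (ha : a ∈ alcove b) {i : ι} {k : ℤ}
    (hw : IsWall b i k) {t : Perm V} (ht : Separates P t a (affRefl P i k a)) :
    t = affRefl P i k := by
  obtain ⟨x, hx, hxk, hx'⟩ := hw
  obtain ⟨j, m, rfl, h⟩ := ht
  by_cases hjx : P.root j x = m
  · exact affRefl_eq_of_forall_iff (hx' j m hjx)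
  exfalso
  have hsA := affRefl_mem_autGroup (P := P) i k
  obtain ⟨j', m', h'⟩ := (hsA.2 _).1 (affRefl_mem P j m)
  obtain ⟨c, hc, hc'⟩ := exists_root_apply_sub hsA h'
  have hsx : affRefl P i k x = x := by
    rw [affRefl_apply, hxk, sub_self, zero_smul, sub_zero]
  have h1 := hc' x
  have h2 := hc' (affRefl P i k a)
  rw [hsx] at h1
  rw [affRefl_affRefl] at h2
  have h3 := mul_nonneg_of_mem ha hx j' m'
  rw [h1, h2] at h3
  have h4 := mul_nonneg_of_mem ha hx j m
  have h5 : 0 < c ^ 2 := by positivity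
  have h6 : 0 < (P.root j x - m) ^ 2 := by
    have := sub_ne_zero.2 hjx
    positivity
  have h7 : 0 ≤ (P.root j (affRefl P i k a) - m) * (P.root j x - m) := by
    by_contra! h8
    have := mul_neg_of_pos_of_neg h5 h8
    nlinarith
  have h9 := mul_neg_of_neg_of_pos h h6
  have h10 := mul_nonneg h4 h7
  nlinarith

/-- The limit δ → 0 made explicit; it carries inequalities from the open alcove to its closure. -/
lemma nonneg_of_forall_pos {u v : ℝ} (h : ∀ δ : ℝ, 0 < δ → δ ≤ 1 → 0 ≤ u + δ * v) : 0 ≤ u := by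
  by_contra! hu
  have hd : 0 < |v| + |u| + 1 := by positivity
  have h1 : 0 < -u / (|v| + |u| + 1) := by
    have : 0 < -u := by linarith
    positivity
  have h2 := h _ h1 (by
    rw [div_le_one hd]
    have := neg_abs_le u
    have := abs_nonneg v
    linarith)
  have h3 : -u / (|v| + |u| + 1) * v ≤ -u / (|v| + |u| + 1) * |v| := by
    have := le_abs_self v
    gcongr
  have h4 : -u / (|v| + |u| + 1) * |v| = -u - (-u / (|v| + |u| + 1)) * (|u| + 1) := by
    field_simp
    ring
  have h5 : 0 < (-u / (|v| + |u| + 1)) * (|u| + 1) := by positivity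
  linarith

/-- The antidominant alcove is cut out by finitely many of its walls. -/
lemma exists_finset_isWall [P.IsReduced] {a : V} (ha : a ∈ alcove b) :
    ∃ J : Finset (ι × ℤ), (∀ p ∈ J, IsWall b p.1 p.2 ∧ 0 < P.root p.1 a - p.2) ∧
      (∀ x, (∀ p ∈ J, 0 < P.root p.1 x - p.2) → x ∈ alcove b) ∧
      ∀ x, (∀ p ∈ J, 0 ≤ P.root p.1 x - p.2) → x ∈ closedAlcove b := by
  classical
  have _i : Fintype ι := Fintype.ofFinite ι
  -- Both bounds of the alcove in the uniform form ⟨α_i, x⟩ > k: level -1 for positive roots, level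
  -- 0 for negative ones.
  let J₀ : Finset (ι × ℤ) :=
    (Finset.univ.filter fun i => b.IsPos i) ×ˢ {-1} ∪ (Finset.univ.filter fun i => ¬ b.IsPos i) ×ˢ {0}
  let Q : Finset (ι × ℤ) → Prop := fun J => ∀ x, (∀ p ∈ J, 0 < P.root p.1 x - p.2) → x ∈ alcove b
  have hposa : ∀ p ∈ J₀, 0 < P.root p.1 a - p.2 := by
    rintro ⟨i, k⟩ hp
    simp only [J₀, Finset.mem_union, Finset.mem_product, Finset.mem_filter, Finset.mem_univ,
      true_and, Finset.mem_singleton] at hp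
    rcases hp with ⟨hi, rfl⟩ | ⟨hi, rfl⟩
    · have := (ha i hi).1
      push_cast
      linarith
    · have := (ha _ (isPos_reflectionPerm_self b i hi)).2
      rw [root_reflectionPerm_self] at this
      push_cast
      linarith
  have hQ₀ : Q J₀ := by
    intro x hx i hi
    constructor
    · have := hx (i, -1) (by simp [J₀, hi])
      push_cast at this
      linarith
    · have hneg : ¬ b.IsPos (P.reflectionPerm i i) := by
        have := RootPairing.Base.IsPos.neg_iff_not b (P.reflectionPerm i i)
        intro h
        exact (RootPairing.Base.IsPos.neg_iff_not b i).1 h hi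
      have := hx (P.reflectionPerm i i, 0) (by simp [J₀, hneg])
      simp only [root_reflectionPerm_self] at this
      push_cast at this
      linarith
  -- In a system of inequalities of minimal size none is redundant; this is what makes each of them
  -- a wall.
  obtain ⟨J, hJ, hmin⟩ := Finset.exists_min_image (J₀.powerset.filter Q) Finset.card
    ⟨J₀, by simp [hQ₀]⟩
  simp only [Finset.mem_filter, Finset.mem_powerset, and_imp] at hJ hmin
  obtain ⟨hJ₀, hJQ⟩ := hJ
  have hclosed : ∀ x, (∀ p ∈ J, 0 ≤ P.root p.1 x - p.2) → x ∈ closedAlcove b := by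
    intro x hx
    have h1 : ∀ δ : ℝ, 0 < δ → δ ≤ 1 → x + δ • (a - x) ∈ alcove b := by
      intro δ h0 h1
      refine hJQ _ fun p hp => ?_
      have h2 := hx p hp
      have h3 := hposa p (hJ₀ hp)
      rw [map_add, map_smul, map_sub, smul_eq_mul]
      nlinarith [mul_nonneg (sub_nonneg.2 h1) h2, mul_pos h0 h3]
    intro i hi
    constructor
    · have : 0 ≤ P.root i x + 1 := nonneg_of_forall_pos (v := P.root i a - P.root i x)
        fun δ h0 h2 => by
          have := (h1 δ h0 h2 i hi).1
          rw [map_add, map_smul, map_sub, smul_eq_mul] at this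
          linarith
      linarith
    · have : 0 ≤ -P.root i x := nonneg_of_forall_pos (v := -(P.root i a - P.root i x))
        fun δ h0 h2 => by
          have := (h1 δ h0 h2 i hi).2
          rw [map_add, map_smul, map_sub, smul_eq_mul] at this
          linarith
      linarith
  refine ⟨J, fun p hp => ⟨?_, hposa p (hJ₀ hp)⟩, hJQ, hclosed⟩
  have hnot : ¬ Q (J.erase p) := by
    intro h
    have h1 := hmin (J.erase p) ((Finset.erase_subset _ _).trans hJ₀) h
    have h2 := Finset.card_erase_lt_of_mem hp
    omega
  obtain ⟨z, hz, hz'⟩ : ∃ z, (∀ q ∈ J.erase p, 0 < P.root q.1 z - q.2) ∧ z ∉ alcove b := by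
    by_contra! h
    exact hnot h
  have hzp : P.root p.1 z - p.2 ≤ 0 := by
    by_contra! h
    refine hz' (hJQ z fun q hq => ?_)
    by_cases hqp : q = p
    · exact hqp ▸ h
    · exact hz q (Finset.mem_erase.2 ⟨hqp, hq⟩)
  have hap := hposa p (hJ₀ hp)
  set u := P.root p.1 a - p.2 with hu
  set w := P.root p.1 z - p.2 with hw
  -- Without the inequality `p` there is a point `z` outside the alcove. This parameter marks where
  -- the segment from `a` to `z` meets the hyperplane of `p`; there all the other inequalities are
  -- still strict.
  set s := u / (u - w) with hs
  have huw : 0 < u - w := by linarith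
  have hs0 : 0 < s := by positivity
  have hs1 : s ≤ 1 := by
    rw [hs, div_le_one huw]
    linarith
  have hsuw : s * (u - w) = u := by rw [hs]; field_simp
  set x := a + s • (z - a) with hx
  have hxp : P.root p.1 x = p.2 := by
    have : P.root p.1 x - p.2 = u - s * (u - w) := by
      rw [hx, map_add, map_smul, map_sub, smul_eq_mul, hu, hw]
      ring
    rw [hsuw, sub_self] at this
    linarith
  have hxq : ∀ q ∈ J.erase p, 0 < P.root q.1 x - q.2 := by
    intro q hq
    have h1 := hz q hq
    have h2 := hposa q (hJ₀ (Finset.mem_of_mem_erase hq))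
    rw [hx, map_add, map_smul, map_sub, smul_eq_mul]
    nlinarith [mul_nonneg (sub_nonneg.2 hs1) h2.le, mul_pos hs0 h1]
  refine ⟨x, hclosed x fun q hq => ?_, hxp, fun j m hjm => ?_⟩
  · by_cases hqp : q = p
    · rw [hqp, hxp, sub_self]
    · exact (hxq q (Finset.mem_erase.2 ⟨hqp, hq⟩)).le
  -- Inside the hyperplane of `p`, the point `x` can move a little in both directions without
  -- leaving the closed alcove. Another hyperplane through `x` does not cut the alcove, so its root
  -- must vanish along all such directions.
  have hker : ∀ d, P.root p.1 d = 0 → P.root j d = 0 := by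
    intro d hd
    have hev : ∀ᶠ ε : ℝ in nhds 0, ∀ q ∈ J.erase p, 0 < P.root q.1 x - q.2 + ε * P.root q.1 d := by
      rw [Filter.eventually_all_finset]
      intro q hq
      have hcont : Continuous fun ε : ℝ => P.root q.1 x - q.2 + ε * P.root q.1 d := by fun_prop
      refine hcont.continuousAt.eventually (lt_mem_nhds ?_)
      simpa using hxq q hq
    obtain ⟨δ, hδ, hδ'⟩ := Metric.eventually_nhds_iff.1 hev
    have hmem : ∀ ε : ℝ, |ε| < δ → x + ε • d ∈ closedAlcove b := by
      intro ε hε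
      refine hclosed _ fun q hq => ?_
      rw [map_add, map_smul, smul_eq_mul]
      by_cases hqp : q = p
      · rw [hqp, hxp, hd]
        simp
      · have := hδ' (y := ε) (by simpa using hε) q (Finset.mem_erase.2 ⟨hqp, hq⟩)
        linarith
    have hsgn : ∀ ε : ℝ, |ε| < δ → 0 ≤ (P.root j a - m) * (ε * P.root j d) := by
      intro ε hε
      have := mul_nonneg_of_mem ha (hmem ε hε) j m
      rwa [map_add, map_smul, smul_eq_mul, hjm, add_sub_cancel_left] at this
    have h1 := hsgn (δ / 2) (by rw [abs_of_pos (by positivity)]; linarith)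
    have h2 := hsgn (-(δ / 2)) (by rw [abs_neg, abs_of_pos (by positivity)]; linarith)
    have h3 : (P.root j a - m) * (δ / 2 * P.root j d) = 0 := by nlinarith
    rcases mul_eq_zero.1 h3 with h4 | h4
    · exact absurd h4 ((regular_of_mem_alcove ha).sub_ne j m)
    · rcases mul_eq_zero.1 h4 with h5 | h5
      · linarith
      · exact h5
  obtain ⟨c, hc⟩ := exists_root_eq_smul_of_ker_le hker
  have hc0 : c ≠ 0 := by
    rintro rfl
    rw [zero_smul] at hc
    exact P.ne_zero j hc
  intro y
  have h1 : P.root j y - m = c * (P.root p.1 y - p.2) := by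
    rw [← hjm, ← hxp, hc, LinearMap.smul_apply, LinearMap.smul_apply, smul_eq_mul, smul_eq_mul]
    ring
  constructor
  · intro h
    rw [h, sub_self] at h1
    rcases mul_eq_zero.1 h1.symm with h2 | h2
    · exact absurd h2 hc0
    · linarith
  · intro h
    rw [h, sub_self, mul_zero] at h1
    linarith

lemma isWallSet_walls [P.IsReduced] {a : V} (ha : a ∈ alcove b) : IsWallSet P a (walls b) where
  regular := regular_of_mem_alcove ha
  subset := by
    rintro t ⟨i, k, rfl, -⟩
    exact affRefl_mem P i k
  eq_of_separates := by
    rintro s ⟨i, k, rfl, hw⟩ t ht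
    exact eq_of_separates_of_isWall ha hw ht
  not_separates := by
    intro y hy h
    obtain ⟨J, hJ, hJ', -⟩ := exists_finset_isWall ha
    have : y ∈ alcove b := hJ' y fun p hp => by
      obtain ⟨h1, h2⟩ := hJ p hp
      by_contra! h3
      refine h _ ⟨p.1, p.2, rfl, h1⟩ (separates_affRefl.2 ?_)
      exact mul_neg_of_pos_of_neg h2 (lt_of_le_of_ne h3 (hy.sub_ne _ _))
    exact not_separates_of_mem ha (alcove_subset_closedAlcove this)

/-- An element of `autGroup` which preserves the alcove permutes its walls. -/
lemma conj_mem_walls {a : V} (ha : a ∈ alcove b) {g : Perm V} (hg : g ∈ autGroup P)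
    (h : ∀ t, ¬ Separates P t a (g a)) {s : Perm V} (hs : s ∈ walls b) :
    g * s * g⁻¹ ∈ walls b := by
  obtain ⟨i, k, rfl, x, hx, hxk, hx'⟩ := hs
  obtain ⟨j, m, hjm⟩ := (hg.2 _).1 (affRefl_mem P i k)
  have hga := mem_alcove_of_not_separates ha ((regular_of_mem_alcove ha).apply hg) h
  obtain ⟨c, hc, hc'⟩ := exists_root_apply_sub hg hjm
  refine ⟨j, m, hjm, g x, ?_, ?_, ?_⟩
  · refine mem_closedAlcove_of_mul_nonneg hga fun i' k' => ?_
    obtain ⟨i₁, k₁, h₁⟩ := ((inv_mem hg).2 _).1 (affRefl_mem P i' k')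
    rw [inv_inv] at h₁
    have h2 : g * affRefl P i₁ k₁ * g⁻¹ = affRefl P i' k' := by rw [← h₁]; group
    obtain ⟨d, -, hd⟩ := exists_root_apply_sub hg h2
    rw [hd, hd]
    have := mul_nonneg (sq_nonneg d) (mul_nonneg_of_mem ha hx i₁ k₁)
    nlinarith
  · have := hc' x
    rw [hxk, sub_self, mul_zero] at this
    linarith
  · intro i' k' hik y
    obtain ⟨i₁, k₁, h₁⟩ := ((inv_mem hg).2 _).1 (affRefl_mem P i' k')
    rw [inv_inv] at h₁
    have h2 : g * affRefl P i₁ k₁ * g⁻¹ = affRefl P i' k' := by rw [← h₁]; group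
    obtain ⟨d, hd0, hd⟩ := exists_root_apply_sub hg h2
    have h3 := hd x
    rw [hik, sub_self] at h3
    have h4 := sub_eq_zero.1 ((mul_eq_zero.1 h3.symm).resolve_left hd0)
    have h5 := hx' _ _ h4 (g⁻¹ y)
    have h6 := hd (g⁻¹ y)
    have h7 := hc' (g⁻¹ y)
    have e : g (g⁻¹ y) = y := by rw [← Perm.mul_apply, mul_inv_cancel, Perm.one_apply]
    rw [e] at h6 h7
    have h8 : P.root i' y = k' ↔ P.root i₁ (g⁻¹ y) = k₁ := by
      rw [← sub_eq_zero, h6, mul_eq_zero, or_iff_right hd0, sub_eq_zero]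
    have h9 : P.root j y = m ↔ P.root i (g⁻¹ y) = k := by
      rw [← sub_eq_zero, h7, mul_eq_zero, or_iff_right hc, sub_eq_zero]
    rw [h8, h9]
    exact h5

end AffineWeyl

/-! ### Simple walls, and the image of the vertex 0 under alcove symmetries. -/

namespace AffineWeyl

open Module Equiv PadicGroup

variable {ι V : Type*} [Finite ι] [AddCommGroup V] [Module ℝ V]
  {P : RootPairing ι ℝ (Dual ℝ V) V} [P.IsEval] [P.IsCrystallographic] [P.IsReduced]
  [P.IsRootSystem] (b : P.Base)

/-- The simple roots form a basis of the dual, and the perfect pairing identifies `V` with its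
bidual. -/
lemma exists_root_eq (r : ι → ℝ) : ∃ x : V, ∀ i ∈ b.support, P.root i x = r i := by
  let φ : Dual ℝ (Dual ℝ V) := b.toWeightBasis.constr ℝ fun i => r i
  refine ⟨P.toLinearMap.flip.toPerfPair.symm φ, fun i hi => ?_⟩
  rw [← RootPairing.IsEval.toLinearMap_apply (P := P)]
  have h1 : P.toLinearMap (P.root i) (P.toLinearMap.flip.toPerfPair.symm φ) =
      P.toLinearMap.flip.toPerfPair (P.toLinearMap.flip.toPerfPair.symm φ) (P.root i) := rfl
  rw [h1, LinearEquiv.apply_symm_apply]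
  have := b.toWeightBasis.constr_basis ℝ (fun i => r i) ⟨i, hi⟩
  rwa [b.toWeightBasis_apply] at this

/-- A positive root is a combination of the simple roots with coefficients in `ℕ`. -/
lemma exists_root_eq_sum_of_isPos {i : ι} (hi : b.IsPos i) :
    ∃ f : ι → ℕ, (∃ j ∈ b.support, f j ≠ 0) ∧ P.root i = ∑ j ∈ b.support, (f j : ℝ) • P.root j := by
  obtain ⟨f, hf₀, hf₁, hf₂⟩ := b.exists_root_eq_sum_int i
  have hf₁' : 0 < f := by
    refine hf₁.resolve_right fun h => ?_
    rw [RootPairing.Base.isPos_iff, RootPairing.Base.height_eq_sum hf₂] at hi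
    exact absurd hi (not_lt.2 (Finset.sum_nonpos fun i _ => h.le i))
  have hfn : ∀ j, ((f j).toNat : ℤ) = f j := fun j => Int.toNat_of_nonneg (hf₁'.le j)
  refine ⟨fun j => (f j).toNat, ?_, ?_⟩
  · by_contra! h
    refine P.ne_zero i ?_
    rw [hf₂]
    refine Finset.sum_eq_zero fun j hj => ?_
    rw [← hfn, h j hj]
    simp
  · rw [hf₂]
    refine Finset.sum_congr rfl fun j _ => ?_
    have : (((f j).toNat : ℕ) : ℝ) = (f j : ℝ) := by
      rw [← Int.cast_natCast, hfn]
    rw [← Int.cast_smul_eq_zsmul ℝ, this]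

lemma exists_small (x : V) : ∃ ε : ℝ, 0 < ε ∧ ∀ i, |P.root i (ε • x)| < 1 := by
  have _i : Fintype ι := Fintype.ofFinite ι
  have h0 : 0 ≤ ∑ i, |P.root i x| := Finset.sum_nonneg fun i _ => abs_nonneg _
  have h1 : 0 < 1 + ∑ i, |P.root i x| := by linarith
  refine ⟨1 / (1 + ∑ i, |P.root i x|), by positivity, fun i => ?_⟩
  rw [map_smul, smul_eq_mul, abs_mul, abs_of_pos (by positivity), div_mul_eq_mul_div, one_mul,
    div_lt_one h1]
  have := Finset.single_le_sum (f := fun i => |P.root i x|) (fun i _ => abs_nonneg _)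
    (Finset.mem_univ i)
  linarith

lemma alcove_nonempty : (alcove b).Nonempty := by
  obtain ⟨x, hx⟩ := exists_root_eq b fun _ => -1
  obtain ⟨ε, hε, hx'⟩ := exists_small (P := P) x
  refine ⟨ε • x, fun i hi => ⟨(abs_lt.1 (hx' i)).1, ?_⟩⟩
  obtain ⟨f, ⟨j, hj, hj'⟩, hf⟩ := exists_root_eq_sum_of_isPos b hi
  have : P.root i x = -∑ j ∈ b.support, (f j : ℝ) := by
    rw [hf, LinearMap.sum_apply, ← Finset.sum_neg_distrib]
    refine Finset.sum_congr rfl fun l hl => ?_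
    rw [LinearMap.smul_apply, hx l hl]
    simp
  rw [map_smul, this, smul_eq_mul]
  have h2 : 0 < ∑ j ∈ b.support, (f j : ℝ) := by
    refine Finset.sum_pos' (fun _ _ => by positivity) ⟨j, hj, ?_⟩
    exact_mod_cast Nat.pos_of_ne_zero hj'
  nlinarith [mul_pos hε h2]

/-- The witness annihilates the simple root `i`, is -1 on the other simple roots, and is scaled so
that all roots have absolute value below 1. Only hyperplanes of level 0 can contain it, and only
multiples of root `i` vanish there. -/
lemma isWall_of_mem_support {i : ι} (hi : i ∈ b.support) : IsWall b i 0 := by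
  classical
  obtain ⟨x', hx'⟩ := exists_root_eq b fun j => if j = i then 0 else -1
  obtain ⟨ε, hε, hsm⟩ := exists_small (P := P) x'
  have hval : ∀ {j : ι} (f : ι → ℕ), P.root j = ∑ l ∈ b.support, (f l : ℝ) • P.root l →
      P.root j (ε • x') = -(ε * ∑ l ∈ b.support.erase i, (f l : ℝ)) := by
    intro j f hf
    rw [map_smul, smul_eq_mul, hf, LinearMap.sum_apply, ← Finset.add_sum_erase _ _ hi,
      LinearMap.smul_apply, hx' i hi, if_pos rfl, smul_zero, zero_add, ← mul_neg,
      ← Finset.sum_neg_distrib]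
    congr 1
    refine Finset.sum_congr rfl fun l hl => ?_
    rw [LinearMap.smul_apply, hx' l (Finset.mem_of_mem_erase hl), if_neg (Finset.ne_of_mem_erase hl)]
    simp
  have hprop : ∀ j, b.IsPos j → P.root j (ε • x') = 0 → ∃ c : ℝ, c ≠ 0 ∧ P.root j = c • P.root i := by
    intro j hj h0
    obtain ⟨f, ⟨l, hl, hl'⟩, hf⟩ := exists_root_eq_sum_of_isPos b hj
    rw [hval f hf, neg_eq_zero, mul_eq_zero, or_iff_right hε.ne',
      Finset.sum_eq_zero_iff_of_nonneg fun _ _ => by positivity] at h0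
    have h1 : P.root j = (f i : ℝ) • P.root i := by
      rw [hf, ← Finset.add_sum_erase _ _ hi, Finset.sum_eq_zero, add_zero]
      intro l hl
      rw [h0 l hl, zero_smul]
    refine ⟨f i, ?_, h1⟩
    intro h2
    rw [h2, zero_smul] at h1
    exact P.ne_zero j h1
  have hint : ∀ (j : ι) (m : ℤ), P.root j (ε • x') = m → m = 0 := by
    intro j m h
    have := hsm j
    rw [h] at this
    have h' : |m| < 1 := by exact_mod_cast this
    exact Int.abs_lt_one_iff.1 h'
  refine ⟨ε • x', fun j hj => ⟨(abs_lt.1 (hsm j)).1.le, ?_⟩, ?_, fun j m hjm => ?_⟩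
  · obtain ⟨f, -, hf⟩ := exists_root_eq_sum_of_isPos b hj
    rw [hval f hf]
    have : 0 ≤ ε * ∑ l ∈ b.support.erase i, (f l : ℝ) := by positivity
    linarith
  · rw [map_smul, hx' i hi]
    simp
  · have hm := hint j m hjm
    subst hm
    push_cast at hjm ⊢
    obtain ⟨c, hc, h⟩ : ∃ c : ℝ, c ≠ 0 ∧ P.root j = c • P.root i := by
      by_cases hj : b.IsPos j
      · exact hprop j hj hjm
      · obtain ⟨c, hc, h⟩ := hprop _ (isPos_reflectionPerm_self b j hj)
          (by rw [root_reflectionPerm_self, hjm, neg_zero])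
        refine ⟨-c, neg_ne_zero.2 hc, ?_⟩
        rw [P.root_reflectionPerm, P.reflection_apply_self] at h
        rw [← neg_neg (P.root j), h]
        module
    intro y
    rw [h, LinearMap.smul_apply, smul_eq_mul, mul_eq_zero, or_iff_right hc]

variable {b}

/-- The walls of an alcove make acute angles. -/
lemma pairing_nonpos_of_isWall {a : V} (ha : a ∈ alcove b) {i j : ι} {k m : ℤ}
    (hi : IsWall b i k) (hj : IsWall b j m) (hia : 0 < P.root i a - k) (hja : 0 < P.root j a - m)
    (hne : affRefl P i k ≠ affRefl P j m) : P.pairing j i ≤ 0 := by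
  obtain ⟨x, hx, hxm, hx'⟩ := hj
  have h1 : 0 < P.root i x - k := by
    have h2 := mul_nonneg_of_mem ha hx i k
    refine lt_of_le_of_ne (by by_contra! h3; nlinarith) fun h3 => hne ?_
    exact affRefl_eq_of_forall_iff (hx' i k (sub_eq_zero.1 h3.symm))
  -- Only the wall `i` lies between `a` and its mirror image, so the mirror image stays on the
  -- positive side of the wall `j`.
  have h2 : 0 < P.root j (affRefl P i k a) - m := by
    by_contra! h3
    have hsa := (regular_of_mem_alcove ha).apply (affRefl_mem_autGroup (P := P) i k)
    have h4 := lt_of_le_of_ne h3 (hsa.sub_ne j m)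
    refine hne (eq_of_separates_of_isWall ha hi (t := affRefl P j m) ?_).symm
    exact separates_affRefl.2 (mul_neg_of_pos_of_neg hja h4)
  -- The mirror image of the hyperplane `j` in the wall `i` does not separate `a` from `x`.
  -- Reflecting back, the equation of `j` is nonnegative at the mirror image of `x`, where it equals
  -- -(⟨α_i, x⟩ - k) times the pairing.
  have hsA := affRefl_mem_autGroup (P := P) i k
  obtain ⟨j', m', h'⟩ := (hsA.2 _).1 (affRefl_mem P j m)
  obtain ⟨c, hc, hc'⟩ := exists_root_apply_sub hsA h'
  have h3 := hc' (affRefl P i k x)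
  have h4 := hc' (affRefl P i k a)
  rw [affRefl_affRefl] at h3 h4
  rw [root_affRefl, hxm] at h3
  have h5 := mul_nonneg_of_mem ha hx j' m'
  rw [h3, h4] at h5
  have h6 : 0 < c ^ 2 := by positivity
  have h7 : 0 < c ^ 2 * (P.root j (affRefl P i k a) - m) * (P.root i x - k) := by positivity
  by_contra! h8
  have h9 := mul_pos h7 h8
  nlinarith

/-- A vector which makes obtuse angles with the elements of an obtuse basis consisting of roots has
nonpositive coefficients. -/
lemma coeff_nonpos_of_pairing_nonpos {κ : Type*} (s : Finset κ) (u : κ → ι) (j : ι) (c : κ → ℝ)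
    (hli : LinearIndepOn ℝ (fun k => P.root (u k)) (s : Set κ))
    (hc : P.root j = ∑ k ∈ s, c k • P.root (u k))
    (huu : ∀ k ∈ s, ∀ l ∈ s, k ≠ l → P.pairing (u k) (u l) ≤ 0)
    (hju : ∀ k ∈ s, P.pairing j (u k) ≤ 0) : ∀ k ∈ s, c k ≤ 0 := by
  classical
  have _i : Fintype ι := Fintype.ofFinite ι
  set B := P.RootForm with hB
  have hself : ∀ f, 0 ≤ B f f := fun f => by
    rw [hB, P.rootForm_apply_apply]
    exact Finset.sum_nonneg fun i _ => mul_self_nonneg _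
  have hself0 : ∀ f, B f f = 0 → f = 0 := by
    intro f hf
    rw [hB, P.rootForm_apply_apply,
      Finset.sum_eq_zero_iff_of_nonneg fun i _ => mul_self_nonneg _] at hf
    have h1 : ∀ i, f (P.coroot i) = 0 := fun i => by
      have := mul_self_eq_zero.1 (hf i (Finset.mem_univ i))
      rwa [RootPairing.coroot', LinearMap.flip_apply, RootPairing.IsEval.toLinearMap_apply] at this
    refine LinearMap.ext_on
      (RootPairing.IsRootSystem.span_coroot_eq_top (P := P)) ?_
    rintro - ⟨i, rfl⟩
    exact h1 i
  have hroot : ∀ i j, P.pairing i j ≤ 0 → B (P.root i) (P.root j) ≤ 0 := by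
    intro i j h
    have h1 : 2 * B (P.root i) (P.root j) = P.pairing i j * B (P.root j) (P.root j) :=
      P.toInvariantForm.two_mul_apply_root_root i j
    have := mul_nonpos_of_nonpos_of_nonneg h (hself (P.root j))
    linarith
  -- Let `v` collect the terms with positive coefficients and `w` the rest. Obtuseness gives B(α_j,
  -- v) ≤ 0 and B(w, v) ≥ 0, so B(v, v) ≤ 0 and `v = 0`; independence then empties `s'`.
  set s' := s.filter fun k => 0 < c k with hs'
  set v := ∑ k ∈ s', c k • P.root (u k) with hv
  set w := ∑ k ∈ s.filter (fun k => ¬ 0 < c k), c k • P.root (u k) with hw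
  have hvw : P.root j = v + w := by
    rw [hc, hv, hw, Finset.sum_filter_add_sum_filter_not]
  have h1 : B (P.root j) v ≤ 0 := by
    rw [hv, map_sum]
    refine Finset.sum_nonpos fun k hk => ?_
    rw [map_smul, smul_eq_mul]
    obtain ⟨hk1, hk2⟩ := Finset.mem_filter.1 hk
    exact mul_nonpos_of_nonneg_of_nonpos hk2.le (hroot _ _ (hju k hk1))
  have h2 : 0 ≤ B w v := by
    rw [hv, map_sum]
    refine Finset.sum_nonneg fun k hk => ?_
    rw [hw, map_sum, LinearMap.sum_apply]
    refine Finset.sum_nonneg fun l hl => ?_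
    obtain ⟨hk1, hk2⟩ := Finset.mem_filter.1 hk
    obtain ⟨hl1, hl2⟩ := Finset.mem_filter.1 hl
    rw [map_smul, map_smul, LinearMap.smul_apply, smul_eq_mul, smul_eq_mul]
    refine mul_nonneg hk2.le (mul_nonneg_of_nonpos_of_nonpos (not_lt.1 hl2) (hroot _ _ ?_))
    exact huu l hl1 k hk1 (by rintro rfl; exact hl2 hk2)
  have h3 : B v v = 0 := by
    refine le_antisymm ?_ (hself v)
    rw [hvw, map_add, LinearMap.add_apply] at h1
    linarith
  have h4 := hself0 v h3
  intro k hk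
  by_contra! hk'
  have h5 : LinearIndepOn ℝ (fun k => P.root (u k)) (s' : Set κ) :=
    hli.mono (by exact_mod_cast Finset.filter_subset _ _)
  have := linearIndepOn_finset_iff.1 h5 c h4 k (Finset.mem_filter.2 ⟨hk, hk'⟩)
  linarith

/-- An element of `autGroup` which permutes the walls of the alcove maps the vertex `0` to a point
of the closed alcove. -/
lemma apply_zero_mem_closedAlcove {g : Perm V} (hg : g ∈ autGroup P)
    (h : ∀ s ∈ walls b, g * s * g⁻¹ ∈ walls b) : g 0 ∈ closedAlcove b := by
  obtain ⟨a, ha⟩ := alcove_nonempty b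
  have hreg := regular_of_mem_alcove ha
  -- The images of the simple walls are walls through `g 0`; each is named by the root that is
  -- positive on the side of the alcove.
  have horient : ∀ i ∈ b.support, ∃ (j : ι) (m : ℤ), g * affRefl P i 0 * g⁻¹ = affRefl P j m ∧
      IsWall b j m ∧ 0 < P.root j a - m := by
    intro i hi
    obtain ⟨j, m, hjm, hw⟩ := h _ ⟨i, 0, rfl, isWall_of_mem_support b hi⟩
    rcases (hreg.sub_ne j m).lt_or_gt with h1 | h1
    · refine ⟨P.reflectionPerm j j, -m, by rw [affRefl_neg, hjm], ?_, ?_⟩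
      · obtain ⟨x, hx, hxm, hx'⟩ := hw
        have e : ∀ y, P.root (P.reflectionPerm j j) y = (-m : ℤ) ↔ P.root j y = m := by
          intro y
          rw [root_reflectionPerm_self]
          push_cast
          exact neg_inj
        exact ⟨x, hx, (e x).2 hxm, fun j' m' h' y => by rw [e, hx' j' m' h']⟩
      · rw [root_reflectionPerm_self]
        push_cast
        linarith
    · exact ⟨j, m, hjm, hw, h1⟩
  choose! u m hum hwall hpos using horient
  have hform : ∀ i ∈ b.support, ∃ c : ℝ, c ≠ 0 ∧
      ∀ x, P.root (u i) (g x) - m i = c * P.root i x := by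
    intro i hi
    obtain ⟨c, hc, hc'⟩ := exists_root_apply_sub hg (hum i hi)
    exact ⟨c, hc, fun x => by simpa using hc' x⟩
  choose! c hc0 hc using hform
  obtain ⟨⟨L, hL⟩, -⟩ := id hg
  have hzero : ∀ i ∈ b.support, P.root (u i) (g 0) = m i := by
    intro i hi
    have := hc i hi 0
    rw [(P.root i).map_zero, mul_zero] at this
    linarith
  have hcomp : ∀ i ∈ b.support, ∀ x, P.root (u i) (L x) = c i * P.root i x := by
    intro i hi x
    have := hc i hi x
    rw [hL, map_add, hzero i hi] at this
    linarith
  have hdual : ∀ i ∈ b.support, (P.root (u i)) ∘ₗ L.toLinearMap = c i • P.root i := fun i hi =>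
    LinearMap.ext (hcomp i hi)
  have hli : LinearIndepOn ℝ (fun i => P.root (u i)) (b.support : Set ι) := by
    rw [linearIndepOn_finset_iff]
    intro d hd i hi
    have h1 : ∑ i ∈ b.support, (d i * c i) • P.root i = 0 := by
      refine LinearMap.ext fun x => ?_
      have := congrArg (fun f : Dual ℝ V => f (L x)) hd
      simp only [LinearMap.sum_apply, LinearMap.smul_apply, LinearMap.zero_apply, smul_eq_mul] at this
      rw [LinearMap.sum_apply, LinearMap.zero_apply, ← this]
      refine Finset.sum_congr rfl fun l hl => ?_
      rw [LinearMap.smul_apply, hcomp l hl, smul_eq_mul]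
      ring
    have := linearIndepOn_finset_iff.1 b.linearIndepOn_root _ h1 i hi
    exact (mul_eq_zero.1 this).resolve_right (hc0 i hi)
  have hspan : ∀ j, ∃ d : ι → ℝ, P.root j = ∑ i ∈ b.support, d i • P.root (u i) := by
    intro j
    have hmem : (P.root j) ∘ₗ L.toLinearMap ∈ Submodule.span ℝ (P.root '' b.support) := by
      rw [b.span_root_support, RootPairing.rootSpan, RootPairing.IsRootSystem.span_root_eq_top]
      exact Submodule.mem_top
    obtain ⟨d, hd⟩ : ∃ d : ι → ℝ,
        ∑ i ∈ b.support, d i • P.root i = (P.root j) ∘ₗ L.toLinearMap := by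
      exact (Submodule.mem_span_image_finset_iff_exists_fun' ℝ).1 hmem
    refine ⟨fun i => d i / c i, LinearMap.ext fun y => ?_⟩
    have h1 := congrArg (fun f : Dual ℝ V => f (L.symm y)) hd
    simp only [LinearMap.sum_apply, LinearMap.smul_apply, smul_eq_mul, LinearMap.comp_apply,
      LinearEquiv.coe_coe, LinearEquiv.apply_symm_apply] at h1
    rw [← h1, LinearMap.sum_apply]
    refine Finset.sum_congr rfl fun i hi => ?_
    have h2 := hcomp i hi (L.symm y)
    rw [LinearEquiv.apply_symm_apply] at h2
    rw [LinearMap.smul_apply, h2, smul_eq_mul]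
    field_simp [hc0 i hi]
  obtain ⟨J, hJ, -, hJ'⟩ := exists_finset_isWall ha
  refine hJ' _ fun p hp => ?_
  obtain ⟨hp1, hp2⟩ := hJ p hp
  -- The inequalities of the alcove are checked at `g 0` one by one. On the image of a simple wall
  -- equality holds. Any other wall makes obtuse pairings with all those images, so its root has
  -- nonpositive coefficients in the `u i`, and its value at `g 0` is at least its value at `a`.
  by_cases hex : ∃ i ∈ b.support, affRefl P (u i) (m i) = affRefl P p.1 p.2
  · obtain ⟨i, hi, he⟩ := hex
    have h1 : affRefl P (u i) (m i) (g 0) = g 0 := by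
      rw [affRefl_apply, hzero i hi, sub_self, zero_smul, sub_zero]
    rw [he] at h1
    have h2 := root_affRefl_self P p.1 p.2 (g 0)
    rw [h1] at h2
    linarith
  · push Not at hex
    obtain ⟨d, hd⟩ := hspan p.1
    have hd' := coeff_nonpos_of_pairing_nonpos b.support u p.1 d hli hd
      (fun k hk l hl hkl => pairing_nonpos_of_isWall ha (hwall l hl) (hwall k hk) (hpos l hl)
        (hpos k hk) fun he => hkl ?_)
      (fun k hk => pairing_nonpos_of_isWall ha (hwall k hk) hp1 (hpos k hk) hp2 (hex k hk))
    · have h1 : ∀ x, P.root p.1 x = ∑ i ∈ b.support, d i * P.root (u i) x := by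
        intro x
        rw [hd, LinearMap.sum_apply]
        rfl
      have h2 : P.root p.1 (g 0) - p.2 =
          (P.root p.1 a - p.2) - ∑ i ∈ b.support, d i * (P.root (u i) a - m i) := by
        rw [h1, h1 a]
        simp only [mul_sub, Finset.sum_sub_distrib]
        rw [Finset.sum_congr rfl fun i hi => by rw [hzero i hi]]
        ring
      rw [h2]
      have h3 : ∑ i ∈ b.support, d i * (P.root (u i) a - m i) ≤ 0 :=
        Finset.sum_nonpos fun i hi => mul_nonpos_of_nonpos_of_nonneg (hd' i hi) (hpos i hi).le
      linarith
    -- Distinct simple roots have distinct reflections: equal ones would give a linear relation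
    -- between two simple coroots.
    · rw [← hum k hk, ← hum l hl] at he
      have h1 : affRefl P l 0 = affRefl P k 0 := by simpa using he
      by_contra hkl'
      have h2 : affRefl P l 0 (P.coroot k) = affRefl P k 0 (P.coroot k) := by rw [h1]
      rw [affRefl_apply, affRefl_apply, root_coroot_self, root_coroot] at h2
      have h3 : (2 : ℝ) • P.coroot k + (-P.pairing l k) • P.coroot l = 0 := by
        push_cast at h2
        have := sub_eq_zero.2 h2
        rw [← this]
        module
      have h4 : LinearIndependent ℝ ![P.coroot k, P.coroot l] :=
        b.flip.linearIndependent_pair_of_ne (i := ⟨k, hk⟩) (j := ⟨l, hl⟩) fun e =>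
          hkl' (congrArg Subtype.val e)
      have := (LinearIndependent.pair_iff.1 h4 _ _ h3).1
      norm_num at this

end AffineWeyl

/-! ### From the Bruhat order to the cone of simple coroots. -/

namespace AffineWeyl

open Module Equiv PadicGroup

variable {ι V : Type*} [Finite ι] [AddCommGroup V] [Module ℝ V]
  {P : RootPairing ι ℝ (Dual ℝ V) V} [P.IsEval] [P.IsCrystallographic] [P.IsReduced]
  [P.IsRootSystem] (b : P.Base)

/-- The combinations of the simple coroots with nonnegative real coefficients. -/
def InCone (y : V) : Prop :=
  ∃ c : ι → ℝ, (∀ i ∈ b.support, 0 ≤ c i) ∧ y = ∑ i ∈ b.support, c i • P.coroot i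

/-- The antidominant elements. -/
def Antidominant (x : V) : Prop := ∀ i ∈ b.support, P.root i x ≤ 0

variable {b}

lemma InCone.add {x y : V} (hx : InCone b x) (hy : InCone b y) : InCone b (x + y) := by
  obtain ⟨c, hc, rfl⟩ := hx
  obtain ⟨d, hd, rfl⟩ := hy
  refine ⟨fun i => c i + d i, fun i hi => add_nonneg (hc i hi) (hd i hi), ?_⟩
  simp only [add_smul, Finset.sum_add_distrib]

lemma InCone.smul {x : V} (hx : InCone b x) {r : ℝ} (hr : 0 ≤ r) : InCone b (r • x) := by
  obtain ⟨c, hc, rfl⟩ := hx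
  refine ⟨fun i => r * c i, fun i hi => mul_nonneg hr (hc i hi), ?_⟩
  simp only [mul_smul, Finset.smul_sum]

lemma inCone_zero : InCone b (0 : V) := ⟨0, fun _ _ => le_rfl, by simp⟩

lemma inCone_coroot {i : ι} (hi : i ∈ b.support) : InCone b (P.coroot i) := by
  classical
  refine ⟨fun j => if j = i then 1 else 0, fun j _ => by dsimp only; split_ifs <;> norm_num, ?_⟩
  simp [ite_smul, hi]

lemma Antidominant.root_nonpos {x : V} (hx : Antidominant b x) {i : ι} {c : ι → ℝ}
    (hc : ∀ j ∈ b.support, 0 ≤ c j) (h : P.root i = ∑ j ∈ b.support, c j • P.root j) :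
    P.root i x ≤ 0 := by
  rw [h, LinearMap.sum_apply]
  exact Finset.sum_nonpos fun j hj => mul_nonpos_of_nonneg_of_nonpos (hc j hj) (hx j hj)

lemma Antidominant.root_nonpos_of_isPos {x : V} (hx : Antidominant b x) {i : ι} (hi : b.IsPos i) :
    P.root i x ≤ 0 := by
  obtain ⟨f, -, hf⟩ := exists_root_eq_sum_of_isPos b hi
  exact hx.root_nonpos (fun _ _ => by positivity) hf

variable (b) in
lemma isPos_of_root_eq_sum {i : ι} {c : ι → ℝ} (hc : ∀ j ∈ b.support, 0 ≤ c j)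
    (h : P.root i = ∑ j ∈ b.support, c j • P.root j) : b.IsPos i := by
  by_contra hi
  obtain ⟨y, hy⟩ := alcove_nonempty b
  have h1 := (hy _ (isPos_reflectionPerm_self b i hi)).2
  rw [root_reflectionPerm_self] at h1
  have h2 := Antidominant.root_nonpos (b := b) (x := y)
    (fun j hj => (hy j (RootPairing.Base.isPos_of_mem_support hj)).2.le) hc h
  linarith

lemma zero_mem_closedAlcove : (0 : V) ∈ closedAlcove b := fun i _ => by simp

lemma mem_autGroup_inv_conj {g : Perm V} (hg : g ∈ autGroup P) (i : ι) (k : ℤ) :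
    ∃ (j : ι) (m : ℤ) (c : ℝ), c ≠ 0 ∧ ∀ x, P.root i (g x) - k = c * (P.root j x - m) := by
  obtain ⟨j, m, h⟩ := ((inv_mem hg).2 _).1 (affRefl_mem P i k)
  rw [inv_inv] at h
  obtain ⟨c, hc, hc'⟩ := exists_root_apply_sub hg (i := j) (j := i) (k := m) (m := k)
    (by rw [← h]; group)
  exact ⟨j, m, c, hc, hc'⟩

/-- The elements of the finite Weyl group move an antidominant element upwards. -/
lemma inCone_apply_sub {x : V} (hx : Antidominant b x) {w : Perm V} (hw : w ∈ affGroup P)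
    (hw0 : w 0 = 0) : InCone b (w x - x) := by
  obtain ⟨a, ha⟩ := alcove_nonempty b
  have hreg := regular_of_mem_alcove ha
  generalize hN : (sepSet P a (w a)).ncard = N
  induction N using Nat.strong_induction_on generalizing w with
  | _ N ih =>
  have hwA := affGroup_le_autGroup hw
  have hwreg := hreg.apply hwA
  -- A simple root that is positive at `w a` gives a simple reflection shortening `w`, to which the
  -- induction hypothesis applies.
  by_cases hex : ∃ i ∈ b.support, 0 < P.root i (w a)
  · obtain ⟨i, hi, hia⟩ := hex
    have hipos := RootPairing.Base.isPos_of_mem_support hi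
    have hs : affRefl P i 0 ∈ affGroup P := mem_affGroup (affRefl_mem P i 0)
    have hsep : Separates P (affRefl P i 0) a (w a) := by
      rw [separates_affRefl]
      push_cast
      rw [sub_zero, sub_zero]
      exact mul_neg_of_neg_of_pos (ha i hipos).2 hia
    have hlt : (sepSet P a ((affRefl P i 0 * w) a)).ncard < N := by
      rw [← hN, Perm.mul_apply]
      exact ncard_sepSet_gt hreg hwreg hsep
    have hsw0 : (affRefl P i 0 * w) 0 = 0 := by
      rw [Perm.mul_apply, hw0, affRefl_apply, map_zero, Int.cast_zero, sub_zero, zero_smul,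
        sub_zero]
    have h1 := ih _ hlt (mul_mem hs hw) hsw0 rfl
    -- Since `w` fixes 0, pulling root `i` back by `w` gives a multiple of some root. That root has
    -- a strict sign at `a` and, up to vanishing, the same sign at `x`, so the positive value at `w
    -- a` passes to `w x`.
    have h2 : 0 ≤ P.root i (w x) := by
      obtain ⟨j, m, c, hc, hc'⟩ := mem_autGroup_inv_conj hwA i 0
      push_cast at hc'
      have h3 := hc' 0
      rw [hw0, map_zero, map_zero, sub_zero, zero_sub] at h3
      have hm : (m : ℝ) = 0 := by
        rcases mul_eq_zero.1 h3.symm with h | h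
        · exact absurd h hc
        · linarith
      have h4 := hc' a
      have h5 := hc' x
      rw [hm, sub_zero, sub_zero] at h4 h5
      rw [h4] at hia
      rw [h5]
      by_cases hj : b.IsPos j
      · have h6 := (ha j hj).2
        have h7 := hx.root_nonpos_of_isPos hj
        have h8 : c < 0 := by
          by_contra! h9
          exact absurd hia (not_lt.2 (mul_nonpos_of_nonneg_of_nonpos h9 h6.le))
        exact mul_nonneg_of_nonpos_of_nonpos h8.le h7
      · have hj' := isPos_reflectionPerm_self b j hj
        have h6 := (ha _ hj').2
        have h7 := hx.root_nonpos_of_isPos hj'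
        rw [root_reflectionPerm_self] at h6 h7
        have h8 : 0 < c := by
          by_contra! h9
          exact absurd hia (not_lt.2 (mul_nonpos_of_nonpos_of_nonneg h9 (by linarith)))
        exact mul_nonneg h8.le (by linarith)
    have h3 : w x - x = ((affRefl P i 0 * w) x - x) + P.root i (w x) • P.coroot i := by
      rw [Perm.mul_apply, affRefl_apply]
      push_cast
      module
    rw [h3]
    exact h1.add ((inCone_coroot hi).smul h2)
  · push Not at hex
    have hneg : ∀ i, b.IsPos i → P.root i (w a) < 0 := by
      intro i hi
      refine lt_of_le_of_ne (Antidominant.root_nonpos_of_isPos (b := b) hex hi) fun h => ?_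
      exact hwreg i 0 (by rw [h]; simp)
    -- Now `a` and `w a` are both in the antidominant chamber, so no hyperplane through 0 separates
    -- them. A hyperplane missing 0 does not either: both points are on the side of 0, which `w`
    -- fixes.
    have hone : w = 1 := by
      refine (isWallSet_walls ha).eq_one_of_forall_not_separates hw ?_
      rintro t ⟨i, k, rfl, h⟩
      rcases eq_or_ne k 0 with rfl | hk
      · push_cast at h
        rw [sub_zero, sub_zero] at h
        by_cases hi : b.IsPos i
        · have := mul_pos_of_neg_of_neg (ha i hi).2 (hneg i hi)
          linarith
        · have hi' := isPos_reflectionPerm_self b i hi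
          have := mul_pos_of_neg_of_neg (ha _ hi').2 (hneg _ hi')
          rw [root_reflectionPerm_self, root_reflectionPerm_self] at this
          linarith
      · obtain ⟨j, m, c, hc, hc'⟩ := mem_autGroup_inv_conj hwA i k
        have h1 := mul_nonneg_of_mem ha (zero_mem_closedAlcove (b := b)) j m
        have h2 := mul_nonneg_of_mem ha (zero_mem_closedAlcove (b := b)) i k
        have h3 := hc' 0
        have h4 := hc' a
        rw [hw0] at h3
        have h5 := mul_nonneg (sq_nonneg c) h1
        have h6 : 0 ≤ (P.root i (w a) - k) * (P.root i 0 - k) := by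
          rw [h3, h4]
          nlinarith
        have h7 := mul_nonneg h2 h6
        have h8 : 0 < (P.root i 0 - k) ^ 2 := by
          have : P.root i (0 : V) - k ≠ 0 := by
            rw [map_zero, zero_sub, neg_ne_zero]
            exact_mod_cast hk
          positivity
        have h9 := mul_neg_of_neg_of_pos h h8
        nlinarith
    rw [hone, Perm.one_apply, sub_self]
    exact inCone_zero

/-- The convex hull of the orbit under the finite Weyl group is closed under going down in the Bruhat
order. -/
lemma inCone_of_affRefl {a x y : V} (ha : a ∈ alcove b) {i : ι} {k : ℤ}
    (h : 0 ≤ (P.root i a - k) * (P.root i y - k))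
    (hy : ∀ w ∈ affGroup P, w 0 = 0 → InCone b (w (affRefl P i k y) - x)) {w : Perm V}
    (hw : w ∈ affGroup P) (hw0 : w 0 = 0) : InCone b (w y - x) := by
  obtain ⟨⟨L, hL⟩, -⟩ := affGroup_le_autGroup hw
  have hwL : ∀ z, w z = L z := fun z => by rw [hL, hw0, add_zero]
  set z := affRefl P i k y with hz
  set r := P.root i y with hr
  have hzr : P.root i z = 2 * k - r := root_affRefl_self P i k y
  have h1 := hy w hw hw0
  have h2 := hy (w * affRefl P i 0) (mul_mem hw (mem_affGroup (affRefl_mem P i 0)))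
    (by rw [Perm.mul_apply, affRefl_apply]; simpa using hw0)
  -- Both 0 and `y` are, weakly, on the side of `a`, hence on the same side of the hyperplane.
  have h3 : 0 ≤ (k : ℝ) * (k - r) := by
    have h4 := mul_nonneg_of_mem ha (zero_mem_closedAlcove (b := b)) i k
    rw [map_zero] at h4
    have h5 : 0 < (P.root i a - k) ^ 2 := by
      have := (regular_of_mem_alcove ha).sub_ne i k
      positivity
    by_contra! h6
    have h7 := mul_nonneg h h4
    have h8 := mul_neg_of_pos_of_neg h5 h6
    nlinarith
  -- All of `y`, `z` and the image of `z` under the reflection through 0 lie on one line parallel to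
  -- the coroot, and θ is the position of `y` between the other two. If `2 k = r`, then `h3` forces
  -- k = r = 0, the points coincide, and any θ serves.
  obtain ⟨θ, hθ0, hθ1, hθ⟩ : ∃ θ : ℝ, 0 ≤ θ ∧ θ ≤ 1 ∧ θ * (2 * k - r) = k - r := by
    rcases eq_or_ne (2 * (k : ℝ) - r) 0 with h0 | h0
    · refine ⟨0, le_rfl, zero_le_one, ?_⟩
      have : (k : ℝ) - r = -k := by linarith
      rw [this] at h3
      have : (k : ℝ) * k = 0 := le_antisymm (by linarith) (mul_self_nonneg _)
      rw [mul_self_eq_zero] at this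
      linarith
    · have h4 : 0 < (2 * (k : ℝ) - r) ^ 2 := by positivity
      refine ⟨(k - r) / (2 * k - r), ?_, ?_, div_mul_cancel₀ _ h0⟩
      · rw [← mul_div_mul_right _ _ h0]
        refine div_nonneg ?_ (by nlinarith)
        nlinarith [sq_nonneg ((k : ℝ) - r)]
      · rw [← mul_div_mul_right _ _ h0, div_le_one (by nlinarith)]
        nlinarith [sq_nonneg (k : ℝ)]
  have h4 : y = (1 - θ) • z + θ • affRefl P i 0 z := by
    rw [affRefl_apply P i 0, hzr]
    push_cast
    have : y = z - (k - r) • P.coroot i := by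
      rw [hz, affRefl_apply]
      module
    rw [this, ← hθ]
    module
  have h5 : w y - x = (1 - θ) • (w z - x) + θ • ((w * affRefl P i 0) z - x) := by
    rw [Perm.mul_apply, hwL, hwL, hwL, h4, map_add, map_smul, map_smul]
    module
  rw [h5]
  exact (h1.smul (by linarith)).add (h2.smul hθ0)

/-- The chain is descended from `v₂` with an invariant stronger than the conclusion: all conjugates
under the stabilizer of 0 are controlled, because the convexity step needs both a point and its
mirror image. -/
lemma inCone_sub_of_bruhatLE {g v₁ v₂ : Perm V} {x₁ x₂ : V} (hg : g ∈ autGroup P)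
    (hgw : ∀ s ∈ walls b, g * s * g⁻¹ ∈ walls b) (hx₂ : Antidominant b x₂)
    (h₁ : v₁ (g 0) = x₁) (h₂ : v₂ (g 0) = x₂) (hle : BruhatLE (walls b) v₁ v₂) :
    InCone b (x₁ - x₂) := by
  obtain ⟨a, ha⟩ := alcove_nonempty b
  have hq := apply_zero_mem_closedAlcove hg hgw
  have hS := isWallSet_walls ha
  have hreg := regular_of_mem_alcove ha
  have key : ∀ w ∈ affGroup P, w 0 = 0 → InCone b (w (v₁ (g 0)) - x₂) := by
    clear h₁
    induction hle using Relation.ReflTransGen.head_induction_on with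
    | refl =>
      intro w hw hw0
      rw [h₂]
      exact inCone_apply_sub hx₂ hw hw0
    | @head u v hstep _ ih =>
      obtain ⟨γ, hγ, s, hs, hu, rfl, hlt⟩ := hstep
      intro w hw hw0
      have hγA : γ ∈ autGroup P := by
        rw [hS.closure_eq] at hγ
        exact affGroup_le_autGroup hγ
      rw [hS.closure_eq] at hu
      have huA := affGroup_le_autGroup hu
      obtain ⟨i, k, ht⟩ := (hγA.2 _).1 (hS.subset hs)
      rw [ht] at ih hlt
      have hnsep : ¬ Separates P (affRefl P i k) a (u a) := by
        intro hsep
        have h3 := ncard_sepSet_gt hreg (hreg.apply huA) hsep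
        rw [hS.wordLength_eq hu,
          hS.wordLength_eq (mul_mem (mem_affGroup (affRefl_mem P i k)) hu)] at hlt
        exact absurd hlt (not_lt.2 h3.le)
      rw [separates_affRefl, not_lt] at hnsep
      refine inCone_of_affRefl ha ?_ ih hw hw0
      -- As `g 0` lies in the closure of the alcove of `a`, its image under `u` is weakly on the
      -- side of `u a`, which is the side of `a` because the step increases the length.
      obtain ⟨j, m, c, hc, hc'⟩ := mem_autGroup_inv_conj huA i k
      have h3 := mul_nonneg_of_mem ha hq j m
      have h4 : 0 ≤ (P.root i (u a) - k) * (P.root i (u (g 0)) - k) := by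
        rw [hc', hc']
        have := mul_nonneg (sq_nonneg c) h3
        nlinarith
      have h5 : 0 < (P.root i (u a) - k) ^ 2 := by
        have := (hreg.apply huA).sub_ne i k
        positivity
      by_contra! h6
      have h7 := mul_nonneg hnsep h4
      have h8 := mul_neg_of_neg_of_pos h6 h5
      nlinarith
  have := key 1 (one_mem _) rfl
  rwa [Perm.one_apply, h₁] at this

/-! ### The coroot lattice and the translations of the affine Weyl group. -/

variable (P) in
/-- The coroot lattice. -/
def corootLattice : AddSubgroup V := AddSubgroup.closure (Set.range P.coroot)

lemma coroot_mem_corootLattice (i : ι) : P.coroot i ∈ corootLattice P :=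
  AddSubgroup.subset_closure ⟨i, rfl⟩

lemma exists_int_root_eq {q : V} (hq : q ∈ corootLattice P) (i : ι) :
    ∃ m : ℤ, P.root i q = m := by
  induction hq using AddSubgroup.closure_induction with
  | mem x hx =>
    obtain ⟨j, rfl⟩ := hx
    exact ⟨P.pairingIn ℤ i j, by rw [root_coroot, intCast_pairingIn]⟩
  | zero => exact ⟨0, by simp⟩
  | add x y _ _ hx hy =>
    obtain ⟨m, hm⟩ := hx
    obtain ⟨n, hn⟩ := hy
    exact ⟨m + n, by rw [map_add, hm, hn]; push_cast; rfl⟩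
  | neg x _ hx =>
    obtain ⟨m, hm⟩ := hx
    exact ⟨-m, by rw [map_neg, hm]; push_cast; rfl⟩

lemma apply_mem_corootLattice {w : Perm V} (hw : w ∈ affGroup P) {q : V}
    (hq : q ∈ corootLattice P) : w q ∈ corootLattice P := by
  obtain ⟨b⟩ := P.nonempty_base
  obtain ⟨a, ha⟩ := alcove_nonempty b
  obtain ⟨L, hL, rfl⟩ := (isWallSet_walls ha).exists_list hw
  induction L with
  | nil => simpa using hq
  | cons s L ih =>
    have hL' : ∀ s ∈ L, s ∈ walls b := fun r hr => hL r (by simp [hr])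
    obtain ⟨i, k, rfl, -⟩ := hL s (by simp)
    have h1 := ih hL' (by
      have := (isWallSet_walls ha).closure_eq
      rw [← this]
      exact Subgroup.list_prod_mem _ fun r hr => Subgroup.subset_closure (hL' r hr))
    rw [List.prod_cons, Perm.mul_apply, affRefl_apply]
    obtain ⟨m, hm⟩ := exists_int_root_eq h1 i
    rw [hm, ← Int.cast_sub, Int.cast_smul_eq_zsmul]
    exact sub_mem h1 (zsmul_mem (coroot_mem_corootLattice i) _)

variable (b) in
lemma exists_int_of_mem_corootLattice {q : V} (hq : q ∈ corootLattice P) :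
    ∃ c : ι → ℤ, q = ∑ i ∈ b.support, (c i : ℝ) • P.coroot i := by
  have h1 : q ∈ Submodule.span ℤ (P.coroot '' b.support) := by
    rw [b.span_int_coroot_support]
    rw [corootLattice, ← Submodule.span_int_eq_addSubgroupClosure] at hq
    exact hq
  obtain ⟨c, hc⟩ := (Submodule.mem_span_image_finset_iff_exists_fun' ℤ).1 h1
  exact ⟨c, by simp only [← hc, Int.cast_smul_eq_zsmul]⟩

lemma eq_of_sum_coroot_eq {c d : ι → ℝ}
    (h : ∑ i ∈ b.support, c i • P.coroot i = ∑ i ∈ b.support, d i • P.coroot i) :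
    ∀ i ∈ b.support, c i = d i := by
  intro i hi
  have h' : ∑ j ∈ b.support, (c j - d j) • P.coroot j = 0 := by
    simp only [sub_smul, Finset.sum_sub_distrib, h, sub_self]
  exact sub_eq_zero.1 (linearIndepOn_finset_iff.1 b.linearIndepOn_coroot _ h' i hi)

/-- By independence of the simple coroots, the nonnegative real coefficients and the integral
coefficients are the same numbers. -/
lemma mem_closure_of_inCone {y : V} (hy : InCone b y) (hy' : y ∈ corootLattice P) :
    y ∈ AddSubmonoid.closure (P.coroot '' b.support) := by
  obtain ⟨c, hc, h⟩ := hy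
  obtain ⟨d, hd⟩ := exists_int_of_mem_corootLattice b hy'
  have hcd := eq_of_sum_coroot_eq (h.symm.trans hd)
  rw [hd]
  refine sum_mem fun i hi => ?_
  have h1 : 0 ≤ d i := by
    have := hc i hi
    rw [hcd i hi] at this
    exact_mod_cast this
  obtain ⟨n, hn⟩ := Int.eq_ofNat_of_zero_le h1
  rw [hn, Int.cast_smul_eq_zsmul, natCast_zsmul]
  exact nsmul_mem (AddSubmonoid.subset_closure (Set.mem_image_of_mem _ hi)) n

/-- A translation which normalizes the affine Weyl group has integral values on the roots. -/
lemma exists_int_root_eq_of_conj_mem (x : V)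
    (h : ∀ i, Equiv.addRight x * affRefl P i 0 * (Equiv.addRight x)⁻¹ ∈ affGroup P) (i : ι) :
    ∃ m : ℤ, P.root i x = m := by
  classical
  obtain ⟨b⟩ := P.nonempty_base
  have hs : ∀ j ∈ b.support, ∃ m : ℤ, P.root j x = m := by
    intro j hj
    have h1 := apply_mem_corootLattice (h j) (zero_mem _)
    -- The conjugated reflection moves 0 to ⟨α_j, x⟩ α_j^∨. This lies in the coroot lattice, of
    -- which the simple coroot α_j^∨ is a basis vector, so the factor is an integer.
    have h2 : (Equiv.addRight x * affRefl P j 0 * (Equiv.addRight x)⁻¹) 0 =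
        P.root j x • P.coroot j := by
      have : (Equiv.addRight x)⁻¹ (0 : V) = -x := by
        rw [Perm.inv_eq_iff_eq]
        simp
      rw [Perm.mul_apply, Perm.mul_apply, this, affRefl_apply]
      simp
    rw [h2] at h1
    obtain ⟨c, hc⟩ := exists_int_of_mem_corootLattice b h1
    have h3 : P.root j x • P.coroot j =
        ∑ i ∈ b.support, (if i = j then P.root j x else 0) • P.coroot i := by
      simp [ite_smul, hj]
    have := eq_of_sum_coroot_eq (h3.symm.trans hc) j hj
    rw [if_pos rfl] at this
    exact ⟨c j, this⟩
  choose! m hm using hs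
  obtain ⟨f, -, -, hf⟩ := b.exists_root_eq_sum_int i
  refine ⟨∑ j ∈ b.support, f j * m j, ?_⟩
  rw [hf, LinearMap.sum_apply]
  push_cast
  refine Finset.sum_congr rfl fun j hj => ?_
  rw [← Int.cast_smul_eq_zsmul ℝ, LinearMap.smul_apply, hm j hj, smul_eq_mul]

lemma addRight_mem_autGroup {x : V} (h : ∀ i, ∃ m : ℤ, P.root i x = m) :
    Equiv.addRight x ∈ autGroup P := by
  have key : ∀ x : V, (∀ i, ∃ m : ℤ, P.root i x = m) → ∀ t ∈ reflections P,
      Equiv.addRight x * t * (Equiv.addRight x)⁻¹ ∈ reflections P := by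
    rintro x hx t ⟨i, k, rfl⟩
    obtain ⟨m, hm⟩ := hx i
    refine ⟨i, k + m, Equiv.ext fun y => ?_⟩
    have : (Equiv.addRight x)⁻¹ y = y - x := by
      rw [Perm.inv_eq_iff_eq]
      simp
    rw [Perm.mul_apply, Perm.mul_apply, this, affRefl_apply, affRefl_apply, Equiv.coe_addRight,
      map_sub, hm]
    push_cast
    module
  have hinv : (Equiv.addRight x)⁻¹ = Equiv.addRight (-x) := by
    ext y
    rw [Perm.inv_eq_iff_eq]
    simp
  refine ⟨⟨LinearEquiv.refl ℝ V, fun y => by simp⟩, fun t => ⟨key x h t, fun ht => ?_⟩⟩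
  have h1 := key (-x) (fun i => by
    obtain ⟨m, hm⟩ := h i
    exact ⟨-m, by rw [map_neg, hm]; push_cast; rfl⟩) _ ht
  have h2 : (Equiv.addRight x)⁻¹ * (Equiv.addRight x * t * (Equiv.addRight x)⁻¹) *
      ((Equiv.addRight x)⁻¹)⁻¹ = t := by group
  rwa [← hinv, h2] at h1

/-- The product of two parallel reflections with consecutive levels is the translation by a coroot.
-/
lemma addRight_mem_affGroup {x : V} (hx : x ∈ corootLattice P) :
    Equiv.addRight x ∈ affGroup P := by
  induction hx using AddSubgroup.closure_induction with
  | mem x hx =>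
    obtain ⟨i, rfl⟩ := hx
    have : Equiv.addRight (P.coroot i) = affRefl P i 1 * affRefl P i 0 := by
      ext y
      rw [Perm.mul_apply, affRefl_apply P i 1, root_affRefl_self, affRefl_apply,
        Equiv.coe_addRight]
      push_cast
      module
    rw [this]
    exact mul_mem (mem_affGroup (affRefl_mem P i 1)) (mem_affGroup (affRefl_mem P i 0))
  | zero =>
    have : Equiv.addRight (0 : V) = 1 := by ext; simp
    rw [this]
    exact one_mem _
  | add x y _ _ hx hy =>
    have : Equiv.addRight (x + y) = Equiv.addRight y * Equiv.addRight x := by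
      ext z
      simp [add_assoc]
    rw [this]
    exact mul_mem hy hx
  | neg x _ hx =>
    have : Equiv.addRight (-x) = (Equiv.addRight x)⁻¹ := by
      ext y
      rw [eq_comm, Perm.inv_eq_iff_eq]
      simp
    rw [this]
    exact inv_mem hx

/-- The polarization sends (2 / (α, α)) α to the coroot of α, so positivity passes between roots and
coroots up to positive factors. -/
lemma exists_root_eq_sum_of_coroot_eq_sum {i : ι} {c : ι → ℝ} (hc : ∀ j ∈ b.support, 0 ≤ c j)
    (h : P.coroot i = ∑ j ∈ b.support, c j • P.coroot j) :
    ∃ d : ι → ℝ, (∀ j ∈ b.support, 0 ≤ d j) ∧ P.root i = ∑ j ∈ b.support, d j • P.root j := by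
  have _i : Fintype ι := Fintype.ofFinite ι
  have hpos : ∀ j, 0 < 2 / P.RootForm (P.root j) (P.root j) := by
    intro j
    have h1 : 0 ≤ P.RootForm (P.root j) (P.root j) := by
      rw [P.rootForm_apply_apply]
      exact Finset.sum_nonneg fun i _ => mul_self_nonneg _
    have h2 : P.RootForm (P.root j) (P.root j) ≠ 0 :=
      RootPairing.IsAnisotropic.rootForm_root_ne_zero j
    have : 0 < P.RootForm (P.root j) (P.root j) := lt_of_le_of_ne h1 (Ne.symm h2)
    positivity
  set r : ι → ℝ := fun j => 2 / P.RootForm (P.root j) (P.root j) with hr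
  have hco : ∀ j, P.coroot j = P.PolarizationEquiv (r j • P.root j) := fun j => by
    rw [map_smul, P.coroot_eq_polarizationEquiv_apply_root]
  refine ⟨fun j => (r i)⁻¹ * (c j * r j), fun j hj => ?_, ?_⟩
  · exact mul_nonneg (inv_nonneg.2 (hpos i).le) (mul_nonneg (hc j hj) (hpos j).le)
  · have h1 : r i • P.root i = ∑ j ∈ b.support, (c j * r j) • P.root j := by
      apply P.PolarizationEquiv.injective
      rw [← hco, h, map_sum]
      refine Finset.sum_congr rfl fun j _ => ?_
      rw [hco, ← map_smul, smul_smul]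
    rw [← inv_smul_smul₀ (hpos i).ne' (P.root i), h1, Finset.smul_sum]
    simp only [smul_smul]
    rfl

/-- Stembridge's lemma: if `x` is antidominant and the sum `γ ≠ 0` of simple coroots is such that
`x - γ` is antidominant, then `x - β` is antidominant for some coroot `β ≤ γ`. -/
lemma exists_antidominant_sub_coroot {x : V} (hx : Antidominant b x) {n : ι → ℕ}
    (hn : ∃ j ∈ b.support, n j ≠ 0)
    (hx' : Antidominant b (x - ∑ j ∈ b.support, (n j : ℝ) • P.coroot j)) :
    ∃ (i : ι) (c : ι → ℕ), P.coroot i = ∑ j ∈ b.support, (c j : ℝ) • P.coroot j ∧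
      (∀ j ∈ b.support, c j ≤ n j) ∧ Antidominant b (x - P.coroot i) := by
  classical
  -- Among the coroots β ≤ γ, one with maximal coefficient sum is chosen.
  let A : Set ℕ := {N | ∃ (i : ι) (c : ι → ℕ),
    P.coroot i = ∑ j ∈ b.support, (c j : ℝ) • P.coroot j ∧
      (∀ j ∈ b.support, c j ≤ n j) ∧ ∑ j ∈ b.support, c j = N}
  have hA : A.Nonempty := by
    obtain ⟨j, hj, hnj⟩ := hn
    refine ⟨_, j, fun l => if l = j then 1 else 0, ?_, fun l hl => ?_, rfl⟩
    · simp [ite_smul, hj]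
    · dsimp only
      split_ifs with h
      · subst h
        omega
      · omega
  have hbdd : BddAbove A := by
    refine ⟨∑ j ∈ b.support, n j, ?_⟩
    rintro N ⟨i, c, -, h, rfl⟩
    exact Finset.sum_le_sum h
  obtain ⟨i, c, hic, hcn, hmax⟩ := Nat.sSup_mem hA hbdd
  refine ⟨i, c, hic, hcn, fun l hl => ?_⟩
  by_contra! hpos
  rw [map_sub, root_coroot] at hpos
  have hxl := hx l hl
  have hli : P.pairing l i < 0 := by linarith
  have hli' : P.flip.pairingIn ℤ i l < 0 := by
    have h1 : ((P.pairingIn ℤ l i : ℤ) : ℝ) < 0 := by rwa [intCast_pairingIn]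
    have h2 : P.flip.pairingIn ℤ i l = P.pairingIn ℤ l i := by
      apply (algebraMap ℤ ℝ).injective_int
      rw [P.flip.algebraMap_pairingIn, P.algebraMap_pairingIn]
      rfl
    rw [h2]
    exact_mod_cast h1
  have hne : P.flip.root i ≠ -P.flip.root l := by
    change P.coroot i ≠ -P.coroot l
    intro h
    have h1 : ∑ j ∈ b.support, (c j : ℝ) • P.coroot j =
        ∑ j ∈ b.support, (if j = l then (-1 : ℝ) else 0) • P.coroot j := by
      rw [← hic, h]
      simp [ite_smul, hl]
    have := eq_of_sum_coroot_eq h1 l hl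
    rw [if_pos rfl] at this
    have h2 : (0 : ℝ) ≤ c l := by positivity
    linarith
  obtain ⟨k, hk⟩ := P.flip.root_add_root_mem_of_pairingIn_neg hli' hne
  change P.coroot k = P.coroot i + P.coroot l at hk
  -- If `x - β` fails at `l`, then β pairs negatively with root `l`, so β + α_l^∨ is again a coroot;
  -- maximality means that it is no longer ≤ γ.
  have hcl : c l = n l := by
    by_contra hcl
    have hlt : c l < n l := lt_of_le_of_ne (hcn l hl) hcl
    have hmem : ∑ j ∈ b.support, (c j + if j = l then 1 else 0) ∈ A := by
      refine ⟨k, fun j => c j + if j = l then 1 else 0, ?_, fun j hj => ?_, rfl⟩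
      · rw [hk, hic]
        push_cast
        simp [add_smul, Finset.sum_add_distrib, ite_smul, hl]
      · dsimp only
        split_ifs with h
        · subst h
          omega
        · exact hcn j hj
    have := le_csSup hbdd hmem
    rw [← hmax, Finset.sum_add_distrib] at this
    simp [hl] at this
  -- The coefficient of γ - β at `l` is 0 and the others are nonnegative, so root `l` is nonpositive
  -- on γ - β. Hence `x - β` is no worse at `l` than `x - γ`, a contradiction.
  have h1 : P.root l (∑ j ∈ b.support, (n j : ℝ) • P.coroot j - P.coroot i) ≤ 0 := by
    have : ∑ j ∈ b.support, (n j : ℝ) • P.coroot j - P.coroot i =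
        ∑ j ∈ b.support, ((n j : ℝ) - c j) • P.coroot j := by
      rw [hic, ← Finset.sum_sub_distrib]
      simp only [sub_smul]
    rw [this, map_sum]
    refine Finset.sum_nonpos fun j hj => ?_
    rw [map_smul, smul_eq_mul, root_coroot]
    rcases eq_or_ne l j with rfl | hlj
    · rw [hcl, sub_self, zero_mul]
    · refine mul_nonpos_of_nonneg_of_nonpos ?_ ?_
      · have : (c j : ℝ) ≤ n j := by exact_mod_cast hcn j hj
        linarith
      · have := b.pairingIn_le_zero_of_ne hlj hl hj
        rw [← intCast_pairingIn]
        exact_mod_cast this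
  have h2 := hx' l hl
  rw [map_sub] at h1 h2
  rw [root_coroot] at h1
  linarith

/-- The root takes a value in (m - 1, m) at x + c. Reflecting at level m - 1 brings it into (m - 2,
m - 1), and reflecting at level m - 2 brings it into (m - 3, m - 2). As m ≤ 0, both hyperplanes lie
below `a`, so each reflection moves away from `a`; their composite subtracts the coroot. -/
lemma bruhatLE_addRight_sub_coroot {a c x : V} (ha : a ∈ alcove b) (hc : c ∈ alcove b)
    {k : Perm V} (hk : k a = c) {i : ι} (hi : b.IsPos i) {m : ℤ} (hm : P.root i x = m)
    (hm0 : m ≤ 0) (hmem : Equiv.addRight x * k ∈ affGroup P) :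
    BruhatLE (walls b) (Equiv.addRight x * k) (Equiv.addRight (x - P.coroot i) * k) := by
  have hS := isWallSet_walls ha
  have hm0' : (m : ℝ) ≤ 0 := by exact_mod_cast hm0
  obtain ⟨ha1, ha2⟩ := ha i hi
  obtain ⟨hc1, hc2⟩ := hc i hi
  have hval : P.root i ((Equiv.addRight x * k) a) = P.root i c + m := by
    rw [Perm.mul_apply, hk, Equiv.coe_addRight, map_add, hm]
  have h1 : BruhatLE (walls b) (Equiv.addRight x * k)
      (affRefl P i (m - 1) * (Equiv.addRight x * k)) := by
    refine hS.bruhat_step (affRefl_mem P i _) hmem ?_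
    rw [separates_affRefl, hval, not_lt]
    push_cast
    exact mul_nonneg (by linarith) (by linarith)
  have h2 : BruhatLE (walls b) (affRefl P i (m - 1) * (Equiv.addRight x * k))
      (affRefl P i (m - 2) * (affRefl P i (m - 1) * (Equiv.addRight x * k))) := by
    refine hS.bruhat_step (affRefl_mem P i _)
      (mul_mem (mem_affGroup (affRefl_mem P i _)) hmem) ?_
    rw [separates_affRefl, Perm.mul_apply, root_affRefl_self, hval, not_lt]
    push_cast
    exact mul_nonneg (by linarith) (by linarith)
  have h3 : affRefl P i (m - 2) * (affRefl P i (m - 1) * (Equiv.addRight x * k)) =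
      Equiv.addRight (x - P.coroot i) * k := by
    ext y
    simp only [Perm.mul_apply, Equiv.coe_addRight]
    rw [affRefl_apply P i (m - 2), root_affRefl_self, affRefl_apply]
    push_cast
    module
  rw [h3] at h2
  exact h1.trans h2

/-- Induction on the coefficient sum of `x₁ - x₂`; Stembridge's lemma keeps every intermediate point
antidominant, which gives the condition m ≤ 0 in each single step. -/
lemma bruhatLE_addRight {a c : V} (ha : a ∈ alcove b) (hc : c ∈ alcove b) {k : Perm V}
    (hk : k a = c) {x₁ x₂ : V} (hx₁ : Antidominant b x₁) (hx₂ : Antidominant b x₂)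
    (hint : ∀ i, ∃ m : ℤ, P.root i x₂ = m) (hmem : Equiv.addRight x₂ * k ∈ affGroup P)
    (h : x₁ - x₂ ∈ AddSubmonoid.closure (P.coroot '' b.support)) :
    BruhatLE (walls b) (Equiv.addRight x₁ * k) (Equiv.addRight x₂ * k) := by
  obtain ⟨n, hn⟩ : ∃ n : ι → ℕ, x₁ - x₂ = ∑ j ∈ b.support, (n j : ℝ) • P.coroot j := by
    rw [← Submodule.span_nat_eq_addSubmonoidClosure, Submodule.mem_toAddSubmonoid] at h
    obtain ⟨n, hn⟩ := (Submodule.mem_span_image_finset_iff_exists_fun' ℕ).1 h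
    exact ⟨n, by simp only [← hn, Nat.cast_smul_eq_nsmul]⟩
  clear h
  generalize hN : ∑ j ∈ b.support, n j = N
  induction N using Nat.strong_induction_on generalizing x₁ n with
  | _ N ih =>
  by_cases hn0 : ∃ j ∈ b.support, n j ≠ 0
  · obtain ⟨i, d, hid, hdn, hanti⟩ := exists_antidominant_sub_coroot hx₁ hn0
      (by rw [← hn, sub_sub_cancel]; exact hx₂)
    obtain ⟨e, he, hie⟩ := exists_root_eq_sum_of_coroot_eq_sum
      (c := fun j => (d j : ℝ)) (fun _ _ => by positivity) hid
    have hneg := hx₁.root_nonpos he hie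
    have hipos : b.IsPos i := isPos_of_root_eq_sum b he hie
    have hlat : x₁ - x₂ ∈ corootLattice P := by
      rw [hn]
      refine sum_mem fun j _ => ?_
      rw [Nat.cast_smul_eq_nsmul]
      exact nsmul_mem (coroot_mem_corootLattice j) _
    obtain ⟨m₂, hm₂⟩ := hint i
    obtain ⟨m₁, hm₁⟩ := exists_int_root_eq hlat i
    have hm : P.root i x₁ = ((m₁ + m₂ : ℤ) : ℝ) := by
      rw [map_sub, hm₂] at hm₁
      push_cast
      linarith
    have hmem₁ : Equiv.addRight x₁ * k ∈ affGroup P := by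
      have : Equiv.addRight x₁ * k = Equiv.addRight (x₁ - x₂) * (Equiv.addRight x₂ * k) := by
        ext y
        simp
      rw [this]
      exact mul_mem (addRight_mem_affGroup hlat) hmem
    have hstep := bruhatLE_addRight_sub_coroot ha hc hk hipos hm
      (by rw [hm] at hneg; exact_mod_cast hneg) hmem₁
    refine hstep.trans (ih (∑ j ∈ b.support, (n j - d j)) ?_ hanti (fun j => n j - d j) ?_ rfl)
    · rw [← hN]
      obtain ⟨j, hj, hdj⟩ : ∃ j ∈ b.support, d j ≠ 0 := by
        by_contra! h0
        refine P.flip.ne_zero i ?_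
        change P.coroot i = 0
        rw [hid]
        exact Finset.sum_eq_zero fun j hj => by rw [h0 j hj]; simp
      refine Finset.sum_lt_sum (fun j _ => Nat.sub_le _ _) ⟨j, hj, ?_⟩
      have := hdn j hj
      omega
    · have : x₁ - P.coroot i - x₂ = (x₁ - x₂) - P.coroot i := by abel
      rw [this, hn, hid, ← Finset.sum_sub_distrib]
      refine Finset.sum_congr rfl fun j hj => ?_
      rw [Nat.cast_sub (hdn j hj), sub_smul]
  · push Not at hn0
    have : x₁ - x₂ = 0 := by
      rw [hn]
      exact Finset.sum_eq_zero fun j hj => by rw [hn0 j hj]; simp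
    rw [sub_eq_zero.1 this]
    exact Relation.ReflTransGen.refl

end AffineWeyl

/-! ### Independence of characters and weights of split tori. -/

namespace PadicGroup

open Module AffineWeyl

section Characters

variable {Γ L M : Type*} [Monoid Γ] [Field L] [AddCommGroup M] [Module L M]

lemma linearIndependent_char :
    LinearIndependent L (fun (χ : Γ →* Lˣ) (s : Γ) => (χ s : L)) := by
  have h := (linearIndependent_monoidHom Γ L).comp (fun χ : Γ →* Lˣ => (Units.coeHom L).comp χ)
    fun χ ψ h => by
      ext s
      exact DFunLike.congr_fun h s
  exact h

lemma eq_zero_of_sum_char_smul (X : Finset (Γ →* Lˣ)) (A : (Γ →* Lˣ) → M)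
    (h : ∀ s, ∑ χ ∈ X, (χ s : L) • A χ = 0) : ∀ χ ∈ X, A χ = 0 := by
  intro χ hχ
  refine (forall_dual_apply_eq_zero_iff L _).1 fun φ => ?_
  have key := linearIndependent_iff'.1 (linearIndependent_char (Γ := Γ) (L := L)) X
    (fun χ => φ (A χ))
  refine key (funext fun s => ?_) χ hχ
  have h1 := congrArg φ (h s)
  rw [map_sum, map_zero] at h1
  rw [Finset.sum_apply, Pi.zero_apply, ← h1]
  exact Finset.sum_congr rfl fun χ _ => by
    rw [map_smul, Pi.smul_apply, smul_eq_mul, smul_eq_mul, mul_comm]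

/-- Apply a linear form that is nonzero at `a`: were ψ not among the characters, it would be a
linear combination of others, against Dedekind. -/
lemma exists_char_eq_of_sum {I : Type*} (X : Finset I) (χ : I → Γ →* Lˣ) (A : I → M)
    {ψ : Γ →* Lˣ} {a : M} (ha : a ≠ 0) (h : ∀ s, (ψ s : L) • a = ∑ i ∈ X, (χ i s : L) • A i) :
    ∃ i ∈ X, χ i = ψ := by
  by_contra! hne
  obtain ⟨φ, hφ⟩ : ∃ φ : Dual L M, φ a ≠ 0 := by
    by_contra! h'
    exact ha ((forall_dual_apply_eq_zero_iff L _).1 h')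
  have hmem : ψ ∉ χ '' X := by
    rintro ⟨i, hi, hi'⟩
    exact hne i hi hi'
  refine (linearIndependent_char (Γ := Γ) (L := L)).notMem_span_image hmem ?_
  have : (fun s => (ψ s : L)) = ∑ i ∈ X, ((φ a)⁻¹ * φ (A i)) • fun s => (χ i s : L) := by
    ext s
    have h1 := congrArg φ (h s)
    simp only [map_smul, map_sum, smul_eq_mul] at h1
    simp only [Finset.sum_apply, Pi.smul_apply, smul_eq_mul]
    have h2 : (ψ s : L) = (φ a)⁻¹ * ∑ i ∈ X, (χ i s : L) * φ (A i) := by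
      rw [← h1]
      field_simp
    rw [h2, Finset.mul_sum]
    exact Finset.sum_congr rfl fun _ _ => by ring
  rw [this]
  exact sum_mem fun i hi => Submodule.smul_mem _ _
    (Submodule.subset_span ⟨χ i, ⟨i, hi, rfl⟩, rfl⟩)

end Characters

section Torus

variable {F : Type*} [Field F] {n : ℕ} {T : Subgroup (GLn n (AlgebraicClosure F))}

/-- The matrix over the algebraic closure. -/
abbrev bc (A : Matrix (Fin n) (Fin n) F) : Matrix (Fin n) (Fin n) (AlgebraicClosure F) :=
  A.map (algebraMap F (AlgebraicClosure F))

lemma bc_injective : Function.Injective (bc : Matrix (Fin n) (Fin n) F → _) :=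
  Matrix.map_injective (algebraMap F (AlgebraicClosure F)).injective

lemma bc_mul (A B : Matrix (Fin n) (Fin n) F) : bc (A * B) = bc A * bc B := Matrix.map_mul

lemma bc_sum {I : Type*} (X : Finset I) (A : I → Matrix (Fin n) (Fin n) F) :
    bc (∑ i ∈ X, A i) = ∑ i ∈ X, bc (A i) :=
  map_sum (algebraMap F (AlgebraicClosure F)).mapMatrix A X

lemma bc_one : bc (1 : Matrix (Fin n) (Fin n) F) = 1 :=
  map_one (algebraMap F (AlgebraicClosure F)).mapMatrix

lemma bc_zero : bc (0 : Matrix (Fin n) (Fin n) F) = 0 :=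
  map_zero (algebraMap F (AlgebraicClosure F)).mapMatrix

lemma IsSplitTorus.exists_pow_eq (hT : IsSplitTorus T) {k : ℕ} (hk : 0 < k) (s : T) :
    ∃ t : T, t ^ k = s := by
  obtain ⟨r, f, -, -⟩ := hT
  have : ∀ i, ∃ y : (AlgebraicClosure F)ˣ, y ^ k = f.symm s i := by
    intro i
    obtain ⟨y, hy⟩ := IsAlgClosed.exists_pow_nat_eq ((f.symm s i : (AlgebraicClosure F)ˣ) :
      AlgebraicClosure F) hk
    have hy0 : y ≠ 0 := by
      rintro rfl
      rw [zero_pow hk.ne'] at hy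
      exact (f.symm s i).ne_zero hy.symm
    exact ⟨Units.mk0 y hy0, Units.ext (by simpa using hy)⟩
  choose y hy using this
  refine ⟨f y, ?_⟩
  rw [← map_pow, show y ^ k = f.symm s from funext hy, MulEquiv.apply_symm_apply]

/-- A split torus over the algebraic closure is divisible, so its characters have no torsion. -/
lemma IsSplitTorus.eq_one_of_pow_eq_one (hT : IsSplitTorus T)
    {χ : T →* (AlgebraicClosure F)ˣ} {k : ℕ} (hk : 0 < k) (h : χ ^ k = 1) : χ = 1 := by
  ext s
  obtain ⟨t, rfl⟩ := hT.exists_pow_eq hk s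
  rw [map_pow, ← MonoidHom.pow_apply, h, MonoidHom.one_apply, MonoidHom.one_apply]

/-- The weights of a torus on the standard representation. -/
lemma IsSplitTorus.exists_weights (hT : IsSplitTorus T) :
    ∃ (X : Finset (T →* (AlgebraicClosure F)ˣ))
      (A : (T →* (AlgebraicClosure F)ˣ) → Matrix (Fin n) (Fin n) F),
      (∀ χ ∈ X, A χ ≠ 0) ∧ ∑ χ ∈ X, A χ = 1 ∧
      (∀ s : T, ∀ χ ∈ X, s.1.1 * bc (A χ) = (χ s : AlgebraicClosure F) • bc (A χ)) ∧
      ∀ s : T, ∀ χ ∈ X, bc (A χ) * s.1.1 = (χ s : AlgebraicClosure F) • bc (A χ) := by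
  classical
  obtain ⟨r, f, ⟨c, hc⟩, -⟩ := hT
  let χ : (Fin r → ℤ) → T →* (AlgebraicClosure F)ˣ := fun m =>
    { toFun := fun s => ∏ i, (f.symm s i) ^ (m i)
      map_one' := by simp
      map_mul' := fun s t => by simp [mul_zpow, Finset.prod_mul_distrib] }
  -- The Laurent coefficients grouped by character; they turn out to be the projections on the
  -- weight spaces, already over `F`.
  let A : (T →* (AlgebraicClosure F)ˣ) → Matrix (Fin n) (Fin n) F := fun ψ =>
    ∑ m ∈ c.support with χ m = ψ, c m
  let X := c.support.image χ
  have hs : ∀ s : T, s.1.1 = ∑ ψ ∈ X, (ψ s : AlgebraicClosure F) • bc (A ψ) := by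
    intro s
    have h1 := hc (f.symm s)
    rw [MulEquiv.apply_symm_apply] at h1
    rw [h1, Finsupp.sum, ← Finset.sum_fiberwise_of_maps_to
      (fun m hm => Finset.mem_image_of_mem χ hm)]
    refine Finset.sum_congr rfl fun ψ _ => ?_
    rw [bc_sum, Finset.smul_sum]
    refine Finset.sum_congr rfl fun m hm => ?_
    rw [← (Finset.mem_filter.1 hm).2]
    rfl
  have h1 : ∑ ψ ∈ X, A ψ = 1 := by
    apply bc_injective
    rw [bc_sum, bc_one]
    have := hs 1
    simpa using this.symm
  -- Expand both sides of (s t) = s · t and compare the coefficients of the characters of t.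
  have hl : ∀ s : T, ∀ ψ ∈ X, s.1.1 * bc (A ψ) = (ψ s : AlgebraicClosure F) • bc (A ψ) := by
    intro s ψ hψ
    refine sub_eq_zero.1 (eq_zero_of_sum_char_smul (L := AlgebraicClosure F) X
      (fun ψ => s.1.1 * bc (A ψ) - (ψ s : AlgebraicClosure F) • bc (A ψ)) (fun t => ?_) ψ hψ)
    have h2 : (s * t).1.1 = s.1.1 * t.1.1 := rfl
    rw [hs (s * t), hs t, Finset.mul_sum] at h2
    simp only [smul_sub, Finset.sum_sub_distrib]
    rw [sub_eq_zero]
    simp only [Matrix.mul_smul] at h2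
    rw [← h2]
    refine Finset.sum_congr rfl fun ψ _ => ?_
    rw [map_mul, Units.val_mul, mul_comm, mul_smul]
  have hr : ∀ s : T, ∀ ψ ∈ X, bc (A ψ) * s.1.1 = (ψ s : AlgebraicClosure F) • bc (A ψ) := by
    intro s ψ hψ
    refine sub_eq_zero.1 (eq_zero_of_sum_char_smul (L := AlgebraicClosure F) X
      (fun ψ => bc (A ψ) * s.1.1 - (ψ s : AlgebraicClosure F) • bc (A ψ)) (fun t => ?_) ψ hψ)
    have h2 : (t * s).1.1 = t.1.1 * s.1.1 := rfl
    rw [hs (t * s), hs t, Finset.sum_mul] at h2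
    simp only [smul_sub, Finset.sum_sub_distrib]
    rw [sub_eq_zero]
    simp only [Matrix.smul_mul] at h2
    rw [← h2]
    refine Finset.sum_congr rfl fun ψ _ => ?_
    rw [map_mul, Units.val_mul, mul_smul]
  refine ⟨X.filter fun ψ => A ψ ≠ 0, A, fun ψ h => (Finset.mem_filter.1 h).2, ?_,
    fun s ψ h => hl s ψ (Finset.mem_filter.1 h).1, fun s ψ h => hr s ψ (Finset.mem_filter.1 h).1⟩
  rw [← h1]
  exact Finset.sum_filter_ne_zero X

/-- The decomposition of a matrix into weight vectors for the conjugation action of a torus, and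
the composition of the weights with a cocharacter. -/
lemma IsSplitTorus.exists_adjoint_weights (hT : IsSplitTorus T)
    {lam : (AlgebraicClosure F)ˣ →* T} (hlam : IsCochar F (T.subtype.comp lam)) :
    ∃ Y : Finset (T →* (AlgebraicClosure F)ˣ),
      (∀ δ ∈ Y, ∃ k : ℤ, ∀ t, δ (lam t) = t ^ k) ∧
      ∀ M : Matrix (Fin n) (Fin n) F, ∃ u : (T →* (AlgebraicClosure F)ˣ) → Matrix (Fin n) (Fin n) F,
        M = ∑ δ ∈ Y, u δ ∧ ∀ δ ∈ Y, ∀ s : T,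
          s.1.1 * bc (u δ) * (s⁻¹).1.1 = (δ s : AlgebraicClosure F) • bc (u δ) := by
  classical
  obtain ⟨X, A, hA, hA1, hl, hr⟩ := hT.exists_weights
  obtain ⟨c, hc⟩ := hlam
  have hpow : ∀ χ ∈ X, ∃ k : ℤ, ∀ t, χ (lam t) = t ^ k := by
    intro χ hχ
    have hne : bc (A χ) ≠ 0 := fun h => hA χ hχ (bc_injective (h.trans bc_zero.symm))
    -- On the image of `A χ` the cocharacter acts through χ, but it is also a sum of powers of t;
    -- hence χ composed with it is one of these powers.
    obtain ⟨k, -, hk⟩ := exists_char_eq_of_sum (L := AlgebraicClosure F) (ψ := χ.comp lam)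
      c.support (fun k : ℤ => zpowGroupHom k) (fun k => bc (c k) * bc (A χ)) hne (fun t => by
        have h1 := hl (lam t) χ hχ
        have h2 := hc t
        change (lam t).1.1 = _ at h2
        rw [h2, Finsupp.sum, Finset.sum_mul] at h1
        rw [MonoidHom.comp_apply, ← h1]
        refine Finset.sum_congr rfl fun k _ => ?_
        rw [Matrix.smul_mul]
        rfl)
    exact ⟨k, fun t => (DFunLike.congr_fun hk t).symm⟩
  refine ⟨(X ×ˢ X).image fun p => p.1 / p.2, fun δ hδ => ?_, fun M => ?_⟩
  · obtain ⟨p, hp, rfl⟩ := Finset.mem_image.1 hδ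
    obtain ⟨h1, h2⟩ := Finset.mem_product.1 hp
    obtain ⟨k, hk⟩ := hpow _ h1
    obtain ⟨l, hl⟩ := hpow _ h2
    exact ⟨k - l, fun t => by rw [MonoidHom.div_apply, hk, hl, zpow_sub, div_eq_mul_inv]⟩
  -- The block A_χ M A_ψ has weight χ/ψ under conjugation.
  · refine ⟨fun δ => ∑ p ∈ X ×ˢ X with p.1 / p.2 = δ, A p.1 * M * A p.2, ?_, fun δ _ s => ?_⟩
    · dsimp only
      have h1 := Finset.sum_fiberwise_of_maps_to (s := X ×ˢ X)
        (g := fun p : (T →* (AlgebraicClosure F)ˣ) × (T →* (AlgebraicClosure F)ˣ) => p.1 / p.2)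
        (fun p hp => Finset.mem_image_of_mem _ hp) (fun p => A p.1 * M * A p.2)
      rw [h1, Finset.sum_product]
      calc M = (∑ χ ∈ X, A χ) * M * ∑ χ ∈ X, A χ := by rw [hA1, one_mul, mul_one]
        _ = _ := by
          rw [Finset.sum_mul, Finset.sum_mul]
          exact Finset.sum_congr rfl fun _ _ => by rw [Finset.mul_sum]
    · dsimp only
      rw [bc_sum, Finset.mul_sum, Finset.sum_mul, Finset.smul_sum]
      refine Finset.sum_congr rfl fun p hp => ?_
      obtain ⟨hp1, rfl⟩ := Finset.mem_filter.1 hp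
      obtain ⟨h1, h2⟩ := Finset.mem_product.1 hp1
      rw [bc_mul, bc_mul]
      calc _ = (s.1.1 * bc (A p.1)) * bc M * (bc (A p.2) * (s⁻¹).1.1) := by
            simp only [mul_assoc]
        _ = _ := by
          rw [hl s _ h1, hr s⁻¹ _ h2, Matrix.smul_mul, Matrix.smul_mul, Matrix.mul_smul, smul_smul,
            MonoidHom.div_apply, map_inv, div_eq_mul_inv, Units.val_mul]

/-- The characters by which the torus acts on a line of the standard representation. -/
def IsWeight (T : Subgroup (GLn n (AlgebraicClosure F))) (χ : T →* (AlgebraicClosure F)ˣ) : Prop :=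
  ∃ v : Fin n → AlgebraicClosure F, v ≠ 0 ∧
    ∀ s : T, s.1.1.mulVec v = (χ s : AlgebraicClosure F) • v

lemma IsSplitTorus.finite_isWeight (hT : IsSplitTorus T) : {χ | IsWeight T χ}.Finite := by
  obtain ⟨X, A, -, hA1, hl, -⟩ := hT.exists_weights
  refine X.finite_toSet.subset ?_
  rintro ψ ⟨v, hv, h⟩
  obtain ⟨χ, hχ, rfl⟩ := exists_char_eq_of_sum (L := AlgebraicClosure F) X id
    (fun χ => (bc (A χ)).mulVec v) hv (fun s => by
      rw [← h s]
      calc s.1.1.mulVec v = (s.1.1 * bc (∑ χ ∈ X, A χ)).mulVec v := by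
            rw [hA1, bc_one, mul_one]
        _ = _ := by
          rw [bc_sum, Finset.mul_sum, Matrix.sum_mulVec]
          refine Finset.sum_congr rfl fun χ hχ => ?_
          rw [hl s χ hχ, Matrix.smul_mulVec]
          rfl)
  exact hχ

lemma IsSplitTorus.eq_one_of_forall_isWeight (hT : IsSplitTorus T) {s : T}
    (h : ∀ χ, IsWeight T χ → χ s = 1) : s = 1 := by
  obtain ⟨X, A, hA, hA1, hl, -⟩ := hT.exists_weights
  have hw : ∀ χ ∈ X, IsWeight T χ := by
    intro χ hχ
    have hne : bc (A χ) ≠ 0 := fun h => hA χ hχ (bc_injective (h.trans bc_zero.symm))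
    obtain ⟨v, hv⟩ : ∃ v, (bc (A χ)).mulVec v ≠ 0 := by
      by_contra! h0
      exact hne (Matrix.ext_of_mulVec_single fun j => by rw [h0, Matrix.zero_mulVec])
    refine ⟨_, hv, fun t => ?_⟩
    rw [Matrix.mulVec_mulVec, hl t χ hχ, Matrix.smul_mulVec]
  apply Subtype.ext
  apply Units.ext
  calc s.1.1 = s.1.1 * bc (∑ χ ∈ X, A χ) := by rw [hA1, bc_one, mul_one]
    _ = bc (∑ χ ∈ X, A χ) := by
      rw [bc_sum, Finset.mul_sum]
      refine Finset.sum_congr rfl fun χ hχ => ?_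
      rw [hl s χ hχ, h χ (hw χ hχ), Units.val_one, one_smul]
    _ = 1 := by rw [hA1, bc_one]

end Torus

/-! ### First-order expansions along polynomial curves. -/

section Tangent

variable {L : Type*} [Field L] {σ : Type*} [Fintype σ]

open Polynomial in
lemma exists_aeval_add_mul (f : MvPolynomial σ L) (Q N : σ → L[X]) (e : L[X]) :
    ∃ r : L[X], MvPolynomial.aeval (fun i => Q i + e * N i) f =
      MvPolynomial.aeval Q f + e * ∑ i, MvPolynomial.aeval Q (MvPolynomial.pderiv i f) * N i +
        e ^ 2 * r := by
  classical
  induction f using MvPolynomial.induction_on with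
  | C a => exact ⟨0, by simp⟩
  | add p q hp hq =>
    obtain ⟨r, hr⟩ := hp
    obtain ⟨r', hr'⟩ := hq
    refine ⟨r + r', ?_⟩
    simp only [map_add, hr, hr', add_mul, Finset.sum_add_distrib]
    ring
  | mul_X p i hp =>
    obtain ⟨r, hr⟩ := hp
    have h : ∑ j, MvPolynomial.aeval Q (MvPolynomial.pderiv j (p * MvPolynomial.X i)) * N j =
        (∑ i, MvPolynomial.aeval Q (MvPolynomial.pderiv i p) * N i) * Q i +
          MvPolynomial.aeval Q p * N i := by
      simp only [Derivation.leibniz, smul_eq_mul, map_add, map_mul, MvPolynomial.aeval_X, add_mul,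
        Finset.sum_add_distrib, MvPolynomial.pderiv_X, Pi.single_apply]
      rw [add_comm, Finset.sum_mul]
      refine congrArg₂ (· + ·) ?_ ?_
      · exact Finset.sum_congr rfl fun _ _ => by ring
      · rw [Finset.sum_eq_single i (fun j _ hj => by simp [hj.symm]) (by simp)]
        simp
    generalize (∑ i, MvPolynomial.aeval Q (MvPolynomial.pderiv i p) * N i) = D at h hr
    refine ⟨r * (Q i + e * N i) + D * N i, ?_⟩
    rw [h, map_mul, map_mul, hr, MvPolynomial.aeval_X, MvPolynomial.aeval_X]
    ring

open Polynomial in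
lemma eval_aeval (f : MvPolynomial σ L) (Q : σ → L[X]) (t : L) :
    (MvPolynomial.aeval Q f).eval t = MvPolynomial.eval (fun i => (Q i).eval t) f := by
  induction f using MvPolynomial.induction_on with
  | C a => simp
  | add p q hp hq => simp [hp, hq]
  | mul_X p i hp => simp [hp]

open Polynomial in
lemma eq_zero_of_eval_ne_zero [Infinite L] {p : L[X]} (h : ∀ t, t ≠ 0 → p.eval t = 0) : p = 0 := by
  have : X * p = 0 := by
    refine Polynomial.funext fun t => ?_
    rcases eq_or_ne t 0 with rfl | ht
    · simp
    · simp [h t ht]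
  exact (mul_eq_zero.1 this).resolve_left X_ne_zero

open Polynomial in
/-- If a polynomial vanishes along two curves which agree up to the order `m > 0`, then its derivative
vanishes at the leading term of their difference. -/
lemma sum_pderiv_mul_eq_zero [Infinite L] (f : MvPolynomial σ L) (Q N : σ → L[X]) {m : ℕ}
    (hm : 0 < m) (h1 : ∀ t, t ≠ 0 → MvPolynomial.eval (fun i => (Q i).eval t) f = 0)
    (h2 : ∀ t, t ≠ 0 → MvPolynomial.eval (fun i => (Q i).eval t + t ^ m * (N i).eval t) f = 0) :
    ∑ i, MvPolynomial.eval (fun i => (Q i).eval 0) (MvPolynomial.pderiv i f) * (N i).eval 0 = 0 := by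
  have h1' : MvPolynomial.aeval Q f = 0 :=
    eq_zero_of_eval_ne_zero fun t ht => by rw [eval_aeval, h1 t ht]
  have h2' : MvPolynomial.aeval (fun i => Q i + X ^ m * N i) f = 0 :=
    eq_zero_of_eval_ne_zero fun t ht => by
      rw [eval_aeval, ← h2 t ht]
      simp
  obtain ⟨r, hr⟩ := exists_aeval_add_mul f Q N (X ^ m)
  rw [h1', h2', zero_add] at hr
  have h3 : X ^ m * (∑ i, MvPolynomial.aeval Q (MvPolynomial.pderiv i f) * N i + X ^ m * r) = 0 := by
    rw [hr]
    ring
  have h4 := congrArg (Polynomial.eval 0)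
    ((mul_eq_zero.1 h3).resolve_left (pow_ne_zero _ X_ne_zero))
  simpa [eval_finsetSum, eval_aeval, hm.ne'] using h4

open Polynomial in
lemma map_eval_mul_map_C {n : ℕ} (A B : Matrix (Fin n) (Fin n) L) (P : Matrix (Fin n) (Fin n) L[X])
    (t : L) : (A.map C * P * B.map C).map (eval t) = A * P.map (eval t) * B := by
  have h1 : ∀ A : Matrix (Fin n) (Fin n) L, (A.map C).map (eval t) = A := by
    intro A
    ext i j
    simp
  have h2 : ∀ A B : Matrix (Fin n) (Fin n) L[X],
      (A * B).map (eval t) = A.map (eval t) * B.map (eval t) := fun A B =>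
    Matrix.map_mul (f := evalRingHom t)
  rw [h2, h2, h1, h1]

end Tangent

/-! ### Elements of N ∩ G' that fix all roots. -/

namespace ReductiveTriple

variable {F : Type*} [Field F] {n : ℕ} {D : ReductiveTriple F n}

variable (D) in
lemma isSplitTorus : IsSplitTorus D.S := D.isMaximalSplitTorus.1

variable (D) in
lemma S_le_G : D.S ≤ D.G := D.isMaximalSplitTorus.2.1

/-- The elements of the torus killed by all the roots commute with the unipotent radicals of the
parabolic subgroups. -/
lemma commute_of_contracts {mu : (AlgebraicClosure F)ˣ →* D.S}
    (hmu : IsCochar F (D.S.subtype.comp mu)) {u : GLn n F} (hu : incl F u ∈ D.G)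
    (hcon : Contracts (D.S.subtype.comp mu) 1 (incl F u)) {c : D.S}
    (hc : ∀ α, IsRoot D.G D.S α → α c = 1) :
    (c : GLn n (AlgebraicClosure F)) * incl F u = incl F u * c := by
  classical
  have hT := D.isSplitTorus
  obtain ⟨Y, hY, hdec⟩ := hT.exists_adjoint_weights hmu
  choose! m hm using hY
  obtain ⟨w, hw, hws⟩ := hdec u.1
  have hconj : ∀ s : D.S, (s.1 * incl F u * s.1⁻¹).1 =
      ∑ δ ∈ Y, (δ s : AlgebraicClosure F) • bc (w δ) := by
    intro s
    have h1 : (incl F u).1 = bc u.1 := rfl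
    rw [Units.val_mul, Units.val_mul, h1, hw, bc_sum, Finset.mul_sum, Finset.sum_mul]
    exact Finset.sum_congr rfl fun δ hδ => hws δ hδ s
  suffices H : ∀ δ ∈ Y, w δ ≠ 0 → δ c = 1 by
    have h1 : c.1 * incl F u * c.1⁻¹ = incl F u := by
      apply Units.ext
      rw [hconj c]
      change _ = bc u.1
      rw [hw, bc_sum]
      refine Finset.sum_congr rfl fun δ hδ => ?_
      by_cases h0 : w δ = 0
      · rw [h0, bc_zero, smul_zero]
      · rw [H δ hδ h0, Units.val_one, one_smul]
    rwa [mul_inv_eq_iff_eq_mul] at h1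
  by_contra! hB
  set B := Y.filter fun δ => w δ ≠ 0 ∧ δ c ≠ 1 with hBdef
  clear_value B
  have hBne : B.Nonempty := by
    obtain ⟨δ, h1, h2, h3⟩ := hB
    exact ⟨δ, hBdef ▸ Finset.mem_filter.2 ⟨h1, h2, h3⟩⟩
  -- Among the weights of `u` not killed by `c`, one on which `mu` has the smallest exponent: it
  -- governs the leading term as t → 0.
  obtain ⟨δ₀, hδ₀, hmin⟩ := Finset.exists_min_image B m hBne
  obtain ⟨hδY, hδ0, hδc⟩ := Finset.mem_filter.1 (hBdef ▸ hδ₀)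
  obtain ⟨P, hP⟩ := hcon
  -- The difference of the conjugates of `u` by c s mu(t) and by s mu(t), divided by the leading
  -- power t ^ m δ₀.
  let N : D.S → Fin n × Fin n → Polynomial (AlgebraicClosure F) := fun s ij =>
    ∑ δ ∈ B, Polynomial.C (((δ c : AlgebraicClosure F) - 1) * δ s *
      algebraMap F (AlgebraicClosure F) (w δ ij.1 ij.2)) * Polynomial.X ^ (m δ - m δ₀).toNat
  let R : D.S → Matrix (Fin n) (Fin n) (Polynomial (AlgebraicClosure F)) := fun s =>
    s.1.1.map Polynomial.C * P * (s.1⁻¹).1.map Polynomial.C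
  have hR : ∀ (s : D.S) (t : (AlgebraicClosure F)ˣ),
      ((s * mu t).1 * incl F u * (s * mu t).1⁻¹).1 =
        1 + (t : AlgebraicClosure F) • (R s).map (Polynomial.eval (t : AlgebraicClosure F)) := by
    intro s t
    have h1 := hP t
    have h2 : (s * mu t).1 * incl F u * (s * mu t).1⁻¹ =
        s.1 * ((mu t).1 * incl F u * (mu t).1⁻¹) * s.1⁻¹ := by
      rw [Subgroup.coe_mul, mul_inv_rev]
      simp only [mul_assoc]
    rw [h2, Units.val_mul, Units.val_mul]
    change ((mu t).1 * incl F u * (mu t).1⁻¹).1 = _ at h1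
    rw [h1, pow_one, mul_add, mul_one, add_mul, Matrix.mul_smul, Matrix.smul_mul]
    have h3 : s.1.1 * (s.1⁻¹).1 = 1 := s.1.mul_inv
    rw [h3]
    congr 2
    rw [map_eval_mul_map_C]
  have hN : ∀ (s : D.S) (t : (AlgebraicClosure F)ˣ) (ij : Fin n × Fin n),
      ((c * s * mu t).1 * incl F u * (c * s * mu t).1⁻¹).1 ij.1 ij.2 =
        ((s * mu t).1 * incl F u * (s * mu t).1⁻¹).1 ij.1 ij.2 +
          ((t ^ m δ₀ : (AlgebraicClosure F)ˣ) : AlgebraicClosure F) * (N s ij).eval ↑t := by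
    intro s t ij
    rw [hconj, hconj, ← sub_eq_iff_eq_add']
    simp only [N, Matrix.sum_apply, Matrix.smul_apply, smul_eq_mul, Polynomial.eval_finsetSum,
      Polynomial.eval_mul, Polynomial.eval_C, Polynomial.eval_pow, Polynomial.eval_X,
      Finset.mul_sum]
    rw [← Finset.sum_sub_distrib, hBdef, Finset.sum_filter]
    refine Finset.sum_congr rfl fun δ hδ => ?_
    split_ifs with h
    · have h1 : ((δ (mu t) : (AlgebraicClosure F)ˣ) : AlgebraicClosure F) =
          ((t ^ m δ₀ : (AlgebraicClosure F)ˣ) : AlgebraicClosure F) * ↑t ^ (m δ - m δ₀).toNat := by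
        have h2 : 0 ≤ m δ - m δ₀ := sub_nonneg.2 (hmin δ (hBdef ▸ Finset.mem_filter.2 ⟨hδ, h⟩))
        have h3 : t ^ m δ = t ^ m δ₀ * t ^ (m δ - m δ₀).toNat := by
          rw [← zpow_natCast, Int.toNat_of_nonneg h2, ← zpow_add]
          congr 1
          ring
        rw [hm δ hδ t, h3]
        push_cast
        rfl
      simp only [map_mul, Units.val_mul, h1, Matrix.map_apply]
      ring
    · rw [not_and_or, not_not, not_not] at h
      rcases h with h | h
      · simp [h]
      · simp [h]
  have hN0 : ∀ (s : D.S) (ij : Fin n × Fin n), (N s ij).eval 0 =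
      ∑ δ ∈ B with m δ = m δ₀, ((δ c : AlgebraicClosure F) - 1) * δ s *
        algebraMap F (AlgebraicClosure F) (w δ ij.1 ij.2) := by
    intro s ij
    simp only [N, Polynomial.eval_finsetSum, Polynomial.eval_mul, Polynomial.eval_C,
      Polynomial.eval_pow, Polynomial.eval_X]
    rw [Finset.sum_filter]
    refine Finset.sum_congr rfl fun δ hδ => ?_
    have h1 := hmin δ hδ
    split_ifs with h
    · rw [h, sub_self, Int.toNat_zero, pow_zero, mul_one]
    · rw [zero_pow (by omega), mul_zero]
  -- Varying `s`, independence of characters isolates the component of weight δ₀; its factor δ₀(c) -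
  -- 1 is nonzero.
  have hkey : ∀ a : Fin n × Fin n → AlgebraicClosure F,
      (∀ s, ∑ ij, a ij * (N s ij).eval 0 = 0) →
      ∑ ij, a ij * algebraMap F (AlgebraicClosure F) (w δ₀ ij.1 ij.2) = 0 := by
    intro a ha
    have h1 := eq_zero_of_sum_char_smul (L := AlgebraicClosure F)
      (B.filter fun δ => m δ = m δ₀)
      (fun δ => ((δ c : AlgebraicClosure F) - 1) *
        ∑ ij, a ij * algebraMap F (AlgebraicClosure F) (w δ ij.1 ij.2)) (fun s => by
          rw [← ha s]
          simp only [hN0, Finset.mul_sum]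
          rw [Finset.sum_comm]
          refine Finset.sum_congr rfl fun δ _ => ?_
          rw [smul_eq_mul, Finset.mul_sum]
          exact Finset.sum_congr rfl fun _ _ => by ring) δ₀ (Finset.mem_filter.2 ⟨hδ₀, rfl⟩)
    refine (mul_eq_zero.1 h1).resolve_left fun h => hδc ?_
    exact Units.ext (sub_eq_zero.1 h)
  rcases le_or_gt (m δ₀) 0 with hm0 | hm0
  -- Contraction makes both curves congruent to 1 modulo t, so for `m δ₀ ≤ 0` the leading
  -- coefficient of their difference vanishes.
  · refine hδ0 (Matrix.ext fun i j => ?_)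
    have h1 := hkey (Pi.single (i, j) 1) fun s => by
      have h2 : N s (i, j) =
          Polynomial.X ^ ((1 - m δ₀).toNat) * (R (c * s) i j - R s i j) := by
        rw [← sub_eq_zero]
        refine eq_zero_of_eval_ne_zero fun t ht => ?_
        have h3 := hN s (Units.mk0 t ht) (i, j)
        rw [hR, hR] at h3
        simp only [Matrix.add_apply, Matrix.smul_apply, Matrix.map_apply, smul_eq_mul,
          Units.val_mk0] at h3
        have h4 : (Units.mk0 t ht) ^ (1 - m δ₀).toNat * (Units.mk0 t ht) ^ m δ₀ =
            Units.mk0 t ht := by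
          rw [← zpow_natCast, Int.toNat_of_nonneg (by omega), ← zpow_add, sub_add_cancel, zpow_one]
        have h5 := congrArg Units.val h4
        simp only [Units.val_mul, Units.val_pow_eq_pow_val, Units.val_mk0] at h5
        have h6 : (((Units.mk0 t ht) ^ m δ₀ : (AlgebraicClosure F)ˣ) : AlgebraicClosure F) ≠ 0 :=
          Units.ne_zero _
        simp only [Polynomial.eval_sub, Polynomial.eval_mul, Polynomial.eval_pow,
          Polynomial.eval_X]
        apply mul_left_cancel₀ h6
        linear_combination -h3 - ((R (c * s) i j).eval t - (R s i j).eval t) * h5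
      rw [Finset.sum_eq_single (i, j) (fun b _ hb => by simp [hb]) (by simp), h2]
      have h3 : (1 - m δ₀).toNat ≠ 0 := by omega
      simp [h3]
    rw [Finset.sum_eq_single (i, j) (fun b _ hb => by simp [hb]) (by simp)] at h1
    simpa using h1
  -- For `m δ₀ > 0` both curves stay in `G`, pass through 1 at t = 0, and agree to order `m δ₀`, so
  -- the leading term is tangent to `G` at 1. Then δ₀ is a root and `c` is killed by it.
  · have hlie : w δ₀ ∈ lieAlg D.G := by
      intro f hf
      refine hkey _ fun s => ?_
      let Q : Fin n × Fin n → Polynomial (AlgebraicClosure F) := fun ij =>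
        Polynomial.C ((1 : Matrix (Fin n) (Fin n) (AlgebraicClosure F)) ij.1 ij.2) +
          Polynomial.X * R s ij.1 ij.2
      have hQ : ∀ (t : (AlgebraicClosure F)ˣ) (ij : Fin n × Fin n),
          (Q ij).eval ↑t = ((s * mu t).1 * incl F u * (s * mu t).1⁻¹).1 ij.1 ij.2 := by
        intro t ij
        rw [hR]
        simp [Q]
      have hmem : ∀ s : D.S, s.1 * incl F u * s.1⁻¹ ∈ D.G := fun s =>
        mul_mem (mul_mem (D.S_le_G s.2) hu) (inv_mem (D.S_le_G s.2))
      have h1 := sum_pderiv_mul_eq_zero f Q (N s) (m := (m δ₀).toNat) (by omega)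
        (fun t ht => by
          have h2 := hf _ (hmem (s * mu (Units.mk0 t ht)))
          rw [← h2]
          refine congrArg (fun x => MvPolynomial.eval x f) (funext fun ij => ?_)
          exact hQ (Units.mk0 t ht) ij)
        (fun t ht => by
          have h2 := hf _ (hmem (c * s * mu (Units.mk0 t ht)))
          rw [← h2]
          refine congrArg (fun x => MvPolynomial.eval x f) (funext fun ij => ?_)
          refine Eq.trans ?_ (hN s (Units.mk0 t ht) ij).symm
          have h3 := hQ (Units.mk0 t ht) ij
          rw [Units.val_mk0] at h3
          rw [h3]
          congr 2
          rw [← Int.toNat_of_nonneg hm0.le, zpow_natCast, Units.val_pow_eq_pow_val, Units.val_mk0,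
            Int.toNat_natCast])
      refine Eq.trans (Finset.sum_congr rfl fun ij _ => ?_) h1
      congr 1
      refine congrArg (fun x => MvPolynomial.eval x (MvPolynomial.pderiv ij f)) (funext fun kl => ?_)
      simp [Q]
    refine hδc (hc δ₀ ⟨fun h => hδc (by rw [h]; rfl), fun h => hδ0 ?_⟩)
    have h1 : w δ₀ ∈ weightSpace D.G D.S δ₀ := ⟨hlie, fun s => hws δ₀ hδY s⟩
    rwa [h, Submodule.mem_bot] at h1

lemma isCochar_comp_inv {E : Type*} [Field E] [Algebra E (AlgebraicClosure F)]
    {lam : (AlgebraicClosure F)ˣ →* GLn n (AlgebraicClosure F)} (h : IsCochar E lam) :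
    IsCochar E (lam.comp (invMonoidHom : (AlgebraicClosure F)ˣ →* _)) := by
  obtain ⟨c, hc⟩ := h
  refine ⟨Finsupp.equivMapDomain (Equiv.neg ℤ) c, fun t => ?_⟩
  rw [MonoidHom.comp_apply, hc, Finsupp.sum_equivMapDomain]
  refine Finset.sum_congr rfl fun k _ => ?_
  simp

lemma isWeight_conjChar (g : D.N) {χ : D.Char} (h : IsWeight D.S χ) :
    IsWeight D.S (conjChar g χ) := by
  obtain ⟨v, hv, h⟩ := h
  refine ⟨(incl F g.1).1.mulVec v, fun h0 => hv ?_, fun s => ?_⟩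
  · have h1 : ((incl F g.1)⁻¹).1 * (incl F g.1).1 = 1 := (incl F g.1).inv_mul
    rw [← Matrix.one_mulVec v, ← h1, ← Matrix.mulVec_mulVec, h0, Matrix.mulVec_zero]
  · have h1 := h ⟨_, inv_mul_mul_mem g s.2⟩
    rw [conjChar_apply g χ s ⟨_, inv_mul_mul_mem g s.2⟩ rfl, ← Matrix.mulVec_smul, ← h1,
      Matrix.mulVec_mulVec, Matrix.mulVec_mulVec]
    congr 1
    change s.1.1 * (incl F g.1).1 = (incl F g.1).1 * ((incl F g.1)⁻¹ * s.1 * incl F g.1).1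
    rw [← Units.val_mul, ← Units.val_mul]
    congr 1
    group

/-- An element of `N ∩ G'` which acts trivially on the roots lies in `Z`. -/
lemma mem_Z_of_conjChar_eq (g : D.N) (hg : g.1 ∈ D.G')
    (h : ∀ α, IsRoot D.G D.S α → conjChar g α = α) : g.1 ∈ D.Z := by
  have hT := D.isSplitTorus
  -- The element g⁻¹ s g s⁻¹, which lies in `S` and is killed by all roots because `g` fixes them.
  let c : D.S → D.S := fun s => ⟨_, inv_mul_mul_mem g s.2⟩ * s⁻¹
  have hcroot : ∀ s α, IsRoot D.G D.S α → α (c s) = 1 := by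
    intro s α hα
    rw [map_mul, map_inv, mul_inv_eq_one, ← conjChar_apply g α s _ rfl, h α hα]
  have hcomm : ∀ s, (c s).1 * incl F g.1 = incl F g.1 * (c s).1 := by
    intro s
    have h1 : D.G' ≤ (Subgroup.centralizer {(c s).1}).comap (incl F) := by
      refine (Subgroup.closure_le _).2 ?_
      rintro u (hu | hu)
      · exact Subgroup.mem_centralizer_singleton_iff.2
          (commute_of_contracts D.isCochar hu.1 hu.2 (hcroot s)).symm
      · exact Subgroup.mem_centralizer_singleton_iff.2
          (commute_of_contracts (mu := D.lam.comp invMonoidHom) (isCochar_comp_inv D.isCochar) hu.1 hu.2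
            (hcroot s)).symm
    exact (Subgroup.mem_centralizer_singleton_iff.1 (h1 hg)).symm
  -- As `c s` commutes with `g`, conjugating k times multiplies `s` by the k-th power of `c s`.
  have hpow : ∀ (s : D.S) (k : ℕ),
      ((c s) ^ k * s).1 = (incl F (g ^ k).1)⁻¹ * s * incl F (g ^ k).1 := by
    intro s k
    induction k with
    | zero => simp
    | succ k ih =>
      have h1 : incl F (g ^ (k + 1)).1 = incl F (g ^ k).1 * incl F g.1 := by
        rw [pow_succ]
        simp
      have h2 : (incl F g.1)⁻¹ * s.1 * incl F g.1 = (c s).1 * s.1 := by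
        simp [c]
      have h3 : Commute ((c s).1 ^ k) (incl F g.1) := Commute.pow_left (hcomm s) k
      rw [h1]
      calc _ = (c s).1 ^ k * ((c s).1 * s.1) := by simp [pow_succ, mul_assoc]
        _ = (incl F g.1)⁻¹ * ((c s).1 ^ k * s.1) * incl F g.1 := by
          rw [← h2, ← mul_assoc, ← mul_assoc, ← mul_assoc, h3.inv_right.eq]
        _ = _ := by
          have : (c s).1 ^ k * s.1 = ((c s) ^ k * s).1 := by simp
          rw [this, ih]
          group
  have hone : ∀ s, c s = 1 := by
    intro s
    refine hT.eq_one_of_forall_isWeight fun χ hχ => ?_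
    -- The powers of `g` permute the finitely many weights, so two of them agree on χ. This gives
    -- χ(c s) ^ (l - k) = 1 for every s, and torsion-freeness of the characters removes the
    -- exponent.
    obtain ⟨k, l, hkl, hne⟩ : ∃ k l : ℕ, k < l ∧ conjChar (g ^ k) χ = conjChar (g ^ l) χ := by
      by_contra! h'
      refine Set.infinite_of_injective_forall_mem (f := fun k : ℕ => conjChar (g ^ k) χ) ?_
        (fun k => isWeight_conjChar (g ^ k) hχ) hT.finite_isWeight
      intro k l hkl
      rcases lt_trichotomy k l with h1 | h1 | h1
      · exact absurd hkl (h' k l h1)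
      · exact h1
      · exact absurd hkl.symm (h' l k h1)
    have hξ : conjChar g χ / χ = 1 := by
      refine hT.eq_one_of_pow_eq_one (k := l - k) (by omega) ?_
      ext s
      have h1 := DFunLike.congr_fun hne s
      rw [conjChar_apply _ _ _ _ (hpow s k), conjChar_apply _ _ _ _ (hpow s l), map_mul, map_mul,
        mul_left_inj, map_pow, map_pow] at h1
      have h2 : χ (c s) ^ (l - k) = 1 := by
        rw [← mul_right_inj (χ (c s) ^ k), ← pow_add, mul_one, h1]
        congr 1
        omega
      have h3 : (conjChar g χ / χ) s = χ (c s) := by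
        rw [MonoidHom.div_apply, map_mul, map_inv, div_eq_mul_inv, conjChar_apply g χ s ⟨_, inv_mul_mul_mem g s.2⟩ rfl]
      rw [MonoidHom.pow_apply, h3, h2]
      rfl
    have h4 := DFunLike.congr_fun hξ s
    rw [MonoidHom.div_apply, conjChar_apply g χ s ⟨_, inv_mul_mul_mem g s.2⟩ rfl] at h4
    rw [map_mul, map_inv, ← div_eq_mul_inv, h4]
    rfl
  refine ⟨g.2.1, Subgroup.mem_centralizer_iff.2 fun s hs => ?_⟩
  have h1 := congrArg Subtype.val (hone ⟨s, hs⟩)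
  change (incl F g.1)⁻¹ * s * incl F g.1 * s⁻¹ = 1 at h1
  rw [mul_inv_eq_one, mul_assoc, inv_mul_eq_iff_eq_mul] at h1
  exact h1

/-! ### Roots as linear forms on V_ad. -/

section Forms

variable {F : Type*} [Field F] {n : ℕ} {D : ReductiveTriple F n}

/-- The values of an element of `V_ad` on independent elements of the root lattice are arbitrary. -/
lemma exists_vad_apply_eq {κ : Type*} (v : κ → D.rootLattice)
    (hv : ∀ c : κ →₀ ℤ, c.prod (fun i k => v i ^ k) = 1 → c = 0) (r : κ → ℝ) :
    ∃ x : D.Vad, ∀ i, x (Additive.ofMul (v i)) = r i := by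
  let f : (κ →₀ ℤ) →+ Additive D.rootLattice :=
    Finsupp.liftAddHom fun i => zmultiplesHom _ (Additive.ofMul (v i))
  let g : (κ →₀ ℤ) →+ ℝ := Finsupp.liftAddHom fun i => zmultiplesHom _ (r i)
  have hf : Function.Injective f := by
    refine (injective_iff_map_eq_zero f).2 fun c hc => hv c ?_
    have h1 : f c = Additive.ofMul (c.prod fun i k => v i ^ k) := by
      simp only [f, Finsupp.liftAddHom_apply, Finsupp.sum, Finsupp.prod, ofMul_prod]
      rfl
    rw [h1] at hc
    exact hc
  -- The real numbers are divisible, hence injective as an abelian group: prescribed values extend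
  -- from a free subgroup to the whole root lattice.
  obtain ⟨x, hx⟩ := (Module.Baer.of_divisible ℝ).extension_property_addMonoidHom f hf g
  refine ⟨x, fun i => ?_⟩
  have h1 := DFunLike.congr_fun hx (Finsupp.single i 1)
  simpa [f, g] using h1

/-- The root lattice is torsion-free, so real-valued homomorphisms separate its points. -/
lemma eq_one_of_forall_vad_apply {χ : D.rootLattice}
    (h : ∀ x : D.Vad, x (Additive.ofMul χ) = 0) : χ = 1 := by
  by_contra hχ
  obtain ⟨x, hx⟩ := exists_vad_apply_eq (D := D) (fun _ : Unit => χ) (fun c hc => by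
    by_contra hc0
    apply hχ
    have h1 : χ ^ c () = 1 := by
      rw [Finsupp.prod, Finset.prod_subset (Finset.subset_univ _) (fun i _ hi => by
        rw [Finsupp.notMem_support_iff.1 hi, zpow_zero])] at hc
      simpa using hc
    have h2 : c () ≠ 0 := fun h0 => hc0 (Finsupp.ext fun _ => h0)
    have h3 : χ ^ (c ()).natAbs = 1 := by
      rcases Int.natAbs_eq (c ()) with h | h
      · rw [h, zpow_natCast] at h1
        exact h1
      · rw [h, zpow_neg, zpow_natCast, inv_eq_one] at h1
        exact h1
    exact Subtype.ext (D.isSplitTorus.eq_one_of_pow_eq_one (Int.natAbs_pos.2 h2)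
      (congrArg Subtype.val h3))) fun _ => 1
  rw [h x] at hx
  exact zero_ne_one (hx ())

lemma form_apply (α : D.Root) (x : D.Vad) :
    D.form α x = x (Additive.ofMul ⟨α.1, Subgroup.subset_closure α.2⟩) := rfl

lemma form_injective : Function.Injective D.form := by
  intro α β h
  have h1 := eq_one_of_forall_vad_apply (D := D)
    (χ := ⟨α.1, Subgroup.subset_closure α.2⟩ / ⟨β.1, Subgroup.subset_closure β.2⟩) fun x => by
      rw [ofMul_div, map_sub, sub_eq_zero]
      exact LinearMap.congr_fun h x
  have h2 := congrArg Subtype.val h1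
  change α.1 / β.1 = 1 at h2
  exact Subtype.ext (div_eq_one.1 h2)

lemma vad_ext {x y : D.Vad} (h : ∀ α, D.form α x = D.form α y) : x = y := by
  have key : ∀ χ (hχ : χ ∈ D.rootLattice),
      x (Additive.ofMul ⟨χ, hχ⟩) = y (Additive.ofMul ⟨χ, hχ⟩) := by
    intro χ hχ
    induction hχ using Subgroup.closure_induction with
    | mem χ hχ => exact h ⟨χ, hχ⟩
    | one =>
      have h1 : (Additive.ofMul (⟨1, one_mem _⟩ : D.rootLattice)) = 0 := rfl
      rw [h1, map_zero, map_zero]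
    | mul χ ψ hχ hψ h1 h2 =>
      have h3 : (Additive.ofMul (⟨χ * ψ, mul_mem hχ hψ⟩ : D.rootLattice)) =
        Additive.ofMul ⟨χ, hχ⟩ + Additive.ofMul ⟨ψ, hψ⟩ := rfl
      rw [h3, map_add, map_add, h1, h2]
    | inv χ hχ h1 =>
      have h3 : (Additive.ofMul (⟨χ⁻¹, inv_mem hχ⟩ : D.rootLattice)) =
        -Additive.ofMul ⟨χ, hχ⟩ := rfl
      rw [h3, map_neg, map_neg, h1]
  exact AddMonoidHom.ext fun χ => key _ χ.toMul.2

lemma eq_zero_of_forall_zpow_eq_one {L : Type*} [Field L] [Infinite L] {k : ℤ}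
    (h : ∀ t : Lˣ, t ^ k = 1) : k = 0 := by
  by_contra hk
  have h1 : ∀ t : Lˣ, t ^ k.natAbs = 1 := by
    intro t
    rcases Int.natAbs_eq k with h' | h'
    · have := h t
      rwa [h', zpow_natCast] at this
    · have := h t
      rwa [h', zpow_neg, zpow_natCast, inv_eq_one] at this
  refine Polynomial.X_pow_sub_C_ne_zero (Int.natAbs_pos.2 hk) (1 : L)
    (eq_zero_of_eval_ne_zero fun t ht => ?_)
  have := congrArg Units.val (h1 (Units.mk0 t ht))
  simpa [sub_eq_zero] using this

/-- A root occurs among the weights of conjugation on matrices, so on `lam` it is an integral power;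
regularity of `lam` excludes the exponent 0. -/
lemma exists_zpow_lam (α : D.Root) : ∃ m : ℤ, m ≠ 0 ∧ ∀ t, α.1 (D.lam t) = t ^ m := by
  obtain ⟨Y, hY, hdec⟩ := D.isSplitTorus.exists_adjoint_weights D.isCochar
  obtain ⟨X, hX, hX0⟩ := (Submodule.ne_bot_iff _).1 α.2.2
  obtain ⟨w, hw, hws⟩ := hdec X
  obtain ⟨δ, hδ, hδα⟩ := exists_char_eq_of_sum (L := AlgebraicClosure F) Y id
    (fun δ => bc (w δ)) (ψ := α.1) (a := bc X) (fun h => hX0 (bc_injective (h.trans bc_zero.symm)))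
    (fun s => by
      dsimp only [id]
      rw [← hX.2 s, ← Finset.sum_congr rfl fun δ hδ => hws δ hδ s, ← Finset.sum_mul,
        ← Finset.mul_sum, ← bc_sum, ← hw]
      rfl)
  obtain ⟨m, hm⟩ := hY δ hδ
  rw [id] at hδα
  rw [hδα] at hm
  refine ⟨m, ?_, hm⟩
  rintro rfl
  refine D.regular α.1 α.2 ?_
  ext t
  rw [MonoidHom.comp_apply, hm, zpow_zero]
  rfl

end Forms

/-! ### The simple roots give a base of the affine root system. -/

section Base

variable {F : Type*} [Field F] [ValuativeRel F] [TopologicalSpace F]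
  [IsNonarchimedeanLocalField F] {n : ℕ} {D : ReductiveTriple F n} {x₀ : D.SpecialPoint}
  {ι : Type*}

namespace AffineRootSystem

variable (A : D.AffineRootSystem x₀ ι)

instance : A.P.IsEval := ⟨A.pairing_eq⟩

instance : A.P.IsRootSystem := A.isRootSystem

instance : A.P.IsCrystallographic := A.isCrystallographic

instance : A.P.IsReduced := A.isReduced

lemma e_pos_real (α : D.Root) : (0 : ℝ) < A.e α := by exact_mod_cast A.e_pos α

lemma root_idx_apply (α : D.Root) (x : D.Vad) : A.P.root (A.idx α) x = A.e α * D.form α x := by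
  rw [A.root_idx]
  rfl

/-- If α has negative exponent on `lam`, take β with β_a = -α_a. Then β ^ e_β α ^ e_α = 1 in the
root lattice, so β has positive exponent. β need not be the inverse of α, since the multipliers may
differ. -/
lemma isPositive_or [Finite ι] (α : D.Root) :
    D.IsPositive α ∨ ∃ β, D.IsPositive β ∧ A.idx β = A.P.reflectionPerm (A.idx α) (A.idx α) := by
  obtain ⟨m, hm0, hm⟩ := exists_zpow_lam α
  rcases lt_or_gt_of_ne hm0 with hneg | hpos
  · right
    obtain ⟨β, hβ⟩ := A.idx_surjective (A.P.reflectionPerm (A.idx α) (A.idx α))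
    refine ⟨β, ?_, hβ⟩
    obtain ⟨k, -, hk⟩ := exists_zpow_lam β
    have h1 := eq_one_of_forall_vad_apply (D := D)
      (χ := ⟨β.1, Subgroup.subset_closure β.2⟩ ^ A.e β *
        ⟨α.1, Subgroup.subset_closure α.2⟩ ^ A.e α) fun x => by
          have h2 := root_reflectionPerm_self (P := A.P) (A.idx α) x
          rw [← hβ, A.root_idx_apply, A.root_idx_apply, form_apply, form_apply] at h2
          rw [ofMul_mul, map_add, ofMul_pow, ofMul_pow, map_nsmul, map_nsmul, nsmul_eq_mul,
            nsmul_eq_mul, h2]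
          ring
    have h2 : k * A.e β + m * A.e α = 0 := by
      refine eq_zero_of_forall_zpow_eq_one (L := AlgebraicClosure F) fun t => ?_
      have h3 := DFunLike.congr_fun (congrArg Subtype.val h1) (D.lam t)
      change (β.1 ^ A.e β * α.1 ^ A.e α) (D.lam t) = 1 at h3
      rw [MonoidHom.mul_apply, MonoidHom.pow_apply, MonoidHom.pow_apply, hk, hm] at h3
      rw [zpow_add, zpow_mul, zpow_mul, zpow_natCast, zpow_natCast]
      exact h3
    have h3 : 0 < k := by
      have h4 : (0 : ℤ) < A.e α := by exact_mod_cast A.e_pos α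
      have h5 : (0 : ℤ) < A.e β := by exact_mod_cast A.e_pos β
      have h6 := mul_neg_of_neg_of_pos hneg h4
      have h7 : 0 < k * A.e β := by linarith
      exact pos_of_mul_pos_left h7 h5.le
    exact ⟨k.toNat, by omega, fun t => by
      rw [hk, ← zpow_natCast, Int.toNat_of_nonneg h3.le]⟩
  · left
    exact ⟨m.toNat, by omega, fun t => by
      rw [hm, ← zpow_natCast, Int.toNat_of_nonneg hpos.le]⟩

variable [Finite ι] {Δ : Set D.Root} (hΔ : D.IsSimpleRoots Δ)

include hΔ in
lemma exists_form_eq (r : Δ → ℝ) : ∃ x : D.Vad, ∀ α : Δ, D.form α.1 x = r α := by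
  refine exists_vad_apply_eq (D := D)
    (fun α : Δ => ⟨α.1.1, Subgroup.subset_closure α.1.2⟩) (fun c hc => hΔ.2.1 c ?_) r
  have := congrArg Subtype.val hc
  rw [Finsupp.prod, Subgroup.val_finsetProd] at this
  exact this

include hΔ in
lemma exists_root_idx_eq_sum {s : Finset ι} (hs : (s : Set ι) = A.idx '' Δ) {β : D.Root}
    (hβ : D.IsPositive β) : ∃ c : ι → ℝ, (∀ j ∈ s, 0 ≤ c j) ∧
      A.P.root (A.idx β) = ∑ j ∈ s, c j • A.P.root j := by
  classical
  have hle : Submonoid.closure {χ : D.Char | ∃ α ∈ Δ, χ = α.1} ≤ D.rootLattice.toSubmonoid := by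
    refine (Submonoid.closure_le).2 ?_
    rintro _ ⟨α, -, rfl⟩
    exact Subgroup.subset_closure α.2
  have key : ∀ χ ∈ Submonoid.closure {χ : D.Char | ∃ α ∈ Δ, χ = α.1},
      ∃ c : ι → ℝ, (∀ j ∈ s, 0 ≤ c j) ∧ ∀ (hχ : χ ∈ D.rootLattice) (x : D.Vad),
        x (Additive.ofMul ⟨χ, hχ⟩) = ∑ j ∈ s, c j * A.P.root j x := by
    intro χ hχ
    induction hχ using Submonoid.closure_induction with
    | mem χ hχ =>
      obtain ⟨α, hα, rfl⟩ := hχ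
      refine ⟨Pi.single (A.idx α) (A.e α : ℝ)⁻¹, fun j _ => ?_, fun _ x => ?_⟩
      · rw [Pi.single_apply]
        split_ifs
        · exact inv_nonneg.2 (A.e_pos_real α).le
        · exact le_rfl
      · have hmem : A.idx α ∈ s := by
          rw [← Finset.mem_coe, hs]
          exact ⟨α, hα, rfl⟩
        rw [Finset.sum_eq_single_of_mem _ hmem (fun j _ hj => by simp [hj]), Pi.single_eq_same,
          A.root_idx_apply, inv_mul_cancel_left₀ (A.e_pos_real α).ne']
        rfl
    | one =>
      refine ⟨0, fun _ _ => le_rfl, fun hχ x => ?_⟩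
      have h1 : (Additive.ofMul (⟨1, hχ⟩ : D.rootLattice)) = 0 := rfl
      rw [h1, map_zero]
      simp
    | mul χ ψ hχ hψ h1 h2 =>
      obtain ⟨c, hc, hc'⟩ := h1
      obtain ⟨d, hd, hd'⟩ := h2
      refine ⟨fun j => c j + d j, fun j hj => add_nonneg (hc j hj) (hd j hj), fun h x => ?_⟩
      have h3 : (Additive.ofMul (⟨χ * ψ, h⟩ : D.rootLattice)) =
        Additive.ofMul ⟨χ, hle hχ⟩ + Additive.ofMul ⟨ψ, hle hψ⟩ := rfl
      rw [h3, map_add, hc', hd', ← Finset.sum_add_distrib]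
      exact Finset.sum_congr rfl fun _ _ => by ring
  obtain ⟨c, hc, h⟩ := key _ (hΔ.2.2 β hβ)
  refine ⟨fun j => A.e β * c j, fun j hj => mul_nonneg (A.e_pos_real β).le (hc j hj), ?_⟩
  ext x
  have h1 : D.form β x = ∑ j ∈ s, c j * A.P.root j x := h _ x
  rw [A.root_idx_apply, h1, Finset.mul_sum, LinearMap.sum_apply]
  exact Finset.sum_congr rfl fun _ _ => by
    rw [LinearMap.smul_apply, smul_eq_mul]
    ring

include hΔ in
/-- The simple roots give a base of the affine root system. -/
lemma exists_base : ∃ b : A.P.Base, (b.support : Set ι) = A.idx '' Δ ∧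
    ∀ i, b.IsPos i ↔ ∃ α, D.IsPositive α ∧ A.idx α = i := by
  classical
  obtain ⟨s, hs⟩ : ∃ s : Finset ι, (s : Set ι) = A.idx '' Δ :=
    ⟨(Set.toFinite (A.idx '' Δ)).toFinset, by simp⟩
  have hli : LinearIndepOn ℝ A.P.root (s : Set ι) := by
    refine linearIndepOn_finset_iff.2 fun g hg j hj => ?_
    have hj' := hj
    rw [← Finset.mem_coe, hs] at hj'
    obtain ⟨α, hα, rfl⟩ := hj'
    obtain ⟨x, hx⟩ := exists_form_eq hΔ (fun β => if β.1 = α then 1 else 0)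
    have h1 := LinearMap.congr_fun hg x
    rw [LinearMap.sum_apply, Finset.sum_eq_single_of_mem _ hj] at h1
    · rw [LinearMap.smul_apply, A.root_idx_apply, hx ⟨α, hα⟩, if_pos rfl, mul_one,
        LinearMap.zero_apply, smul_eq_mul, mul_eq_zero] at h1
      exact h1.resolve_right (A.e_pos_real α).ne'
    · intro j hj hne
      rw [← Finset.mem_coe, hs] at hj
      obtain ⟨β, hβ, rfl⟩ := hj
      have hβα : β ≠ α := fun h => hne (by rw [h])
      rw [LinearMap.smul_apply, A.root_idx_apply, hx ⟨β, hβ⟩, if_neg hβα, mul_zero, smul_zero]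
  have hneg : ∀ i, A.P.root (A.P.reflectionPerm i i) = -A.P.root i := fun i =>
    LinearMap.ext fun x => root_reflectionPerm_self i x
  have hsp : ∀ i, ∃ c : ι → ℝ, (∀ j ∈ s, 0 ≤ c j) ∧
      (A.P.root i = ∑ j ∈ s, c j • A.P.root j ∨ -A.P.root i = ∑ j ∈ s, c j • A.P.root j) := by
    intro i
    obtain ⟨α, rfl⟩ := A.idx_surjective i
    rcases A.isPositive_or α with h | ⟨β, hβ, hβα⟩
    · obtain ⟨c, hc, h⟩ := A.exists_root_idx_eq_sum hΔ hs h
      exact ⟨c, hc, Or.inl h⟩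
    · obtain ⟨c, hc, h⟩ := A.exists_root_idx_eq_sum hΔ hs hβ
      rw [hβα, hneg] at h
      exact ⟨c, hc, Or.inr h⟩
  -- The multipliers e_α make the coefficients merely real; the closure lemma for reduced systems
  -- upgrades them to natural numbers.
  let b : A.P.Base := RootPairing.Base.mk' A.P (s : Set ι) hli
    (RootPairing.root_mem_or_neg_mem_closure_of_nonneg A.P s hli hsp)
  have hb : b.support = s := by
    apply Finset.coe_injective
    change ((Set.toFinite (s : Set ι)).toFinset : Set ι) = s
    simp
  have hpos : ∀ α, D.IsPositive α → b.IsPos (A.idx α) := by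
    intro α hα
    obtain ⟨c, hc, h⟩ := A.exists_root_idx_eq_sum hΔ hs hα
    exact isPos_of_root_eq_sum b (c := c) (by rwa [hb]) (by rwa [hb])
  refine ⟨b, by rw [hb, hs], fun i => ⟨fun hi => ?_, ?_⟩⟩
  · obtain ⟨α, rfl⟩ := A.idx_surjective i
    rcases A.isPositive_or α with h | ⟨β, hβ, hβα⟩
    · exact ⟨α, h, rfl⟩
    · exfalso
      have h1 := hpos β hβ
      obtain ⟨y, hy⟩ := alcove_nonempty b
      have h2 := (hy _ h1).2
      have h3 := (hy _ hi).2
      rw [hβα, root_reflectionPerm_self] at h2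
      linarith
  · rintro ⟨α, hα, rfl⟩
    exact hpos α hα

end AffineRootSystem

end Base

/-! ### Conjugation of root subgroups and of G'. -/

section Conjugation

variable {F : Type*} [Field F] {n : ℕ} {D : ReductiveTriple F n}

lemma incl_val (g : GLn n F) : (incl F g).1 = bc g.1 := rfl

lemma conj_mem_rootSubgroup (g : D.N) {α : D.Char} {u : GLn n F} (hu : u ∈ D.rootSubgroup α) :
    g.1 * u * (g.1)⁻¹ ∈ D.rootSubgroup (conjChar g α) := by
  refine ⟨?_, fun mu hmu m hm hα => ?_⟩
  · rw [map_mul, map_mul, map_inv]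
    exact mul_mem (mul_mem g.2.1 hu.1) (inv_mem g.2.1)
  let mu' : (AlgebraicClosure F)ˣ →* D.S :=
    { toFun := fun t => ⟨_, inv_mul_mul_mem g (mu t).2⟩
      map_one' := by
        apply Subtype.ext
        simp
      map_mul' := fun s t => by
        apply Subtype.ext
        simp only [map_mul, Subgroup.coe_mul]
        group }
  have hmu' : IsCochar F (D.S.subtype.comp mu') := by
    obtain ⟨c, hc⟩ := hmu
    refine ⟨c.mapRange (conj (g.1)⁻¹) (map_zero _), fun t => ?_⟩
    have h1 := hc t
    change (mu t).1.1 = _ at h1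
    change ((incl F g.1)⁻¹ * (mu t).1 * incl F g.1).1 = _
    rw [Units.val_mul, Units.val_mul, h1, ← map_inv, incl_val, incl_val,
      Finsupp.sum_mapRange_index (by intro a; rw [Matrix.map_zero _ (map_zero _), smul_zero]),
      Finsupp.sum, Finsupp.sum, Finset.mul_sum, Finset.sum_mul]
    refine Finset.sum_congr rfl fun k _ => ?_
    rw [Matrix.mul_smul, Matrix.smul_mul]
    change _ = _ • bc ((g.1)⁻¹.1 * c k * ((g.1)⁻¹)⁻¹.1)
    rw [inv_inv, bc_mul, bc_mul]
  obtain ⟨P, hP⟩ := hu.2 mu' hmu' m hm fun t => by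
    rw [← hα t, conjChar_apply g α (mu t) (mu' t) rfl]
  refine ⟨(bc g.1.1).map Polynomial.C * P * (bc (g.1)⁻¹.1).map Polynomial.C, fun t => ?_⟩
  have h1 := hP t
  change ((mu' t).1 * incl F u * (mu' t).1⁻¹).1 = _ at h1
  change ((mu t).1 * incl F (g.1 * u * (g.1)⁻¹) * (mu t).1⁻¹).1 = _
  have h2 : (mu t).1 * incl F (g.1 * u * (g.1)⁻¹) * (mu t).1⁻¹ =
      incl F g.1 * ((mu' t).1 * incl F u * (mu' t).1⁻¹) * incl F (g.1)⁻¹ := by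
    simp only [mu', map_mul, map_inv, MonoidHom.coe_mk, OneHom.coe_mk]
    group
  have h3 : (incl F g.1).1 * (incl F (g.1)⁻¹).1 = 1 := by
    rw [← Units.val_mul, ← map_mul, mul_inv_cancel, map_one, Units.val_one]
  rw [h2, Units.val_mul, Units.val_mul, h1, mul_add, mul_one, add_mul, h3, Matrix.mul_smul,
    Matrix.smul_mul, map_eval_mul_map_C]
  rfl

/-- Conjugation by an element which commutes with the cocharacter. -/
lemma Contracts.conj {lam : (AlgebraicClosure F)ˣ →* GLn n (AlgebraicClosure F)}
    {u z : GLn n (AlgebraicClosure F)} (hu : Contracts lam 1 u) (hz : ∀ t, lam t * z = z * lam t) :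
    Contracts lam 1 (z * u * z⁻¹) := by
  obtain ⟨P, hP⟩ := hu
  refine ⟨z.1.map Polynomial.C * P * (z⁻¹).1.map Polynomial.C, fun t => ?_⟩
  have h1 := hP t
  have h2 : lam t * (z * u * z⁻¹) * (lam t)⁻¹ = z * (lam t * u * (lam t)⁻¹) * z⁻¹ := by
    have h3 : z⁻¹ * (lam t)⁻¹ = (lam t)⁻¹ * z⁻¹ := by
      rw [← mul_inv_rev, hz, mul_inv_rev]
    calc _ = (lam t * z) * u * (z⁻¹ * (lam t)⁻¹) := by group
      _ = _ := by
        rw [hz, h3]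
        group
  have h3 : z.1 * (z⁻¹).1 = 1 := z.mul_inv
  rw [h2, Units.val_mul, Units.val_mul, h1, mul_add, mul_one, add_mul, h3, Matrix.mul_smul,
    Matrix.smul_mul, map_eval_mul_map_C]

lemma conj_mem_G'_of_mem_Z {z u : GLn n F} (hz : z ∈ D.Z) (hu : u ∈ D.G') :
    z * u * z⁻¹ ∈ D.G' := by
  have hcomm : ∀ s ∈ D.S, s * incl F z = incl F z * s := fun s hs =>
    Subgroup.mem_centralizer_iff.1 hz.2 s hs
  have hmem : ∀ u, incl F u ∈ D.G → incl F (z * u * z⁻¹) ∈ D.G := fun u hu => by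
    rw [map_mul, map_mul, map_inv]
    exact mul_mem (mul_mem hz.1 hu) (inv_mem hz.1)
  induction hu using Subgroup.closure_induction with
  | mem u hu =>
    refine Subgroup.subset_closure ?_
    rcases hu with hu | hu
    · refine Or.inl ⟨hmem u hu.1, ?_⟩
      rw [map_mul, map_mul, map_inv]
      exact Contracts.conj hu.2 fun t => hcomm _ (D.lam t).2
    · refine Or.inr ⟨hmem u hu.1, ?_⟩
      rw [map_mul, map_mul, map_inv]
      exact Contracts.conj hu.2 fun t => hcomm _ (D.lam t⁻¹).2
  | one => simp
  | mul a b _ _ ha hb =>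
    have : z * (a * b) * z⁻¹ = (z * a * z⁻¹) * (z * b * z⁻¹) := by group
    rw [this]
    exact mul_mem ha hb
  | inv a _ ha =>
    have : z * a⁻¹ * z⁻¹ = (z * a * z⁻¹)⁻¹ := by group
    rw [this]
    exact inv_mem ha

lemma conjRoot_of_mem_Z {z : D.N} (hz : z.1 ∈ D.Z) (α : D.Root) : conjRoot z α = α :=
  Subtype.ext (conjChar_of_mem_Z z hz α.1)

lemma conjRoot_mul (g h : D.N) (α : D.Root) :
    conjRoot (g * h) α = conjRoot g (conjRoot h α) :=
  Subtype.ext (conjChar_mul g h α.1)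

end Conjugation

/-! ### The action of the Iwahori Weyl group on the apartment. -/

section Action

variable {F : Type*} [Field F] [ValuativeRel F] [TopologicalSpace F]
  [IsNonarchimedeanLocalField F] {n : ℕ} {D : ReductiveTriple F n}

/-- Elements of U and U_op are contracted by a cocharacter over `F`, hence over the maximal
unramified extension, so they are among the unipotent generators of the kernel. -/
lemma G'_le_kottwitzKernel : D.G' ≤ (kottwitzKernel D.G).comap (incl F) := by
  have hco : ∀ lam : (AlgebraicClosure F)ˣ →* GLn n (AlgebraicClosure F), IsCochar F lam →
      IsCochar (maxUnramified F) lam := by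
    rintro lam ⟨c, hc⟩
    refine ⟨c.mapRange (fun A => A.map (algebraMap F (maxUnramified F)))
      (Matrix.map_zero _ (map_zero _)), fun t => ?_⟩
    rw [hc t, Finsupp.sum_mapRange_index (by intro a; rw [Matrix.map_zero _ (map_zero _), smul_zero])]
    refine Finset.sum_congr rfl fun k _ => ?_
    dsimp only
    rw [Matrix.map_map]
    rfl
  have hE : ∀ u : GLn n F, HasEntriesIn F (maxUnramified F) (incl F u) := fun u i j =>
    (maxUnramified F).algebraMap_mem (u i j)
  have hone : HasEntriesIn F (maxUnramified F) (1 : GLn n (AlgebraicClosure F)) := by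
    have := hE 1
    rwa [map_one] at this
  refine (Subgroup.closure_le _).2 fun u hu => ?_
  refine Subgroup.subset_closure ⟨1, one_mem _, hone, incl F u, Or.inl ?_, by group⟩
  rcases hu with hu | hu
  · exact ⟨hu.1, hE u, _, hco _ D.isCochar, fun t => D.S_le_G (D.lam t).2, hu.2⟩
  · exact ⟨hu.1, hE u, _, hco _ (isCochar_comp_inv D.isCochar),
      fun t => D.S_le_G (D.lam t⁻¹).2, hu.2⟩

variable {x₀ : D.SpecialPoint}

lemma actsBy_iff {g : D.N} {f : Equiv.Perm D.Vad} : D.ActsBy x₀ g f ↔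
    ∀ x α, ∀ u ∈ D.rootSubgroup α.1,
      x₀.phi (conjRoot g⁻¹ α) ((g.1)⁻¹ * u * g.1) +
        ((D.form (conjRoot g⁻¹ α) x : ℝ) : WithTop ℝ) =
      x₀.phi α u + ((D.form α (f x) : ℝ) : WithTop ℝ) := Iff.rfl

lemma inv_conj_mem_rootSubgroup (g : D.N) {α : D.Root} {u : GLn n F}
    (hu : u ∈ D.rootSubgroup α.1) :
    (g.1)⁻¹ * u * g.1 ∈ D.rootSubgroup (conjRoot g⁻¹ α).1 := by
  have h := conj_mem_rootSubgroup g⁻¹ hu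
  rwa [Subgroup.coe_inv, inv_inv] at h

lemma ActsBy.mul {g h : D.N} {f k : Equiv.Perm D.Vad} (hg : D.ActsBy x₀ g f)
    (hh : D.ActsBy x₀ h k) : D.ActsBy x₀ (g * h) (f * k) := by
  rw [actsBy_iff] at hg hh ⊢
  intro x α u hu
  have h1 := hh x _ _ (inv_conj_mem_rootSubgroup g hu)
  have h2 := hg (k x) α u hu
  rw [h2, ← conjRoot_mul, ← mul_inv_rev] at h1
  rw [Equiv.Perm.mul_apply, ← h1]
  congr 2
  simp only [Subgroup.coe_mul]
  group

/-- A valuation takes at least three values, so some value is finite; finite values can be cancelled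
when transformations are compared. -/
lemma exists_phi_eq_coe (x₀ : D.SpecialPoint) (α : D.Root) :
    ∃ u ∈ D.rootSubgroup α.1, ∃ r : ℝ, x₀.phi α u = r := by
  by_contra! h
  have h1 : x₀.phi α '' D.rootSubgroup α.1 ⊆ {⊤} := by
    rintro _ ⟨u, hu, rfl⟩
    by_contra h2
    obtain ⟨r, hr⟩ := WithTop.ne_top_iff_exists.1 h2
    exact h u hu r hr.symm
  have h2 := (x₀.isValuation.three_values α).trans (Set.encard_le_encard h1)
  rw [Set.encard_singleton] at h2
  exact absurd h2 (by decide)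

lemma ActsBy.unique {g : D.N} {f k : Equiv.Perm D.Vad} (hf : D.ActsBy x₀ g f)
    (hk : D.ActsBy x₀ g k) : f = k := by
  refine Equiv.ext fun x => vad_ext fun α => ?_
  obtain ⟨u, hu, r, hr⟩ := exists_phi_eq_coe x₀ α
  have h1 := (actsBy_iff.1 hf x α u hu).symm.trans (actsBy_iff.1 hk x α u hu)
  rw [hr, ← WithTop.coe_add, ← WithTop.coe_add, WithTop.coe_inj] at h1
  exact add_left_cancel h1

lemma actsBy_of_mem_Z (z : D.Z) :
    D.ActsBy x₀ ⟨z.1, Z_le_N z.2⟩ (Equiv.addRight (x₀.nu z)) := by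
  rw [actsBy_iff]
  intro x α u hu
  have h1 := x₀.compatible z α u hu
  change x₀.phi (conjRoot (⟨z.1, Z_le_N z.2⟩ : D.N)⁻¹ α) ((z.1)⁻¹ * u * z.1) =
    x₀.phi α u + ((D.form α (x₀.nu z) : ℝ) : WithTop ℝ) at h1
  change x₀.phi (conjRoot (⟨z.1, Z_le_N z.2⟩ : D.N)⁻¹ α) ((z.1)⁻¹ * u * z.1) + _ = _
  have h2 : conjRoot (⟨z.1, Z_le_N z.2⟩ : D.N)⁻¹ α = α := conjRoot_of_mem_Z (inv_mem z.2) α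
  rw [h1, h2, Equiv.coe_addRight, map_add, add_comm (D.form α x), WithTop.coe_add, add_assoc]

lemma conjRoot_eq_of_actsBy_one {g : D.N} (hg : D.ActsBy x₀ g 1) (α : D.Root) :
    conjRoot g⁻¹ α = α := by
  obtain ⟨u, hu, r, hr⟩ := exists_phi_eq_coe x₀ α
  have h0 := actsBy_iff.1 hg 0 α u hu
  rw [Equiv.Perm.one_apply, map_zero, map_zero, WithTop.coe_zero, add_zero, add_zero, hr] at h0
  -- Comparing the action at `x` with the action at 0 cancels the valuation and leaves an equality
  -- of two linear forms.
  refine form_injective (LinearMap.ext fun x => ?_)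
  have h1 := actsBy_iff.1 hg x α u hu
  rw [h0, hr, ← WithTop.coe_add, ← WithTop.coe_add, WithTop.coe_inj, Equiv.Perm.one_apply] at h1
  exact add_left_cancel h1

/-- This is faithfulness of `W^aff`: a trivial action fixes the roots, which puts the element in
`Z`, and makes ν vanish; the Kottwitz condition is automatic in G'. -/
lemma mem_Z0_of_actsBy_one {g : D.N} (hg' : g.1 ∈ D.G') (hg : D.ActsBy x₀ g 1) :
    g.1 ∈ D.Z0 := by
  have hZ : g.1 ∈ D.Z := mem_Z_of_conjChar_eq g hg' fun α hα => by
    have h1 := conjRoot_eq_of_actsBy_one hg ⟨α, hα⟩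
    have h2 := conjRoot_conjRoot_inv g ⟨α, hα⟩
    rw [h1] at h2
    exact congrArg Subtype.val h2
  refine ⟨hZ, fun α => ?_, G'_le_kottwitzKernel hg'⟩
  have h1 := ActsBy.unique (actsBy_of_mem_Z (x₀ := x₀) ⟨g.1, hZ⟩) hg
  have h2 : x₀.nu ⟨g.1, hZ⟩ = 0 := by
    have := DFunLike.congr_fun h1 0
    simpa using this
  have h3 := x₀.nu_spec ⟨g.1, hZ⟩ α
  rw [h2, map_zero] at h3
  linarith

lemma nu_eq_zero_of_mem_Z0 (z : D.Z) (hz : z.1 ∈ D.Z0) : x₀.nu z = 0 :=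
  vad_ext fun α => by rw [x₀.nu_spec, hz.2.1 α, map_zero, neg_zero]

-- Since the point is special, N = Z · (N ∩ G'), and `Z` normalizes G'.
variable (D) in
lemma conj_mem_G' (x₀ : D.SpecialPoint) (g : D.N) {h : D.N} (hh : h.1 ∈ D.G') :
    g.1 * h.1 * (g.1)⁻¹ ∈ D.G' := by
  obtain ⟨k, hk, -, hz⟩ := x₀.special g
  have h1 := conj_mem_G'_of_mem_Z hz (mul_mem (mul_mem hk hh) (inv_mem hk))
  have h2 : g.1 * (k.1)⁻¹ * (k.1 * h.1 * (k.1)⁻¹) * (g.1 * (k.1)⁻¹)⁻¹ = g.1 * h.1 * (g.1)⁻¹ := by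
    group
  rwa [h2] at h1

lemma Waff_normal (x₀ : D.SpecialPoint) : D.Waff.Normal where
  conj_mem := by
    rintro _ ⟨h, hh, rfl⟩ w
    obtain ⟨g, rfl⟩ := QuotientGroup.mk_surjective w
    exact ⟨g * h * g⁻¹, conj_mem_G' D x₀ g hh, rfl⟩

namespace AffineRootSystem

variable {ι : Type*} (A : D.AffineRootSystem x₀ ι)

include A in
lemma exists_actsBy' (g : D.N) : ∃ f, D.ActsBy x₀ g f := by
  obtain ⟨h, hh, -, hz⟩ := x₀.special g
  obtain ⟨f, hf⟩ := A.exists_actsBy h hh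
  have h1 := (actsBy_of_mem_Z (x₀ := x₀) ⟨_, hz⟩).mul hf
  have h2 : (⟨g.1 * (h.1)⁻¹, Z_le_N hz⟩ : D.N) * h = g := by
    apply Subtype.ext
    simp
  rw [h2] at h1
  exact ⟨_, h1⟩

/-- The action of `N` on the apartment. -/
def action : D.N →* Equiv.Perm D.Vad :=
  MonoidHom.mk' (fun g => (A.exists_actsBy' g).choose) fun g h =>
    (A.exists_actsBy' (g * h)).choose_spec.unique
      ((A.exists_actsBy' g).choose_spec.mul (A.exists_actsBy' h).choose_spec)

lemma actsBy_action (g : D.N) : D.ActsBy x₀ g (A.action g) := (A.exists_actsBy' g).choose_spec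

lemma actsBy_iff_action_eq {g : D.N} {f : Equiv.Perm D.Vad} :
    D.ActsBy x₀ g f ↔ A.action g = f :=
  ⟨fun h => (A.actsBy_action g).unique h, fun h => h ▸ A.actsBy_action g⟩

/-- The action of the Iwahori Weyl group on the apartment. -/
def actionW : D.W →* Equiv.Perm D.Vad :=
  QuotientGroup.lift _ A.action fun z hz => by
    have hz0 : z.1 ∈ D.Z0 := hz
    rw [MonoidHom.mem_ker, ← A.actsBy_iff_action_eq]
    have h1 := actsBy_of_mem_Z (x₀ := x₀) ⟨z.1, hz0.1⟩
    rw [nu_eq_zero_of_mem_Z0 _ hz0] at h1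
    have h2 : Equiv.addRight (0 : D.Vad) = 1 := by
      ext1 x
      simp
    rwa [h2] at h1

lemma actionW_mk (g : D.N) : A.actionW (QuotientGroup.mk g) = A.action g := rfl

lemma actionW_toW (z : D.Z) : A.actionW (D.toW z) = Equiv.addRight (x₀.nu z) :=
  A.actsBy_iff_action_eq.1 (actsBy_of_mem_Z z)

lemma actionW_injOn : Set.InjOn A.actionW D.Waff := by
  intro w hw w' hw' h
  have h1 : w⁻¹ * w' ∈ D.Waff := mul_mem (inv_mem hw) hw'
  obtain ⟨g, hg, hgw⟩ := h1
  have h2 : A.action g = 1 := by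
    rw [← A.actionW_mk]
    change A.actionW (QuotientGroup.mk' _ g) = 1
    rw [hgw, map_mul, map_inv, h, inv_mul_cancel]
  have h3 := mem_Z0_of_actsBy_one hg (A.actsBy_iff_action_eq.2 h2)
  have h4 : QuotientGroup.mk' (D.Z0.subgroupOf D.N) g = 1 := (QuotientGroup.eq_one_iff g).2 h3
  rw [hgw, inv_mul_eq_one] at h4
  exact h4

lemma affineWeylGroup_eq : D.affineWeylGroup A.P = affGroup A.P := by
  rw [affineWeylGroup, affGroup]
  congr 1
  ext f
  constructor
  · rintro ⟨i, k, h⟩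
    exact ⟨i, k, Equiv.ext h⟩
  · rintro ⟨i, k, rfl⟩
    exact ⟨i, k, fun x => rfl⟩

lemma actionW_mem_affGroup {w : D.W} (hw : w ∈ D.Waff) : A.actionW w ∈ affGroup A.P := by
  obtain ⟨g, hg, rfl⟩ := hw
  rw [← A.affineWeylGroup_eq, A.mem_affineWeylGroup_iff]
  exact ⟨g, hg, A.actsBy_action g⟩

lemma exists_actionW_eq {f : Equiv.Perm D.Vad} (hf : f ∈ affGroup A.P) :
    ∃ w ∈ D.Waff, A.actionW w = f := by
  rw [← A.affineWeylGroup_eq, A.mem_affineWeylGroup_iff] at hf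
  obtain ⟨g, hg, h⟩ := hf
  exact ⟨QuotientGroup.mk g, ⟨g, hg, rfl⟩, A.actsBy_iff_action_eq.1 h⟩

variable [Finite ι]

/-- `W^aff` is normal in `W`, so the translation by ν(z) normalizes the affine Weyl group. -/
lemma exists_int_root_nu (z : D.Z) (i : ι) : ∃ m : ℤ, A.P.root i (x₀.nu z) = m := by
  refine exists_int_root_eq_of_conj_mem (P := A.P) (x₀.nu z) (fun j => ?_) i
  obtain ⟨w, hw, hwj⟩ := A.exists_actionW_eq (mem_affGroup (affRefl_mem A.P j 0))
  rw [← A.actionW_toW, ← hwj, ← map_inv, ← map_mul, ← map_mul]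
  exact A.actionW_mem_affGroup ((Waff_normal x₀).conj_mem w hw _)

lemma actionW_mem_autGroup (w : D.W) : A.actionW w ∈ autGroup A.P := by
  obtain ⟨g, rfl⟩ := QuotientGroup.mk_surjective w
  obtain ⟨h, hh, -, hz⟩ := x₀.special g
  have h2 : (⟨g.1 * (h.1)⁻¹, Z_le_N hz⟩ : D.N) * h = g := by
    apply Subtype.ext
    simp
  rw [← h2, A.actionW_mk, map_mul]
  refine mul_mem ?_ (affGroup_le_autGroup (A.actionW_mem_affGroup ⟨h, hh, rfl⟩))
  have h3 := A.actionW_toW ⟨_, hz⟩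
  change A.action ⟨g.1 * (h.1)⁻¹, Z_le_N hz⟩ = _ at h3
  rw [h3]
  exact addRight_mem_autGroup fun i => A.exists_int_root_nu _ i

end AffineRootSystem

end Action

end ReductiveTriple

end PadicGroup

namespace PadicGroup

open Module AffineWeyl

/-! ### Transport of length and Bruhat order along a homomorphism. -/

section Transport

variable {Γ Γ' : Type*} [Group Γ] [Group Γ'] {φ : Γ →* Γ'} {H : Subgroup Γ} {S : Set Γ}

lemma wordLength_image (hinj : Set.InjOn φ H) (hS : S ⊆ H) {w : Γ} (hw : w ∈ H) :
    wordLength (φ '' S) (φ w) = wordLength S w := by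
  rw [wordLength, wordLength]
  congr 1
  ext l
  constructor
  · rintro ⟨L, hL, hLw, rfl⟩
    choose! g hg hgφ using hL
    have hg' : ∀ s ∈ L.map g, s ∈ S := by
      intro s hs
      obtain ⟨t, ht, rfl⟩ := List.mem_map.1 hs
      exact hg t ht
    refine ⟨L.map g, hg', hinj (Subgroup.list_prod_mem _ fun s hs => hS (hg' s hs)) hw ?_, by simp⟩
    rw [map_list_prod, List.map_map, ← hLw]
    congr 1
    exact (List.map_congr_left fun t ht => hgφ t ht).trans (List.map_id L)
  · rintro ⟨L, hL, rfl, rfl⟩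
    refine ⟨L.map φ, fun s hs => ?_, (map_list_prod φ L).symm, by simp⟩
    obtain ⟨t, ht, rfl⟩ := List.mem_map.1 hs
    exact ⟨t, hL t ht, rfl⟩

/-- Injectivity is only required on `H`. Chains stay in the subgroup generated by the reflections,
so they lift one step at a time; `actionW` is known to be injective only on `W^aff`. -/
lemma bruhatLE_image_iff (hinj : Set.InjOn φ H) (hS : S ⊆ H) {u v : Γ} (hu : u ∈ H) (hv : v ∈ H) :
    BruhatLE (φ '' S) (φ u) (φ v) ↔ BruhatLE S u v := by
  have hcl : Subgroup.closure S ≤ H := (Subgroup.closure_le H).2 hS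
  have hmap : Subgroup.closure (φ '' S) = (Subgroup.closure S).map φ :=
    (MonoidHom.map_closure φ S).symm
  constructor
  · intro h
    have key : ∀ x, BruhatLE (φ '' S) x (φ v) → ∀ u ∈ H, φ u = x → BruhatLE S u v := by
      intro x hx
      induction hx using Relation.ReflTransGen.head_induction_on with
      | refl =>
        intro u hu hux
        rw [hinj hu hv hux]
        exact Relation.ReflTransGen.refl
      | @head x y hstep _ ih =>
        intro u hu hux
        obtain ⟨γ, hγ, _, ⟨s, hs, rfl⟩, hx, rfl, hlt⟩ := hstep
        rw [hmap] at hγ hx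
        obtain ⟨g, hg, rfl⟩ := hγ
        obtain ⟨u', hu', hux'⟩ := hx
        obtain rfl : u' = u := hinj (hcl hu') hu (hux'.trans hux.symm)
        have hmem : g * s * g⁻¹ * u' ∈ H :=
          mul_mem (mul_mem (mul_mem (hcl hg) (hS hs)) (inv_mem (hcl hg))) hu
        have heq : φ g * φ s * (φ g)⁻¹ * x = φ (g * s * g⁻¹ * u') := by
          rw [map_mul, map_mul, map_mul, map_inv, hux]
        rw [heq, ← hux, wordLength_image hinj hS hu, wordLength_image hinj hS hmem] at hlt
        exact Relation.ReflTransGen.head ⟨g, hg, s, hs, hu', rfl, hlt⟩ (ih _ hmem heq.symm)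
    exact key _ h u hu rfl
  · refine fun h => Relation.ReflTransGen.lift φ ?_ _ _ h
    rintro x _ ⟨g, hg, s, hs, hx, rfl, hlt⟩
    have hmem : g * s * g⁻¹ * x ∈ H :=
      mul_mem (mul_mem (mul_mem (hcl hg) (hS hs)) (inv_mem (hcl hg))) (hcl hx)
    refine ⟨φ g, hmap ▸ Subgroup.mem_map_of_mem φ hg, φ s, Set.mem_image_of_mem φ hs,
      hmap ▸ Subgroup.mem_map_of_mem φ hx, by simp only [map_mul, map_inv], ?_⟩
    rwa [wordLength_image hinj hS (hcl hx), wordLength_image hinj hS hmem]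

end Transport

namespace ReductiveTriple

/-! ### Root groups inside G'. -/

section RootGroups

variable {F : Type*} [Field F] {n : ℕ} {D : ReductiveTriple F n}

lemma Contracts.of_pos {lam : (AlgebraicClosure F)ˣ →* GLn n (AlgebraicClosure F)} {m : ℕ}
    (hm : 0 < m) {g : GLn n (AlgebraicClosure F)} (h : Contracts lam m g) : Contracts lam 1 g := by
  obtain ⟨P, hP⟩ := h
  refine ⟨(Polynomial.X : Polynomial (AlgebraicClosure F)) ^ (m - 1) • P, fun t => ?_⟩
  rw [hP t]
  congr 1
  ext i j
  simp only [Matrix.smul_apply, Matrix.map_apply, smul_eq_mul, Polynomial.eval_mul,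
    Polynomial.eval_pow, Polynomial.eval_X, pow_one]
  rw [← mul_assoc, ← pow_succ', Nat.sub_add_cancel hm]

/-- The condition defining the root subgroup is applied to `lam` and to its inverse. -/
lemma M'_le_G' {α : D.Root} (hα : D.IsPositive α) : D.M' α.1 ≤ D.G' := by
  obtain ⟨m, hm, hαm⟩ := hα
  refine (Subgroup.closure_le _).2 ?_
  rintro u (hu | hu)
  · exact Subgroup.subset_closure (Or.inl ⟨hu.1,
      Contracts.of_pos hm (hu.2 D.lam D.isCochar m hm hαm)⟩)
  · refine Subgroup.subset_closure (Or.inr ⟨hu.1, Contracts.of_pos hm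
      (hu.2 (D.lam.comp invMonoidHom) (isCochar_comp_inv D.isCochar) m hm fun t => ?_)⟩)
    change (α.1 (D.lam t⁻¹))⁻¹ = t ^ m
    rw [hαm, inv_pow, inv_inv]

end RootGroups

/-! ### Comparison of the orders on W and on V_ad. -/

section Order

variable {F : Type*} [Field F] [ValuativeRel F] [TopologicalSpace F]
  [IsNonarchimedeanLocalField F] {n : ℕ} {D : ReductiveTriple F n} {x₀ : D.SpecialPoint}
  {ι : Type*} [Finite ι]

namespace AffineRootSystem

variable (A : D.AffineRootSystem x₀ ι) {b : A.P.Base}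

section

variable {A} (hpos : ∀ i, b.IsPos i ↔ ∃ α, D.IsPositive α ∧ A.idx α = i)

include hpos

lemma closedAlcove_eq : A.closedAlcove = AffineWeyl.closedAlcove b := by
  ext x
  constructor
  · intro h i hi
    obtain ⟨α, hα, rfl⟩ := (hpos i).1 hi
    exact h α hα
  · intro h α hα
    exact h _ ((hpos _).2 ⟨α, hα, rfl⟩)

lemma isWallOfAlcove_iff {α : D.Root} {k : ℤ} :
    A.IsWallOfAlcove α k ↔ IsWall b (A.idx α) k := by
  rw [IsWallOfAlcove, IsWall, closedAlcove_eq hpos]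
  constructor
  · rintro ⟨x, hx, hxk, h⟩
    refine ⟨x, hx, hxk, fun j m hj y => ?_⟩
    obtain ⟨β, rfl⟩ := A.idx_surjective j
    exact h β m hj y
  · rintro ⟨x, hx, hxk, h⟩
    exact ⟨x, hx, hxk, fun β m hβ y => h _ m hβ y⟩

lemma mem_Saff_iff {w : D.W} : w ∈ A.Saff ↔ w ∈ D.Waff ∧ A.actionW w ∈ walls b := by
  constructor
  · rintro ⟨g, f, α, k, hg, rfl, hf, hfk, hw⟩
    refine ⟨⟨g, hg, rfl⟩, A.idx α, k, ?_, (isWallOfAlcove_iff hpos).1 hw⟩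
    rw [A.actionW_mk, A.actsBy_iff_action_eq.1 hf]
    exact Equiv.ext hfk
  · rintro ⟨⟨g, hg, rfl⟩, i, k, h, hw⟩
    obtain ⟨α, rfl⟩ := A.idx_surjective i
    refine ⟨g, A.action g, α, k, hg, rfl, A.actsBy_action g, fun x => ?_,
      (isWallOfAlcove_iff hpos).2 hw⟩
    change A.action g = _ at h
    rw [h]
    rfl

lemma image_Saff : A.actionW '' A.Saff = walls b := by
  ext t
  constructor
  · rintro ⟨w, hw, rfl⟩
    exact ((mem_Saff_iff hpos).1 hw).2
  · intro ht
    obtain ⟨a, ha⟩ := alcove_nonempty b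
    obtain ⟨w, hw, rfl⟩ := A.exists_actionW_eq (mem_affGroup ((isWallSet_walls ha).subset ht))
    exact ⟨w, (mem_Saff_iff hpos).2 ⟨hw, ht⟩, rfl⟩

lemma bruhatLE_walls_iff {u v : D.W} (hu : u ∈ D.Waff) (hv : v ∈ D.Waff) :
    BruhatLE (walls b) (A.actionW u) (A.actionW v) ↔ BruhatLE A.Saff u v := by
  rw [← image_Saff hpos]
  exact bruhatLE_image_iff A.actionW_injOn (fun w hw => ((mem_Saff_iff hpos).1 hw).1) hu hv

lemma conj_mem_walls_of_mem_Omega {u : D.W} (hu : u ∈ A.Omega) :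
    ∀ s ∈ walls b, A.actionW u * s * (A.actionW u)⁻¹ ∈ walls b := by
  intro s hs
  rw [← image_Saff hpos] at hs ⊢
  obtain ⟨w, hw, rfl⟩ := hs
  exact ⟨_, (hu w).1 hw, by simp only [map_mul, map_inv]⟩

/-- An element whose action preserves the base alcove permutes its walls, and so does its inverse;
normality of `W^aff` does the rest. -/
lemma mem_Omega_of_not_separates {a : D.Vad} (ha : a ∈ alcove b) {u : D.W}
    (h : ∀ t, ¬ Separates A.P t a (A.actionW u a)) : u ∈ A.Omega := by
  have hu := A.actionW_mem_autGroup u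
  have hn := Waff_normal x₀
  have h' : ∀ t, ¬ Separates A.P t a ((A.actionW u)⁻¹ a) := by
    intro t ht
    have h1 := (separates_conj hu).2 ht
    rw [← Equiv.Perm.mul_apply, mul_inv_cancel, Equiv.Perm.one_apply] at h1
    exact h _ h1.symm
  intro s
  rw [mem_Saff_iff hpos, mem_Saff_iff hpos, map_mul, map_mul, map_inv]
  constructor
  · rintro ⟨h1, h2⟩
    exact ⟨hn.conj_mem s h1 u, conj_mem_walls ha hu h h2⟩
  · rintro ⟨h1, h2⟩
    have h3 := hn.conj_mem _ h1 u⁻¹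
    have h4 := conj_mem_walls ha (inv_mem hu) h' h2
    have h5 : u⁻¹ * (u * s * u⁻¹) * u⁻¹⁻¹ = s := by group
    have h6 : (A.actionW u)⁻¹ * (A.actionW u * A.actionW s * (A.actionW u)⁻¹) *
        (A.actionW u)⁻¹⁻¹ = A.actionW s := by group
    rw [h5] at h3
    rw [h6] at h4
    exact ⟨h3, h4⟩

end

lemma addRight_injective : Function.Injective (Equiv.addRight : D.Vad → Equiv.Perm D.Vad) := by
  intro x y h
  have := DFunLike.congr_fun h 0
  simpa using this

lemma addRight_add_eq_mul (x y : D.Vad) :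
    Equiv.addRight (x + y) = Equiv.addRight x * Equiv.addRight y := by
  ext1 z
  simp only [Equiv.Perm.mul_apply, Equiv.coe_addRight]
  abel

lemma actionW_eq_addRight_sub {z₁ z₂ : D.Z} {w : D.W} (h : D.toW z₁ = D.toW z₂ * w) :
    A.actionW w = Equiv.addRight (x₀.nu z₁ - x₀.nu z₂) := by
  have h1 := congrArg A.actionW h
  rw [map_mul, A.actionW_toW, A.actionW_toW] at h1
  have h2 : Equiv.addRight (x₀.nu z₁) =
      Equiv.addRight (x₀.nu z₂) * Equiv.addRight (x₀.nu z₁ - x₀.nu z₂) := by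
    rw [← addRight_add_eq_mul]
    congr 1
    abel
  rw [h2] at h1
  exact (mul_left_cancel h1).symm

section

variable {Δ : Set D.Root} {a : Δ → D.Z}

lemma toW_mem_Waff (hΔ : D.IsSimpleRoots Δ) (ha : ∀ α, (a α).1 ∈ D.M' α.1.1) (α : Δ) :
    D.toW (a α) ∈ D.Waff :=
  ⟨⟨(a α).1, Z_le_N (a α).2⟩, M'_le_G' (hΔ.1 α.1 α.2) (ha α), rfl⟩

lemma exists_actionW_of_mem_closure (hνa : ∀ α, x₀.nu (a α) = A.corootA α.1) {m : D.W}
    (hm : m ∈ Submonoid.closure (Set.range fun α => D.toW (a α))) :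
    ∃ y ∈ AddSubmonoid.closure (A.corootA '' Δ), A.actionW m = Equiv.addRight y := by
  induction hm using Submonoid.closure_induction with
  | mem m hm =>
    obtain ⟨α, rfl⟩ := hm
    refine ⟨A.corootA α.1, AddSubmonoid.subset_closure (Set.mem_image_of_mem _ α.2), ?_⟩
    rw [← hνa]
    exact A.actionW_toW (a α)
  | one =>
    refine ⟨0, zero_mem _, ?_⟩
    rw [map_one]
    ext1 x
    simp
  | mul m m' _ _ h h' =>
    obtain ⟨y, hy, h⟩ := h
    obtain ⟨y', hy', h'⟩ := h'
    exact ⟨y + y', add_mem hy hy', by rw [map_mul, h, h', addRight_add_eq_mul]⟩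

lemma exists_mem_closure_actionW_eq (hνa : ∀ α, x₀.nu (a α) = A.corootA α.1) {y : D.Vad}
    (hy : y ∈ AddSubmonoid.closure (A.corootA '' Δ)) :
    ∃ m ∈ Submonoid.closure (Set.range fun α => D.toW (a α)),
      A.actionW m = Equiv.addRight y := by
  induction hy using AddSubmonoid.closure_induction with
  | mem y hy =>
    obtain ⟨α, hα, rfl⟩ := hy
    refine ⟨D.toW (a ⟨α, hα⟩), Submonoid.subset_closure ⟨⟨α, hα⟩, rfl⟩, ?_⟩
    rw [A.actionW_toW, hνa]
  | zero =>
    refine ⟨1, one_mem _, ?_⟩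
    rw [map_one]
    ext1 x
    simp
  | add y y' _ _ h h' =>
    obtain ⟨m, hm, h⟩ := h
    obtain ⟨m', hm', h'⟩ := h'
    exact ⟨m * m', mul_mem hm hm', by rw [map_mul, h, h', addRight_add_eq_mul]⟩

lemma closure_le_Waff (hΔ : D.IsSimpleRoots Δ) (ha : ∀ α, (a α).1 ∈ D.M' α.1.1) :
    Submonoid.closure (Set.range fun α => D.toW (a α)) ≤ D.Waff.toSubmonoid := by
  refine Submonoid.closure_le.2 ?_
  rintro _ ⟨α, rfl⟩
  exact toW_mem_Waff hΔ ha α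

lemma antidominant_nu (hb : (b.support : Set ι) = A.idx '' Δ) {z : D.Z}
    (hz : x₀.IsDominant Δ z) : Antidominant b (x₀.nu z) := by
  intro i hi
  rw [← Finset.mem_coe, hb] at hi
  obtain ⟨α, hα, rfl⟩ := hi
  have h1 := hz α hα
  rw [map_neg] at h1
  rw [A.root_idx_apply]
  exact mul_nonpos_of_nonneg_of_nonpos (A.e_pos_real α).le (by linarith)

lemma corootA_image (hb : (b.support : Set ι) = A.idx '' Δ) :
    A.corootA '' Δ = A.P.coroot '' b.support := by
  rw [hb, Set.image_image]
  rfl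

/-- The Bruhat order between dominant elements implies the order of their translations. -/
lemma vadLE_of_WLE (hb : (b.support : Set ι) = A.idx '' Δ)
    (hpos : ∀ i, b.IsPos i ↔ ∃ α, D.IsPositive α ∧ A.idx α = i) {z₁ z₂ : D.Z}
    (h₂ : x₀.IsDominant Δ z₂) (h : A.WLE (D.toW z₁) (D.toW z₂)) :
    A.VadLE Δ (x₀.nu z₁) (x₀.nu z₂) ∧ ∃ w ∈ D.Waff, D.toW z₁ = D.toW z₂ * w := by
  obtain ⟨w₁, hw₁, w₂, hw₂, u, hu, e₁, e₂, hle⟩ := h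
  -- The factors in `W^aff` are followed through the image of the vertex 0 under `u`, which they
  -- move to the translation vectors.
  have hval : ∀ (z : D.Z) (w : D.W), D.toW z = w * u →
      A.actionW w (A.actionW u 0) = x₀.nu z := by
    intro z w e
    rw [← Equiv.Perm.mul_apply, ← map_mul, ← e, A.actionW_toW]
    simp
  have hmem : u⁻¹ * (w₂⁻¹ * w₁) * u⁻¹⁻¹ ∈ D.Waff :=
    (Waff_normal x₀).conj_mem _ (mul_mem (inv_mem hw₂) hw₁) u⁻¹
  have heq : D.toW z₁ = D.toW z₂ * (u⁻¹ * (w₂⁻¹ * w₁) * u⁻¹⁻¹) := by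
    rw [e₁, e₂]
    group
  have hlat : x₀.nu z₁ - x₀.nu z₂ ∈ corootLattice A.P := by
    have h1 := apply_mem_corootLattice (A.actionW_mem_affGroup hmem) (zero_mem _)
    rw [A.actionW_eq_addRight_sub heq] at h1
    simpa using h1
  refine ⟨?_, _, hmem, heq⟩
  rw [VadLE, A.corootA_image hb]
  exact mem_closure_of_inCone (inCone_sub_of_bruhatLE (A.actionW_mem_autGroup u)
    (conj_mem_walls_of_mem_Omega hpos hu) (A.antidominant_nu hb h₂) (hval z₁ w₁ e₁)
    (hval z₂ w₂ e₂) ((bruhatLE_walls_iff hpos hw₁ hw₂).2 hle)) hlat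

/-- The order of the translations implies the Bruhat order between dominant elements. -/
lemma WLE_of_vadLE (hb : (b.support : Set ι) = A.idx '' Δ)
    (hpos : ∀ i, b.IsPos i ↔ ∃ α, D.IsPositive α ∧ A.idx α = i) {z₁ z₂ : D.Z}
    (h₁ : x₀.IsDominant Δ z₁) (h₂ : x₀.IsDominant Δ z₂)
    (h : A.VadLE Δ (x₀.nu z₁) (x₀.nu z₂)) {w : D.W} (hw : w ∈ D.Waff)
    (hzw : D.toW z₁ = D.toW z₂ * w) : A.WLE (D.toW z₁) (D.toW z₂) := by
  obtain ⟨a, ha⟩ := alcove_nonempty b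
  have hn := Waff_normal x₀
  have hreg := regular_of_mem_alcove ha
  -- Bring the alcove of λ₂ back to the base alcove by some v in `W^aff`. Then u = v λ₂ lies in Ω,
  -- and the same u serves for λ₁ because λ₁ ∈ λ₂ `W^aff`.
  obtain ⟨f, hf, hsep⟩ := (isWallSet_walls ha).exists_forall_not_separates
    (hreg.apply (A.actionW_mem_autGroup (D.toW z₂)))
  obtain ⟨v, hv, rfl⟩ := A.exists_actionW_eq hf
  rw [← Equiv.Perm.mul_apply, ← map_mul] at hsep
  obtain ⟨u, hu⟩ : ∃ u, u = v * D.toW z₂ := ⟨_, rfl⟩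
  rw [← hu] at hsep
  have hsep' : ∀ t, ¬ Separates A.P t a ((A.actionW u)⁻¹ a) := by
    intro t ht
    have h1 := (separates_conj (A.actionW_mem_autGroup u)).2 ht
    rw [← Equiv.Perm.mul_apply, mul_inv_cancel, Equiv.Perm.one_apply] at h1
    exact hsep _ h1.symm
  have hc := mem_alcove_of_not_separates ha
    (hreg.apply (inv_mem (A.actionW_mem_autGroup u))) hsep'
  have hz₂ : D.toW z₂ = v⁻¹ * u := by
    rw [hu, inv_mul_cancel_left]
  have hmem : D.toW z₁ * u⁻¹ ∈ D.Waff := by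
    have h1 : D.toW z₁ * u⁻¹ = v⁻¹ * (u * w * u⁻¹) := by
      rw [hzw, hz₂]
      group
    rw [h1]
    exact mul_mem (inv_mem hv) (hn.conj_mem w hw u)
  refine ⟨D.toW z₁ * u⁻¹, hmem, v⁻¹, inv_mem hv, u, mem_Omega_of_not_separates hpos ha hsep,
    by rw [inv_mul_cancel_right], hz₂, (bruhatLE_walls_iff hpos hmem (inv_mem hv)).1 ?_⟩
  have e₁ : A.actionW (D.toW z₁ * u⁻¹) = Equiv.addRight (x₀.nu z₁) * (A.actionW u)⁻¹ := by
    rw [map_mul, map_inv, A.actionW_toW]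
  have e₂ : A.actionW v⁻¹ = Equiv.addRight (x₀.nu z₂) * (A.actionW u)⁻¹ := by
    rw [← A.actionW_toW, ← map_inv, ← map_mul, hz₂, mul_inv_cancel_right]
  rw [e₁, e₂]
  -- Both components in `W^aff` are a translation after the inverse of `u`, and that inverse maps
  -- `a` to another point of the base alcove.
  refine bruhatLE_addRight ha hc rfl (A.antidominant_nu hb h₁) (A.antidominant_nu hb h₂)
    (A.exists_int_root_nu z₂) ?_ ?_
  · rw [← e₂]
    exact A.actionW_mem_affGroup (inv_mem hv)
  · rw [← A.corootA_image hb]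
    exact h

end

end AffineRootSystem

end Order

end ReductiveTriple

end PadicGroup

end

open PadicGroup in
theorem proposition4p1 {F : Type*} [Field F] [ValuativeRel F] [TopologicalSpace F]
    [IsNonarchimedeanLocalField F] {n : ℕ} (D : ReductiveTriple F n) (x₀ : D.SpecialPoint)
    {ι : Type*} [Finite ι] (A : D.AffineRootSystem x₀ ι)
    (Δ : Set D.Root) (hΔ : D.IsSimpleRoots Δ)
    (a : Δ → D.Z) (ha : ∀ α, (a α).1 ∈ D.M' α.1.1) (hνa : ∀ α, x₀.nu (a α) = A.corootA α.1)
    (z₁ z₂ : D.Z) (h₁ : x₀.IsDominant Δ z₁) (h₂ : x₀.IsDominant Δ z₂) :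
    [A.WLE (D.toW z₁) (D.toW z₂),
      ∃ m ∈ Submonoid.closure (Set.range fun α => D.toW (a α)), D.toW z₁ = D.toW z₂ * m,
      A.VadLE Δ (x₀.nu z₁) (x₀.nu z₂) ∧ ∃ w ∈ D.Waff, D.toW z₁ = D.toW z₂ * w].TFAE := by
  obtain ⟨b, hb, hpos⟩ := A.exists_base hΔ
  have hle := ReductiveTriple.AffineRootSystem.closure_le_Waff hΔ ha
  tfae_have 1 → 3 := A.vadLE_of_WLE hb hpos h₂
  tfae_have 3 → 1 := by
    rintro ⟨h, w, hw, hzw⟩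
    exact A.WLE_of_vadLE hb hpos h₁ h₂ h hw hzw
  tfae_have 2 → 3 := by
    rintro ⟨m, hm, hzm⟩
    obtain ⟨y, hy, hmy⟩ := A.exists_actionW_of_mem_closure hνa hm
    rw [A.actionW_eq_addRight_sub hzm] at hmy
    refine ⟨?_, m, hle hm, hzm⟩
    rw [ReductiveTriple.AffineRootSystem.VadLE,
      ReductiveTriple.AffineRootSystem.addRight_injective hmy]
    exact hy
  tfae_have 3 → 2 := by
    rintro ⟨h, w, hw, hzw⟩
    obtain ⟨m, hm, hmw⟩ := A.exists_mem_closure_actionW_eq hνa h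
    rw [← A.actionW_eq_addRight_sub hzw] at hmw
    -- The product of the λ_α and `w` both lie in `W^aff` and act by the same translation, so they
    -- are equal.
    exact ⟨m, hm, by rw [A.actionW_injOn (hle hm) hw hmw, hzw]⟩
  tfae_finish
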